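/- Conventions. A log-Riemann surface is a connected Riemann surface $\mathcal S$ together with a local diffeomorphism (local biholomorphism) $\pi:\mathcal S\to\mathbb C$ such that the set $\mathcal R$ of points added in the completion $\mathcal S^*=\mathcal S\sqcup\mathcal R$ of $\mathcal S$, for the path metric $d$ induced by the flat metric $|d\pi|$, is discrete. The points of $\mathcal R$ are the ramification points. The map $\pi$ extends continuously to $\mathcal S^*$. A point $w\in\mathcal R$ has order $m\in\{1,2,\dots,\infty\}$ if some open neighbourhood of $w$ in $\mathcal S^*$ has the form $\{w\}\cup W$ with $W\subset\mathcal S$ connected and mapped by $\pi$, as an $m$-sheeted covering, onto a punctured disc centred at $\pi(w)$. The finite completion $\mathcal S^\times\subset\mathcal S^*$ is $\mathcal S$ together with its ramification points of finite order. A pointed log-Riemann surface is a pair $(\mathcal S,p)$ with $p\in\mathcal S$. Pointed log-Riemann surfaces $(\mathcal S_n,p_n)$, with projections $\pi_n$, converge to $(\mathcal S,p)$ in the Carathéodory topology if for every compact $K\subset\mathcal S$ containing $p$ there is $N=N(K)$ such that for all $n\ge N$ there is an isometric embedding $\iota_{n,K}$ of $K$ into $\mathcal S_n$ with $\iota_{n,K}(p)=p_n$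 that is a translation in the charts $\pi,\pi_n$. Here isometric embedding is meant in the sense of the flat metrics: $\iota_{n,K}$ is defined on a connected open set $U\supset K$, it is continuous and injective there, $\pi_n\circ\iota_{n,K}=\pi+c$ on $U$ for a constant $c\in\mathbb C$, and it carries the path metric of $U$ induced by $|d\pi|$ to the path metric of $\iota_{n,K}(U)$ induced by $|d\pi_n|$. Theorem 2.10 (truncation). Let $(\mathcal S,p)$ be a pointed log-Riemann surface. There is a sequence of pointed log-Riemann surfaces $(\mathcal S_n,p_n)$ converging to $(\mathcal S,p)$ in the Carathéodory topology such that (1) each $\mathcal S_n$ has only finitely many ramification points, all of finite order; (2) if $\mathcal S^\times$ is simply connected, then all the surfaces $\mathcal S_n^\times$ are simply connected. -/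

import Mathlib

open Set Filter Topology
open scoped Manifold ContDiff ENNReal

universe u v

noncomputable section

/-! ### The flat path metric of a map `π : X → ℂ` and its completion -/

section FlatMetric

variable {X : Type u} [TopologicalSpace X]

/-- The flat length `∫_γ |dπ|` of a path `γ`, as the total variation of `π ∘ γ`
(it is `∞` when the path is not rectifiable). -/
def flatLength (π : X → ℂ) {x y : X} (γ : Path x y) : ℝ≥0∞ :=
  eVariationOn (π ∘ γ) univ

/-- The path distance of `|dπ|` inside a subset `U`: the infimum of the flat lengths of the paths
from `x` to `y` that stay in `U` (it is `∞` when there is no such rectifiable path). -/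
def flatEDistIn (π : X → ℂ) (U : Set X) (x y : X) : ℝ≥0∞ :=
  ⨅ (γ : Path x y) (_ : ∀ t, γ t ∈ U), flatLength π γ

/-- The path distance `d` on `X` induced by `|dπ|`. -/
def flatEDist (π : X → ℂ) (x y : X) : ℝ≥0∞ :=
  ⨅ γ : Path x y, flatLength π γ

theorem flatLength_refl (π : X → ℂ) (x : X) : flatLength π (Path.refl x) = 0 := by
  unfold flatLength
  refine eVariationOn.constant_on ?_
  rintro _ ⟨s, -, rfl⟩ _ ⟨t, -, rfl⟩
  rfl

theorem flatLength_symm_le (π : X → ℂ) {x y : X} (γ : Path x y) :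
    flatLength π γ.symm ≤ flatLength π γ := by
  unfold flatLength
  have h : (π ∘ γ.symm : unitInterval → ℂ) = (π ∘ γ) ∘ unitInterval.symm := by
    ext t
    rfl
  rw [h]
  refine eVariationOn.comp_le_of_antitoneOn _ _ ?_ (fun _ _ => mem_univ _)
  intro s _ t _ hst
  exact unitInterval.symm_le_symm.mpr hst

theorem flatLength_trans_le (π : X → ℂ) {x y z : X} (γ : Path x y) (δ : Path y z) :
    flatLength π (γ.trans δ) ≤ flatLength π γ + flatLength π δ := by
  unfold flatLength
  have hhalf : (1 / 2 : ℝ) ∈ unitInterval := by constructor <;> norm_num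
  let m : unitInterval := ⟨1 / 2, hhalf⟩
  have hU : (univ : Set unitInterval) = Iic m ∪ Ici m := (Iic_union_Ici).symm
  rw [hU, eVariationOn.union (x := m) _ isGreatest_Iic isLeast_Ici]
  refine add_le_add ?_ ?_
  · let φ : unitInterval → unitInterval := fun t => projIcc 0 1 zero_le_one (2 * (t : ℝ))
    have h : EqOn (π ∘ (γ.trans δ)) ((π ∘ γ) ∘ φ) (Iic m) := by
      intro t ht
      have ht' : (t : ℝ) ≤ 1 / 2 := ht
      simp only [Function.comp_apply, Path.trans_apply, ht', dif_pos, φ]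
      congr 2
      rw [projIcc_of_mem zero_le_one]
    rw [eVariationOn.congr h, hU.symm]
    refine eVariationOn.comp_le_of_monotoneOn _ _ ?_ (fun _ _ => mem_univ _)
    intro s _ t _ hst
    exact monotone_projIcc _ (by have : (s : ℝ) ≤ t := hst; linarith)
  · let φ : unitInterval → unitInterval := fun t => projIcc 0 1 zero_le_one (2 * (t : ℝ) - 1)
    have h : EqOn (π ∘ (γ.trans δ)) ((π ∘ δ) ∘ φ) (Ici m) := by
      intro t ht
      have ht' : 1 / 2 ≤ (t : ℝ) := ht
      simp only [Function.comp_apply, Path.trans_apply, φ]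
      split_ifs with h1
      · have h2 : (t : ℝ) = 1 / 2 := le_antisymm h1 ht'
        simp [h2]
      · congr 2
        rw [projIcc_of_mem zero_le_one]
    rw [eVariationOn.congr h, hU.symm]
    refine eVariationOn.comp_le_of_monotoneOn _ _ ?_ (fun _ _ => mem_univ _)
    intro s _ t _ hst
    exact monotone_projIcc _ (by have : (s : ℝ) ≤ t := hst; linarith)

theorem flatEDist_self (π : X → ℂ) (x : X) : flatEDist π x x = 0 :=
  le_antisymm ((iInf_le _ (Path.refl x)).trans (flatLength_refl π x).le) bot_le

theorem flatEDist_comm_le (π : X → ℂ) (x y : X) : flatEDist π x y ≤ flatEDist π y x :=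
  le_iInf fun γ => (iInf_le _ γ.symm).trans (flatLength_symm_le π γ)

theorem flatEDist_triangle (π : X → ℂ) (x y z : X) :
    flatEDist π x z ≤ flatEDist π x y + flatEDist π y z :=
  ENNReal.le_iInf_add_iInf fun γ δ =>
    (iInf_le _ (γ.trans δ)).trans (flatLength_trans_le π γ δ)

/-- `π` is 1-Lipschitz for the path distance. -/
theorem edist_le_flatEDist (π : X → ℂ) (x y : X) : edist (π x) (π y) ≤ flatEDist π x y := by
  refine le_iInf fun γ => ?_
  have h := eVariationOn.edist_le (π ∘ γ) (mem_univ (0 : unitInterval))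
    (mem_univ (1 : unitInterval))
  simpa [flatLength] using h

/-- The type `X` regarded as a metric space through the path distance of `|dπ|`. -/
def FlatSpace (_π : X → ℂ) : Type u := X

instance FlatSpace.instPseudoEMetricSpace (π : X → ℂ) : PseudoEMetricSpace (FlatSpace π) where
  edist x y := flatEDist (X := X) π x y
  edist_self x := flatEDist_self (X := X) π x
  edist_comm x y := le_antisymm (flatEDist_comm_le (X := X) π x y) (flatEDist_comm_le (X := X) π y x)
  edist_triangle x y z := flatEDist_triangle (X := X) π x y z

/-- The completion `X*` of `X` with respect to the flat path metric. -/
abbrev FlatCompletion (π : X → ℂ) : Type u := UniformSpace.Completion (FlatSpace π)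

/-- The canonical map `X → X*`. -/
def toFlatCompletion (π : X → ℂ) (x : X) : FlatCompletion π :=
  UniformSpace.Completion.coe' (α := FlatSpace π) x

/-- The set of points added in the completion. -/
def ramificationSet (π : X → ℂ) : Set (FlatCompletion π) :=
  (range (toFlatCompletion π))ᶜ

/-- The continuous extension of `π` to the completion. -/
def flatExtension (π : X → ℂ) : FlatCompletion π → ℂ :=
  UniformSpace.Completion.extension (α := FlatSpace π) π

theorem uniformContinuous_flat (π : X → ℂ) :
    UniformContinuous (show FlatSpace π → ℂ from π) := by
  refine LipschitzWith.uniformContinuous (K := 1) fun x y => ?_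
  rw [ENNReal.coe_one, one_mul]
  exact edist_le_flatEDist (X := X) π x y

theorem flatExtension_toFlatCompletion (π : X → ℂ) (x : X) :
    flatExtension π (toFlatCompletion π x) = π x :=
  UniformSpace.Completion.extension_coe (uniformContinuous_flat π) x

/-- The added point `w` has order `m ∈ {1, 2, …, ∞}`: some open neighbourhood of `w` consists of
`w` and of a connected set `W` of points of `X` which `π` maps, as an `m`-sheeted covering,
onto a punctured disc around the projection of `w`. -/
def HasRamificationOrder (π : X → ℂ) (w : FlatCompletion π) (m : ℕ∞) : Prop :=
  w ∈ ramificationSet π ∧ m ≠ 0 ∧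
    ∃ (r : ℝ) (W : Set X), 0 < r ∧ IsConnected W ∧
      IsOpen (insert w (toFlatCompletion π '' W)) ∧
      ∃ h : MapsTo π W (Metric.ball (flatExtension π w) r \ {flatExtension π w}),
        IsCoveringMap h.restrict ∧ ∀ z, (h.restrict ⁻¹' {z}).encard = m

/-- The added point `w` has finite order. -/
def HasFiniteRamificationOrder (π : X → ℂ) (w : FlatCompletion π) : Prop :=
  ∃ m : ℕ, HasRamificationOrder π w m

end FlatMetric

/-! ### Log-Riemann surfaces -/

/-- A log-Riemann surface: a Riemann surface (a connected Hausdorff complex manifold of dimension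
one) with a local diffeomorphism `π` to `ℂ`, such that the set of points added in the completion for
the flat path metric `|dπ|` is discrete. -/
structure LogRiemannSurface : Type (u + 1) where
  carrier : Type u
  [topologicalSpace : TopologicalSpace carrier]
  [t2Space : T2Space carrier]
  [connectedSpace : ConnectedSpace carrier]
  [chartedSpace : ChartedSpace ℂ carrier]
  [isManifold : IsManifold 𝓘(ℂ) ω carrier]
  π : carrier → ℂ
  isLocalDiffeomorph : IsLocalDiffeomorph 𝓘(ℂ) 𝓘(ℂ) ω π
  discrete : DiscreteTopology (ramificationSet π)

namespace LogRiemannSurface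

instance : CoeSort LogRiemannSurface.{u} (Type u) := ⟨LogRiemannSurface.carrier⟩

attribute [instance] LogRiemannSurface.topologicalSpace LogRiemannSurface.t2Space
  LogRiemannSurface.connectedSpace LogRiemannSurface.chartedSpace LogRiemannSurface.isManifold

/-- The set of ramification points. -/
def ram (S : LogRiemannSurface.{u}) : Set (FlatCompletion S.π) := ramificationSet S.π

/-- The finite completion: the surface together with its ramification points of finite order,
with the topology of the completion. -/
def finiteCompletion (S : LogRiemannSurface.{u}) : Set (FlatCompletion S.π) :=
  range (toFlatCompletion S.π) ∪ {w | HasFiniteRamificationOrder S.π w}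

/-- `ι` is an isometric embedding of a neighbourhood of `K` in `S` into `T` for the flat metrics,
and a translation in the charts `π`: on some connected open set `U ⊇ K` it is continuous and
injective, reads `z ↦ z + c` through the projections, and carries the path metric of `U` to that
of its image. -/
def IsIsometricEmbeddingOn (S : LogRiemannSurface.{u}) (T : LogRiemannSurface.{v})
    (K : Set S) (ι : S → T) : Prop :=
  ∃ U : Set S, IsOpen U ∧ IsConnected U ∧ K ⊆ U ∧ ContinuousOn ι U ∧ InjOn ι U ∧
    (∃ c : ℂ, ∀ x ∈ U, T.π (ι x) = S.π x + c) ∧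
    ∀ x ∈ U, ∀ y ∈ U, flatEDistIn T.π (ι '' U) (ι x) (ι y) = flatEDistIn S.π U x y

/-- Carathéodory convergence `(T n, q n) → (S, p)` of pointed log-Riemann surfaces. -/
def CaratheodoryConverges (T : ℕ → LogRiemannSurface.{v}) (q : ∀ n, T n)
    (S : LogRiemannSurface.{u}) (p : S) : Prop :=
  ∀ K : Set S, IsCompact K → p ∈ K → ∃ N : ℕ, ∀ n ≥ N,
    ∃ ι : S → T n, IsIsometricEmbeddingOn S (T n) K ι ∧ ι p = q n

end LogRiemannSurface

end

/-! A connected surface spread over the plane is σ-compact (Poincaré–Volterra,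
`IsLocalHomeomorph.sigmaCompactSpace`). It therefore suffices to embed a neighbourhood of one
compact set `K` isometrically into a surface of the required kind, and then to let `K` run through a
compact exhaustion. A continuous injection that commutes with the projections preserves the path
metrics (`flatEDistIn_image`), so only the topology of the embedding is at stake.

The targets are finite branched coverings of the plane, encoded by the permutations of finitely many
sheets met on crossing vertical slits. Such a covering is proper over `ℂ`, hence it is the flat
completion of its regular part (`exists_homeomorph_flatCompletion`). Its ramification points come
from the nontrivial cycles at the nodes and have the lengths of these cycles as orders, so they are
finitely many, of finite order, and the finite completion is the whole covering.

To embed a compact set of points of finite order (regular points count as cones with one sheet),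
cover it by finitely many finite cones and cut the plane by a rectangular grid adapted to them. Only
finitely many lifts of cells occur, and the gluings between lifts of two cells form a partial
injection of this finite set. It extends to a permutation. Any choice of permutations defines a
covering of the plane minus the grid vertices, since every compatibility condition would sit at a
vertex (`exists_isCoveringMap_of_cells`, `exists_slitData_of_halfCones`). After a rotation the
vertices have distinct real parts, the covering can be cut along vertical slits
(`exists_slitData_of_isCoveringMapOn`), and the map extends over the omitted fibres
(`exists_slitData_of_isCompact`). A connected neighbourhood of `K` lands in one connected component
of the result.

If the finite completion is simply connected, the finite covering just obtained may still have
nontrivial topology. It is replaced by its tree of words, a covering of it in which sheets are glued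
cycle by cycle along a tree. The embedding lifts to this tree near `K`, provided it was constructed
on a compact set large enough to contain the paths and homotopies that make the lift well defined
(`exists_isCompact_lift`). By compactness only words of bounded length are met. Cutting off the
longer ones leaves finitely many sheets glued along a tree, which is simply connected by van Kampen
(`SlitData.IsTree.simplyConnectedSpace`). -/

noncomputable section

/-! ### Branched coverings of the plane given by vertical slits -/

/-- Combinatorial data of a branched covering of `ℂ` with set of sheets `I`: over each `a : ℝ` the
plane is slit along the vertical ray above the node `(a, height a)`, and crossing that slit from
left to right permutes the sheets by `perm a`. -/
structure SlitData (I : Type u) where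
  height : ℝ → ℝ
  perm : ℝ → Equiv.Perm I
  finite_support : {a | perm a ≠ 1}.Finite

namespace SlitData

variable {I : Type u} (D : SlitData I)

/-- The node over the abscissa `a`. -/
def node (a : ℝ) : ℂ := ⟨a, D.height a⟩

/-- The permutation met when crossing the vertical line through `z` at `z` from left to right. -/
def cross (z : ℂ) : Equiv.Perm I :=
  open Classical in if D.height z.re < z.im then D.perm z.re else 1

/-- Sheet `i'` at the nearby point `z'` is reached from sheet `i` at `z`. -/
def Rel (z z' : ℂ) (i i' : I) : Prop :=
  open Classical in
  -- At a node every sheet of the cycle is reached. Elsewhere a point of the vertical line counts as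
  -- belonging to its left side, so the label changes only towards a strictly larger abscissa.
  if z.im = D.height z.re then (D.perm z.re).SameCycle i i'
  else i' = if z'.re ≤ z.re then i else D.cross z i

theorem rel_node {z z' : ℂ} {i i' : I} (h : z.im = D.height z.re) :
    D.Rel z z' i i' ↔ (D.perm z.re).SameCycle i i' := by simp [Rel, h]

theorem rel_of_le {z z' : ℂ} {i i' : I} (h : z.im ≠ D.height z.re) (h' : z'.re ≤ z.re) :
    D.Rel z z' i i' ↔ i' = i := by simp [Rel, h, h']

theorem rel_of_lt {z z' : ℂ} {i i' : I} (h : z.im ≠ D.height z.re) (h' : z.re < z'.re) :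
    D.Rel z z' i i' ↔ i' = D.cross z i := by simp [Rel, h, h'.not_ge]

theorem rel_self {z : ℂ} {i i' : I} (h : z.im ≠ D.height z.re) :
    D.Rel z z i i' ↔ i' = i := D.rel_of_le h le_rfl

theorem rel_refl (z : ℂ) (i : I) : D.Rel z z i i := by
  by_cases h : z.im = D.height z.re
  · rw [rel_node _ h]
  · rw [rel_self _ h]

theorem rel_symm {z : ℂ} {i i' : I} (h : D.Rel z z i i') : D.Rel z z i' i := by
  by_cases hz : z.im = D.height z.re
  · rw [rel_node _ hz] at *; exact h.symm
  · rw [rel_self _ hz] at *; exact h.symm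

theorem Rel.trans_left {D : SlitData I} {z z' : ℂ} {i k i' : I} (h : D.Rel z z i k)
    (h' : D.Rel z z' k i') : D.Rel z z' i i' := by
  by_cases hz : z.im = D.height z.re
  · rw [rel_node _ hz] at *; exact h.trans h'
  · rw [rel_self _ hz] at h; exact h ▸ h'

-- Only the sheets of one cycle at a node get identified: away from the nodes `Rel z z` is equality.
@[reducible] def setoid : Setoid (ℂ × I) where
  r p q := p.1 = q.1 ∧ D.Rel p.1 p.1 p.2 q.2
  iseqv := by
    refine ⟨fun p => ⟨rfl, D.rel_refl _ _⟩, ?_, ?_⟩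
    · rintro ⟨z, i⟩ ⟨z', i'⟩ ⟨h, h'⟩
      obtain rfl : z = z' := h
      exact ⟨rfl, D.rel_symm h'⟩
    · rintro ⟨z, i⟩ ⟨z', i'⟩ ⟨z'', i''⟩ ⟨h, h'⟩ ⟨k, k'⟩
      obtain rfl : z = z' := h
      obtain rfl : z = z'' := k
      exact ⟨rfl, h'.trans_left k'⟩

/-- The branched covering described by the data. -/
def Space : Type u := Quotient D.setoid

/-- The point over `z` on sheet `i`. -/
def pt (z : ℂ) (i : I) : D.Space := Quotient.mk D.setoid (z, i)

/-- The projection to the plane. -/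
def pr : D.Space → ℂ := Quotient.lift Prod.fst fun _ _ h => h.1

@[simp] theorem pr_pt (z : ℂ) (i : I) : D.pr (D.pt z i) = z := rfl

theorem ind {P : D.Space → Prop} (h : ∀ z i, P (D.pt z i)) (p : D.Space) : P p :=
  Quotient.ind (fun q => h q.1 q.2) p

theorem pt_eq_pt {z z' : ℂ} {i i' : I} : D.pt z i = D.pt z' i' ↔ z = z' ∧ D.Rel z z i i' :=
  Quotient.eq (r := D.setoid)

theorem pt_eq_pt' {z : ℂ} {i i' : I} : D.pt z i = D.pt z i' ↔ D.Rel z z i i' := by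
  rw [pt_eq_pt]; simp

/-- `r` is a radius such that the disc of radius `r` about `z` only meets the slit through `z`. -/
def Good (z : ℂ) (r : ℝ) : Prop :=
  0 < r ∧ (∀ a, D.perm a ≠ 1 → a ≠ z.re → r ≤ |a - z.re|) ∧
    (z.im ≠ D.height z.re → r ≤ |z.im - D.height z.re|)

theorem Good.mono {D : SlitData I} {z : ℂ} {r r' : ℝ} (h : D.Good z r) (h0 : 0 < r') (hr : r' ≤ r) :
    D.Good z r' :=
  ⟨h0, fun a ha ha' => hr.trans (h.2.1 a ha ha'), fun hz => hr.trans (h.2.2 hz)⟩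

theorem exists_good (z : ℂ) : ∃ r, D.Good z r := by
  have h1 : ∃ r > 0, ∀ a, D.perm a ≠ 1 → a ≠ z.re → r ≤ |a - z.re| := by
    have hfin : ({a | D.perm a ≠ 1} \ {z.re}).Finite := D.finite_support.sdiff
    have : ({a | D.perm a ≠ 1} \ {z.re})ᶜ ∈ 𝓝 z.re :=
      hfin.isClosed.isOpen_compl.mem_nhds (by simp)
    obtain ⟨r, hr, hb⟩ := Metric.mem_nhds_iff.1 this
    refine ⟨r, hr, fun a ha ha' => ?_⟩
    by_contra! hlt
    exact hb (show a ∈ Metric.ball z.re r by rwa [Metric.mem_ball, Real.dist_eq]) ⟨ha, ha'⟩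
  obtain ⟨r, hr, h⟩ := h1
  by_cases hz : z.im = D.height z.re
  · exact ⟨r, hr, h, fun h' => absurd hz h'⟩
  · have : 0 < |z.im - D.height z.re| := abs_pos.2 (sub_ne_zero.2 hz)
    exact ⟨min r _, lt_min hr this, fun a ha ha' => (min_le_left _ _).trans (h a ha ha'),
      fun _ => min_le_right _ _⟩

section good
variable {D} {z : ℂ} {r : ℝ} (hg : D.Good z r) {z' : ℂ} (hz' : dist z' z < r)
include hg hz'

theorem Good.perm_eq_one (hre : z'.re ≠ z.re) : D.perm z'.re = 1 := by
  by_contra h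
  have h1 := hg.2.1 _ h hre
  have h2 : |z'.re - z.re| ≤ dist z' z := by
    rw [Complex.dist_eq, ← Complex.sub_re]; exact Complex.abs_re_le_norm _
  linarith

theorem Good.same_side (hz : z.im ≠ D.height z.re) (hre : z'.re = z.re) :
    z'.im ≠ D.height z'.re ∧ D.cross z' = D.cross z := by
  have h1 := hg.2.2 hz
  have h2 : |z'.im - z.im| < r := lt_of_le_of_lt (by
    rw [Complex.dist_eq, ← Complex.sub_im]; exact Complex.abs_im_le_norm _) hz'
  rw [hre, cross, cross, hre]
  rcases abs_lt.1 h2 with ⟨h3, h4⟩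
  rcases lt_or_gt_of_ne hz with h | h
  · rw [abs_of_neg (by linarith)] at h1
    refine ⟨by linarith, ?_⟩
    rw [if_neg (by linarith), if_neg (by linarith)]
  · rw [abs_of_pos (by linarith)] at h1
    refine ⟨by linarith, ?_⟩
    rw [if_pos (by linarith), if_pos (by linarith)]

/-- Within a good disc, sheets can be glued only over the centre: any other node inside it has
trivial permutation. -/
theorem Good.eq_of_rel (hne : z' ≠ z) {k i' : I} (h : D.Rel z' z' k i') : i' = k := by
  by_cases hn : z'.im = D.height z'.re
  · rw [rel_node _ hn] at h
    by_cases hre : z'.re = z.re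
    · by_cases hz : z.im = D.height z.re
      · exact absurd (Complex.ext hre (by rw [hn, hz, hre])) hne
      · exact absurd hn (hg.same_side hz' hz hre).1
    · rw [hg.perm_eq_one hz' hre] at h
      simpa [eq_comm] using h
  · rwa [rel_self _ hn] at h

theorem Good.rel_trans_right {i k i' : I} (h : D.Rel z z' i k) (h' : D.Rel z' z' k i') :
    D.Rel z z' i i' := by
  by_cases hne : z' = z
  · subst hne; exact h.trans_left h'
  · rwa [hg.eq_of_rel hz' hne h']

theorem Good.cross_mem (_h : z.im = D.height z.re) :
    D.cross z' = 1 ∨ D.cross z' = D.perm z.re := by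
  by_cases hre : z'.re = z.re
  · unfold cross; split_ifs <;> simp [hre]
  · unfold cross; split_ifs <;> simp [hg.perm_eq_one hz' hre]

/-- This is what makes the basic neighbourhoods open. "Eventually" is needed because, for a centre
that is not a node, the third point must stay on the same side of the vertical line as the second.
-/
theorem Good.rel_trans {i i' : I} (h : D.Rel z z' i i') :
    ∀ᶠ z'' in 𝓝 z', ∀ i'', D.Rel z' z'' i' i'' → D.Rel z z'' i i'' := by
  by_cases hz : z.im = D.height z.re
  · refine Eventually.of_forall fun z'' i'' h'' => ?_
    rw [rel_node _ hz] at *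
    refine h.trans ?_
    by_cases hn : z'.im = D.height z'.re
    · rw [rel_node _ hn] at h''
      by_cases hre : z'.re = z.re
      · rwa [hre] at h''
      · rw [hg.perm_eq_one hz' hre] at h''
        obtain rfl : i' = i'' := by simpa using h''
        rfl
    · by_cases hle : z''.re ≤ z'.re
      · rw [rel_of_le _ hn hle] at h''; rw [h'']
      · rw [rel_of_lt _ hn (not_le.1 hle)] at h''
        rcases hg.cross_mem hz' hz with h1 | h1
        · rw [h1] at h''; rw [h'']; rfl
        · rw [h1] at h''; rw [h'']; exact Equiv.Perm.sameCycle_apply_right.2 (by rfl)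
  · rcases lt_trichotomy z'.re z.re with hre | hre | hre
    · have hp := hg.perm_eq_one hz' hre.ne
      have hc : D.cross z' = 1 := by unfold cross; rw [hp, ite_self]
      rw [rel_of_le _ hz hre.le] at h
      filter_upwards [Complex.continuous_re.continuousAt.eventually_lt continuousAt_const hre]
        with z'' hz'' i'' h''
      rw [rel_of_le _ hz hz''.le, ← h]
      by_cases hn : z'.im = D.height z'.re
      · rw [rel_node _ hn, hp] at h''; simpa [eq_comm] using h''
      · by_cases hle : z''.re ≤ z'.re
        · rwa [rel_of_le _ hn hle] at h''
        · rwa [rel_of_lt _ hn (not_le.1 hle), hc] at h''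
    · rw [rel_of_le _ hz hre.le] at h
      obtain ⟨hn, hc⟩ := hg.same_side hz' hz hre
      refine Eventually.of_forall fun z'' i'' h'' => ?_
      by_cases hle : z''.re ≤ z'.re
      · rw [rel_of_le _ hn hle] at h''
        rw [rel_of_le _ hz (hre ▸ hle), h'', h]
      · rw [rel_of_lt _ hn (not_le.1 hle)] at h''
        rw [rel_of_lt _ hz (hre ▸ (not_le.1 hle)), h'', h, hc]
    · have hp := hg.perm_eq_one hz' hre.ne'
      have hc : D.cross z' = 1 := by unfold cross; rw [hp, ite_self]
      rw [rel_of_lt _ hz hre] at h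
      filter_upwards [continuousAt_const.eventually_lt Complex.continuous_re.continuousAt hre]
        with z'' hz'' i'' h''
      rw [rel_of_lt _ hz hz'', ← h]
      by_cases hn : z'.im = D.height z'.re
      · rw [rel_node _ hn, hp] at h''; simpa [eq_comm] using h''
      · by_cases hle : z''.re ≤ z'.re
        · rwa [rel_of_le _ hn hle] at h''
        · rwa [rel_of_lt _ hn (not_le.1 hle), hc] at h''

end good

theorem rel_inj {z z' : ℂ} {i k i' : I} (h : D.Rel z z' i i') (h' : D.Rel z z' k i') :
    D.Rel z z i k := by
  by_cases hz : z.im = D.height z.re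
  · rw [rel_node _ hz] at *; exact h.trans h'.symm
  · rw [rel_self _ hz]
    by_cases hle : z'.re ≤ z.re
    · rw [rel_of_le _ hz hle] at *; rw [← h, h']
    · rw [rel_of_lt _ hz (not_le.1 hle)] at *
      exact (D.cross z).injective (h'.symm.trans h)

theorem exists_rel_left (z z' : ℂ) (i' : I) : ∃ i, D.Rel z z' i i' := by
  by_cases hz : z.im = D.height z.re
  · exact ⟨i', by rw [rel_node _ hz]⟩
  · by_cases hle : z'.re ≤ z.re
    · exact ⟨i', by rw [rel_of_le _ hz hle]⟩
    · exact ⟨(D.cross z).symm i', by rw [rel_of_lt _ hz (not_le.1 hle)]; simp⟩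

theorem exists_rel_right (z z' : ℂ) (i : I) : ∃ i', D.Rel z z' i i' := by
  by_cases hz : z.im = D.height z.re
  · exact ⟨i, by rw [rel_node _ hz]⟩
  · by_cases hle : z'.re ≤ z.re
    · exact ⟨i, by rw [rel_of_le _ hz hle]⟩
    · exact ⟨D.cross z i, by rw [rel_of_lt _ hz (not_le.1 hle)]⟩

/-! ### Topology of the branched covering -/

instance : TopologicalSpace D.Space where
  -- The sheets are quantified inside the filter, so one radius serves all sheets of a cycle; the
  -- set of sheets may be infinite.
  IsOpen O := ∀ z i, D.pt z i ∈ O → ∀ᶠ z' in 𝓝 z, ∀ i', D.Rel z z' i i' → D.pt z' i' ∈ O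
  isOpen_univ := by simp
  isOpen_inter s t hs ht z i hzi := by
    filter_upwards [hs z i hzi.1, ht z i hzi.2] with z' h1 h2 i' hi'
    exact ⟨h1 i' hi', h2 i' hi'⟩
  isOpen_sUnion S hS z i := by
    rintro ⟨s, hs, hzi⟩
    filter_upwards [hS s hs z i hzi] with z' h1 i' hi'
    exact ⟨s, hs, h1 i' hi'⟩

theorem isOpen_iff {O : Set D.Space} : IsOpen O ↔
    ∀ z i, D.pt z i ∈ O → ∀ᶠ z' in 𝓝 z, ∀ i', D.Rel z z' i i' → D.pt z' i' ∈ O := Iff.rfl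

/-- The basic neighbourhood of radius `r` of the point over `z` on sheet `i`. -/
def cone (z : ℂ) (i : I) (r : ℝ) : Set D.Space :=
  {p | ∃ z' i', dist z' z < r ∧ D.Rel z z' i i' ∧ p = D.pt z' i'}

theorem Good.mem_cone {D : SlitData I} {z : ℂ} {r : ℝ} (hg : D.Good z r) {i : I} {z' : ℂ} {i' : I} :
    D.pt z' i' ∈ D.cone z i r ↔ dist z' z < r ∧ D.Rel z z' i i' := by
  constructor
  · rintro ⟨w, k, hw, hr, he⟩
    rw [eq_comm, pt_eq_pt] at he
    obtain ⟨rfl, h⟩ := he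
    exact ⟨hw, hg.rel_trans_right hw hr h⟩
  · rintro ⟨h, h'⟩
    exact ⟨z', i', h, h', rfl⟩

theorem Good.isOpen_cone {D : SlitData I} {z : ℂ} {r : ℝ} (hg : D.Good z r) (i : I) :
    IsOpen (D.cone z i r) := by
  intro z' i' h
  rw [hg.mem_cone] at h
  have hb : ∀ᶠ z'' in 𝓝 z', dist z'' z < r := Metric.isOpen_ball.mem_nhds h.1
  filter_upwards [hb, hg.rel_trans h.1 h.2] with z'' h1 h2 i'' h3
  exact hg.mem_cone.2 ⟨h1, h2 _ h3⟩

theorem mem_cone_self {z : ℂ} {r : ℝ} (hr : 0 < r) (i : I) : D.pt z i ∈ D.cone z i r :=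
  ⟨z, i, by simpa using hr, D.rel_refl _ _, rfl⟩

theorem mem_nhds_iff {z : ℂ} {i : I} {O : Set D.Space} : O ∈ 𝓝 (D.pt z i) ↔
    ∀ᶠ z' in 𝓝 z, ∀ i', D.Rel z z' i i' → D.pt z' i' ∈ O := by
  constructor
  · intro h
    obtain ⟨V, hV, hVo, hm⟩ := _root_.mem_nhds_iff.1 h
    filter_upwards [hVo z i hm] with z' h1 i' hi' using hV (h1 i' hi')
  · intro h
    obtain ⟨ε, hε, hb⟩ := Metric.eventually_nhds_iff.1 h
    obtain ⟨r, hr⟩ := D.exists_good z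
    have hg := hr.mono (lt_min hr.1 hε) (min_le_left _ _)
    refine mem_of_superset ((hg.isOpen_cone i).mem_nhds (D.mem_cone_self hg.1 i)) ?_
    rintro _ ⟨z', i', h1, h2, rfl⟩
    exact hb (h1.trans_le (min_le_right _ _)) i' h2

theorem nhds_hasBasis (z : ℂ) (i : I) :
    (𝓝 (D.pt z i)).HasBasis (fun r => D.Good z r) (D.cone z i) := by
  refine ⟨fun O => ⟨fun h => ?_, ?_⟩⟩
  · rw [mem_nhds_iff] at h
    obtain ⟨ε, hε, hb⟩ := Metric.eventually_nhds_iff.1 h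
    obtain ⟨r, hr⟩ := D.exists_good z
    refine ⟨min r ε, hr.mono (lt_min hr.1 hε) (min_le_left _ _), ?_⟩
    rintro _ ⟨z', i', h1, h2, rfl⟩
    exact hb (h1.trans_le (min_le_right _ _)) i' h2
  · rintro ⟨r, hr, h⟩
    exact mem_of_superset ((hr.isOpen_cone i).mem_nhds (D.mem_cone_self hr.1 i)) h

theorem tendsto_pt {A : Type*} {l : Filter A} {ζ : A → ℂ} {ι : A → I} {z : ℂ} {i : I}
    (hζ : Tendsto ζ l (𝓝 z)) (h : ∀ᶠ a in l, D.Rel z (ζ a) i (ι a)) :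
    Tendsto (fun a => D.pt (ζ a) (ι a)) l (𝓝 (D.pt z i)) := by
  intro O hO
  rw [mem_nhds_iff] at hO
  rw [mem_map]
  filter_upwards [hζ.eventually hO, h] with a h1 h2 using h1 _ h2

theorem tendsto_nhds_pt {A : Type*} {l : Filter A} {f : D.Space → A} {z : ℂ} {i : I}
    (h : ∀ U ∈ l, ∀ᶠ z' in 𝓝 z, ∀ i', D.Rel z z' i i' → f (D.pt z' i') ∈ U) :
    Tendsto f (𝓝 (D.pt z i)) l := fun U hU => D.mem_nhds_iff.2 (h U hU)

theorem continuous_pr : Continuous D.pr := by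
  rw [continuous_iff_continuousAt]
  refine D.ind fun z i => D.tendsto_nhds_pt fun U hU => ?_
  filter_upwards [hU] with z' h _ _ using h

theorem cone_subset (z : ℂ) (i : I) (r : ℝ) : D.cone z i r ⊆ D.pr ⁻¹' Metric.ball z r := by
  rintro _ ⟨z', i', h1, -, rfl⟩; exact h1

theorem preimage_ball (z : ℂ) (r : ℝ) : D.pr ⁻¹' Metric.ball z r = ⋃ i, D.cone z i r := by
  refine subset_antisymm ?_ (iUnion_subset fun i => D.cone_subset z i r)
  intro p
  revert p
  refine D.ind fun z' i' h => ?_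
  obtain ⟨i, hi⟩ := D.exists_rel_left z z' i'
  exact mem_iUnion.2 ⟨i, z', i', h, hi, rfl⟩

theorem Good.rel_of_mem_cone {D : SlitData I} {z : ℂ} {r : ℝ} (hg : D.Good z r) {i k : I}
    {p : D.Space} (h : p ∈ D.cone z i r) (h' : p ∈ D.cone z k r) : D.Rel z z i k := by
  obtain ⟨z', i', h1, h2, rfl⟩ := h
  exact D.rel_inj h2 (hg.mem_cone.1 h').2

theorem cone_congr {z : ℂ} {i k : I} (h : D.Rel z z i k) (r : ℝ) : D.cone z i r = D.cone z k r := by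
  ext p
  constructor
  · rintro ⟨z', i', h1, h2, rfl⟩
    exact ⟨z', i', h1, (D.rel_symm h).trans_left h2, rfl⟩
  · rintro ⟨z', i', h1, h2, rfl⟩
    exact ⟨z', i', h1, h.trans_left h2, rfl⟩

instance : T2Space D.Space := by
  rw [t2Space_iff]
  refine fun p q => ?_
  revert p q
  refine D.ind fun z i => D.ind fun z' k hne => ?_
  by_cases hz : z = z'
  · subst hz
    obtain ⟨r, hr⟩ := D.exists_good z
    refine ⟨_, _, hr.isOpen_cone i, hr.isOpen_cone k, D.mem_cone_self hr.1 i,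
      D.mem_cone_self hr.1 k, ?_⟩
    rw [Set.disjoint_left]
    intro p hp hp'
    exact hne (D.pt_eq_pt'.2 (hr.rel_of_mem_cone hp hp'))
  · obtain ⟨u, v, hu, hv, h1, h2, h3⟩ := t2_separation hz
    exact ⟨_, _, hu.preimage D.continuous_pr, hv.preimage D.continuous_pr, h1, h2,
      h3.preimage _⟩

theorem Good.preimage_ball_diff {D : SlitData I} {z : ℂ} {r : ℝ} (hg : D.Good z r) (i : I) :
    D.pr ⁻¹' Metric.ball z r \ D.cone z i r = ⋃ k : {k // ¬ D.Rel z z i k}, D.cone z k r := by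
  ext p
  rw [preimage_ball]
  simp only [Set.mem_sdiff, mem_iUnion, Subtype.exists, exists_prop]
  constructor
  · rintro ⟨⟨k, hk⟩, h⟩
    exact ⟨k, fun hik => h (by rwa [D.cone_congr hik]), hk⟩
  · rintro ⟨k, hk, h⟩
    exact ⟨⟨k, h⟩, fun h' => hk (hg.rel_of_mem_cone h' h)⟩

/-- A preconnected set lying over the disc and meeting a basic neighbourhood lies in it. -/
theorem Good.subset_cone {D : SlitData I} {z : ℂ} {r : ℝ} (hg : D.Good z r) {i : I}
    {C : Set D.Space} (hC : IsPreconnected C) (h : C ⊆ D.pr ⁻¹' Metric.ball z r)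
    {p : D.Space} (hp : p ∈ C) (hp' : p ∈ D.cone z i r) : C ⊆ D.cone z i r := by
  refine hC.subset_left_of_subset_union (hg.isOpen_cone i)
    (v := ⋃ k : {k // ¬ D.Rel z z i k}, D.cone z k r)
    (isOpen_iUnion fun k => hg.isOpen_cone _) ?_ ?_ ⟨p, hp, hp'⟩
  · rw [← hg.preimage_ball_diff]; exact disjoint_sdiff_right
  · rw [← hg.preimage_ball_diff]
    intro q hq
    by_cases h' : q ∈ D.cone z i r
    exacts [Or.inl h', Or.inr ⟨h hq, h'⟩]

theorem isOpenMap_pr : IsOpenMap D.pr := by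
  refine IsOpenMap.of_nhds_le fun p => ?_
  revert p
  refine D.ind fun z i O hO => ?_
  rw [mem_map, mem_nhds_iff] at hO
  filter_upwards [hO] with z' h
  obtain ⟨i', hi'⟩ := D.exists_rel_right z z' i
  exact h i' hi'

/-- An ultrafilter over a small disc must choose one of the finitely many cones above it, and it
converges to the apex of that cone. -/
theorem isProperMap_pr [Finite I] : IsProperMap D.pr := by
  rw [isProperMap_iff_ultrafilter]
  refine ⟨D.continuous_pr, fun 𝒰 z hz => ?_⟩
  obtain ⟨r, hr⟩ := D.exists_good z
  have h1 : D.pr ⁻¹' Metric.ball z r ∈ (𝒰 : Filter D.Space) := hz (Metric.ball_mem_nhds z hr.1)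
  rw [preimage_ball, Ultrafilter.mem_coe, ← biUnion_univ,
    Ultrafilter.finite_biUnion_mem_iff finite_univ] at h1
  obtain ⟨i, -, hi⟩ := h1
  refine ⟨D.pt z i, rfl, ?_⟩
  intro O hO
  rw [mem_nhds_iff] at hO
  have h2 : D.pr ⁻¹' _ ∈ (𝒰 : Filter D.Space) := hz hO
  filter_upwards [h2, hi] with p hp hp'
  obtain ⟨z', i', -, h4, rfl⟩ := hp'
  exact hp i' h4

/-! ### Maps induced by equivariant maps of sheets -/

section map
variable {J : Type v} {D} {D' : SlitData J} {f : I → J} (hh : D.height = D'.height)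
  (hf : ∀ a i, f (D.perm a i) = D'.perm a (f i))
include hh hf

theorem map_cross (z : ℂ) (i : I) : f (D.cross z i) = D'.cross z (f i) := by
  unfold cross
  rw [hh]
  split_ifs
  · exact hf _ _
  · rfl

theorem map_zpow (a : ℝ) (n : ℤ) (i : I) : f ((D.perm a ^ n) i) = (D'.perm a ^ n) (f i) := by
  have : Function.Semiconj f (D.perm a) (D'.perm a) := hf a
  induction n using Int.induction_on generalizing i with
  | zero => simp
  | succ n ih => rw [zpow_add_one, zpow_add_one, Equiv.Perm.mul_apply, ih, hf,
      Equiv.Perm.mul_apply]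
  | pred n ih =>
    rw [zpow_sub_one, zpow_sub_one, Equiv.Perm.mul_apply, Equiv.Perm.mul_apply, ih]
    congr 1
    rw [Equiv.Perm.eq_inv_iff_eq, ← hf]; simp

theorem map_sameCycle {a : ℝ} {i i' : I} (h : (D.perm a).SameCycle i i') :
    (D'.perm a).SameCycle (f i) (f i') := by
  obtain ⟨n, rfl⟩ := h
  exact ⟨n, (map_zpow hh hf a n i).symm⟩

theorem map_rel {z z' : ℂ} {i i' : I} (h : D.Rel z z' i i') : D'.Rel z z' (f i) (f i') := by
  by_cases hz : z.im = D.height z.re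
  · rw [rel_node _ hz] at h
    rw [rel_node _ (hh ▸ hz)]
    exact map_sameCycle hh hf h
  · have hz' : z.im ≠ D'.height z.re := hh ▸ hz
    by_cases hle : z'.re ≤ z.re
    · rw [rel_of_le _ hz hle] at h; rw [rel_of_le _ hz' hle, h]
    · rw [rel_of_lt _ hz (not_le.1 hle)] at h
      rw [rel_of_lt _ hz' (not_le.1 hle), h, map_cross hh hf]

/-- The map of branched coverings induced by an equivariant map of sheets. -/
def map : D.Space → D'.Space :=
  Quotient.lift (fun q : ℂ × I => D'.pt q.1 (f q.2)) (by
    rintro ⟨z, i⟩ ⟨z', i'⟩ ⟨h, h'⟩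
    obtain rfl : z = z' := h
    exact D'.pt_eq_pt'.2 (map_rel hh hf h'))

@[simp] theorem map_pt (z : ℂ) (i : I) : map hh hf (D.pt z i) = D'.pt z (f i) := rfl

theorem pr_map (p : D.Space) : D'.pr (map hh hf p) = D.pr p := by
  revert p; exact D.ind fun z i => rfl

theorem continuous_map : Continuous (map hh hf) := by
  rw [continuous_iff_continuousAt]
  refine D.ind fun z i => D.tendsto_nhds_pt fun U hU => ?_
  rw [map_pt, mem_nhds_iff] at hU
  filter_upwards [hU] with z' h i' hi' using h _ (map_rel hh hf hi')

theorem exists_rel_lift {z z' : ℂ} {j : I} {i' : J} (h : D'.Rel z z' (f j) i') :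
    ∃ j', D.Rel z z' j j' ∧ f j' = i' := by
  by_cases hz : z.im = D.height z.re
  · rw [rel_node _ (hh ▸ hz)] at h
    obtain ⟨n, rfl⟩ := h
    exact ⟨(D.perm z.re ^ n) j, by rw [rel_node _ hz]; exact ⟨n, rfl⟩, map_zpow hh hf _ _ _⟩
  · have hz' : z.im ≠ D'.height z.re := hh ▸ hz
    by_cases hle : z'.re ≤ z.re
    · rw [rel_of_le _ hz' hle] at h
      exact ⟨j, by rw [rel_of_le _ hz hle], h.symm⟩
    · rw [rel_of_lt _ hz' (not_le.1 hle)] at h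
      exact ⟨D.cross z j, by rw [rel_of_lt _ hz (not_le.1 hle)], by rw [h, map_cross hh hf]⟩

theorem isOpenMap_map : IsOpenMap (map hh hf) := by
  refine IsOpenMap.of_nhds_le fun p => ?_
  revert p
  refine D.ind fun z i O hO => ?_
  rw [mem_map, mem_nhds_iff] at hO
  rw [map_pt, mem_nhds_iff]
  filter_upwards [hO] with z' h i' hi'
  obtain ⟨j', h1, rfl⟩ := exists_rel_lift hh hf hi'
  exact h j' h1

theorem exists_rel_lift_left {z z' : ℂ} {i : J} {j' : I} (h : D'.Rel z z' i (f j')) :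
    ∃ j, D.Rel z z' j j' ∧ D'.Rel z z i (f j) := by
  obtain ⟨j, hj⟩ := D.exists_rel_left z z' j'
  exact ⟨j, hj, D'.rel_inj h (map_rel hh hf hj)⟩

/-- An equivariant map sends each cycle onto a cycle. Injectivity on cycles then excludes branching
at the nodes, so each cone maps bijectively to a cone. -/
theorem isCoveringMap_map
    (hinj : ∀ a j j', (D.perm a).SameCycle j j' → f j = f j' → j = j') :
    IsCoveringMap (map hh hf) := by
  intro x
  revert x
  refine D'.ind fun z i => ?_
  obtain ⟨r₁, hr₁⟩ := D.exists_good z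
  obtain ⟨r₂, hr₂⟩ := D'.exists_good z
  have hr₀ := lt_min hr₁.1 hr₂.1
  have hg := hr₁.mono hr₀ (min_le_left _ _)
  have hg' := hr₂.mono hr₀ (min_le_right _ _)
  set r := min r₁ r₂
  have hV := hg'.isOpen_cone i
  -- The leaves are indexed by points over the centre and not by sheets, since several sheets may
  -- pass through one point.
  let κ := {c : D.Space // ∃ j, c = D.pt z j ∧ D'.Rel z z i (f j)}
  let U : κ → Set D.Space := fun c => D.cone z c.2.choose r
  have exh : map hh hf ⁻¹' D'.cone z i r ⊆ ⋃ c, U c := by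
    intro p
    revert p
    refine D.ind fun z' j' h => ?_
    obtain ⟨h1, h2⟩ := hg'.mem_cone.1 h
    obtain ⟨j, h3, h4⟩ := exists_rel_lift_left hh hf h2
    let c : κ := ⟨D.pt z j, j, rfl, h4⟩
    refine mem_iUnion.2 ⟨c, ?_⟩
    have := c.2.choose_spec.1
    exact hg.mem_cone.2 ⟨h1, (D.rel_symm (D.pt_eq_pt'.1 this)).trans_left h3⟩
  rcases isEmpty_or_nonempty κ with hκ | hκ
  · refine IsEvenlyCovered.to_isEvenlyCovered_preimage (.of_preimage_eq_empty Empty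
      (hV.mem_nhds (D'.mem_cone_self hr₀ i)) (subset_empty_iff.1 (exh.trans ?_)))
    simp
  let _ : TopologicalSpace κ := ⊥
  have _ : DiscreteTopology κ := ⟨rfl⟩
  have surj : ∀ c : κ, SurjOn (map hh hf) (U c) (D'.cone z i r) := by
    rintro c
    refine fun p => ?_
    revert p
    refine D'.ind fun z' i' h => ?_
    obtain ⟨h1, h2⟩ := hg'.mem_cone.1 h
    obtain ⟨j', h3, h4⟩ := exists_rel_lift hh hf
      ((D'.rel_symm c.2.choose_spec.2).trans_left h2)
    exact ⟨D.pt z' j', hg.mem_cone.2 ⟨h1, h3⟩, by rw [map_pt, h4]⟩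
  have hn : Nonempty (D'.Space → D.Space) := ⟨fun _ => hκ.some.1⟩
  refine IsEvenlyCovered.to_isEvenlyCovered_preimage (.of_trivialization
    (t := hV.trivializationDiscrete (f := map hh hf) U _ (fun c W hW => ⟨fun h => ?_, fun h => ?_⟩)
      (fun c => ?_) surj (fun c c' hne => ?_) exh) (D'.mem_cone_self hr₀ i))
  · exact (h.preimage (continuous_map hh hf)).inter (hg.isOpen_cone _)
  · convert isOpenMap_map hh hf _ h using 1
    refine subset_antisymm (fun w hw => ?_) ?_
    · obtain ⟨p, hp, rfl⟩ := surj c (hW hw)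
      exact ⟨p, ⟨hw, hp⟩, rfl⟩
    · rintro _ ⟨p, hp, rfl⟩; exact hp.1
  · intro p hp q hq
    obtain ⟨z₁, j₁, h1, h2, rfl⟩ := hp
    obtain ⟨z₂, j₂, h3, h4, rfl⟩ := hq
    intro he
    rw [map_pt, map_pt, pt_eq_pt] at he
    obtain ⟨rfl, he⟩ := he
    rw [pt_eq_pt']
    by_cases hz : z₁ = z
    · subst hz; exact (D.rel_symm h2).trans_left h4
    · have he' := hg'.eq_of_rel h1 hz he
      by_cases hn : z.im = D.height z.re
      · rw [rel_node _ hn] at h2 h4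
        rw [hinj _ _ _ (h2.symm.trans h4) he'.symm]
        exact D.rel_refl _ _
      · have : j₁ = j₂ := by
          by_cases hle : z₁.re ≤ z.re
          · rw [rel_of_le _ hn hle] at h2 h4; rw [h2, h4]
          · rw [rel_of_lt _ hn (not_le.1 hle)] at h2 h4; rw [h2, h4]
        rw [this]; exact D.rel_refl _ _
  · rw [Function.onFun, Set.disjoint_left]
    intro p hp hp'
    apply hne
    have := hg.rel_of_mem_cone hp hp'
    rw [← D.pt_eq_pt', ← c.2.choose_spec.1, ← c'.2.choose_spec.1] at this
    exact Subtype.ext this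

end map

end SlitData

/-! ### Flat distances and the identification of a flat completion -/

section FlatGeometry

variable {X : Type u} [TopologicalSpace X]

/-- A path whose projection is a straight segment is short. -/
theorem flatEDist_le_of_lineMap {π : X → ℂ} {x y : X} (γ : Path x y)
    (h : ∀ t, π (γ t) = AffineMap.lineMap (π x) (π y) (t : ℝ)) :
    flatEDist π x y ≤ edist (π x) (π y) := by
  refine (iInf_le _ γ).trans ?_
  unfold flatLength
  have h1 : π ∘ γ = (AffineMap.lineMap (k := ℝ) (π x) (π y)) ∘ (Subtype.val : unitInterval → ℝ) :=
    funext h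
  have hL : LipschitzWith (nndist (π x) (π y)) (AffineMap.lineMap (k := ℝ) (π x) (π y)) := by
    refine LipschitzWith.of_dist_le_mul fun s t => ?_
    rw [dist_lineMap_lineMap, coe_nndist, mul_comm]
  rw [h1]
  have h2 := (hL.lipschitzOnWith (s := univ)).comp_eVariationOn_le (g := (Subtype.val : unitInterval → ℝ))
    (s := univ) (fun _ _ => mem_univ _)
  have h3 : eVariationOn (Subtype.val : unitInterval → ℝ) univ ≤ 1 := by
    have := MonotoneOn.eVariationOn_eq (f := (Subtype.val : unitInterval → ℝ)) (s := univ)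
      (fun _ _ _ _ h => h) (mem_univ 0) (mem_univ 1)
    have h01 : univ ∩ Icc (0 : unitInterval) 1 = univ := by
      ext t; exact ⟨fun _ => mem_univ _, fun _ => ⟨mem_univ _, t.2.1, t.2.2⟩⟩
    rw [h01] at this
    simp [this]
  refine h2.trans ((mul_le_mul_right h3 _).trans ?_)
  rw [mul_one, edist_nndist]

/-- Sections of `π` over convex sets are isometric (up to a linear isometry of the plane). -/
theorem flatEDist_section_le {π : X → ℂ} {C : Set ℂ} (hC : Convex ℝ C) {s : ℂ → X}
    (hs : ContinuousOn s C) {θ : ℂ} (hπ : ∀ z ∈ C, π (s z) = θ * z) {z z' : ℂ} (hz : z ∈ C)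
    (hz' : z' ∈ C) : flatEDist π (s z) (s z') ≤ edist (π (s z)) (π (s z')) := by
  have hmem : ∀ t : unitInterval, AffineMap.lineMap z z' (t : ℝ) ∈ C := fun t =>
    hC.lineMap_mem hz hz' t.2
  let γ : Path (s z) (s z') :=
    { toFun := fun t => s (AffineMap.lineMap z z' (t : ℝ))
      continuous_toFun := by
        refine hs.comp_continuous ?_ hmem
        exact (AffineMap.lineMap_continuous).comp continuous_subtype_val
      source' := by simp
      target' := by simp }
  refine flatEDist_le_of_lineMap γ fun t => ?_
  change π (s _) = _
  rw [hπ _ (hmem t), hπ _ hz, hπ _ hz', AffineMap.lineMap_apply_module, AffineMap.lineMap_apply_module]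
  simp only [Complex.real_smul]
  ring

theorem edist_le_flatLength (π : X → ℂ) {x y : X} (γ : Path x y) (t : unitInterval) :
    edist (π (γ t)) (π x) ≤ flatLength π γ := by
  have h := eVariationOn.edist_le (π ∘ γ) (mem_univ t) (mem_univ (0 : unitInterval))
  simpa [flatLength] using h

theorem exists_isPreconnected_of_flatEDist_lt {π : X → ℂ} {x y : X} {r : ℝ}
    (h : flatEDist π x y < ENNReal.ofReal r) :
    ∃ C, IsPreconnected C ∧ x ∈ C ∧ y ∈ C ∧ ∀ w ∈ C, dist (π w) (π x) < r := by
  unfold flatEDist at h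
  obtain ⟨γ, hγ⟩ := iInf_lt_iff.1 h
  refine ⟨range γ, isPreconnected_range γ.continuous, ⟨0, γ.source⟩, ⟨1, γ.target⟩, ?_⟩
  rintro _ ⟨t, rfl⟩
  have h1 := (edist_le_flatLength _ γ t).trans_lt hγ
  rwa [edist_lt_ofReal] at h1

/-- The identity from a surface to the same set with its flat distance. -/
def FlatSpace.of (π : X → ℂ) : X → FlatSpace π := fun x => x

/-- The identity from a surface with its flat distance to the surface. -/
def FlatSpace.out (π : X → ℂ) : FlatSpace π → X := fun x => x

theorem FlatSpace.edist_of (π : X → ℂ) (x y : X) :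
    edist (FlatSpace.of π x) (FlatSpace.of π y) = flatEDist π x y := rfl

theorem FlatSpace.edist_eq (π : X → ℂ) (x y : FlatSpace π) :
    edist x y = flatEDist π (FlatSpace.out π x) (FlatSpace.out π y) := rfl

end FlatGeometry

section Completion

variable {X : Type u} [TopologicalSpace X] {P : X → ℂ} {T : Set X}

/-- Points of `X` have small neighbourhoods that paths can only leave by moving away in the
projection. -/
def HasTraps (P : X → ℂ) : Prop :=
  ∀ x, ∀ O ∈ 𝓝 x, ∃ r > 0, ∃ N ⊆ O, N ∈ 𝓝 x ∧
    ∀ C, IsPreconnected C → (∀ y ∈ C, dist (P y) (P x) < r) → (C ∩ N).Nonempty → C ⊆ N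

/-- Points of `X` have neighbourhoods of small flat diameter in `T`. -/
def HasSmallNhds (P : X → ℂ) (T : Set X) : Prop :=
  ∀ x, ∀ ε > (0 : ℝ≥0∞), ∃ O ∈ 𝓝 x, ∀ y y' : T, (y : X) ∈ O → (y' : X) ∈ O →
    flatEDist (P ∘ ((↑) : T → X)) y y' ≤ ε

/-- The inclusion of `T`, with its flat distance, into `X`. -/
def FlatSpace.val (P : X → ℂ) (T : Set X) : FlatSpace (P ∘ ((↑) : T → X)) → X :=
  fun y => (FlatSpace.out _ y).1

/-- The projection of a Cauchy filter converges in the plane, and properness gives a cluster point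
above the limit. Short paths cannot leave a trap around that point, so the filter converges to it.
-/
theorem tendsto_val_of_cauchy (hP : IsProperMap P) (hN : HasTraps P)
    {f : Filter (FlatSpace (P ∘ ((↑) : T → X)))} (hf : Cauchy f) :
    ∃ x, Tendsto (FlatSpace.val P T) f (𝓝 x) := by
  have hPc : UniformContinuous (P ∘ FlatSpace.val P T) :=
    uniformContinuous_flat (P ∘ ((↑) : T → X))
  obtain ⟨z, hz⟩ := CompleteSpace.complete (hf.map hPc)
  have := hf.1
  have hmap : MapClusterPt z (map (FlatSpace.val P T) f) P := by
    rw [← map_map] at hz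
    exact ClusterPt.of_le_nhds hz
  obtain ⟨x, hx, hcl⟩ := hP.clusterPt_of_mapClusterPt hmap
  refine ⟨x, fun O hO => ?_⟩
  obtain ⟨r, hr, N, hNO, hNx, hN⟩ := hN x O hO
  obtain ⟨-, hf2⟩ := EMetric.cauchy_iff.1 hf
  -- Half the trap radius bounds the path, and the other half the distance from its starting point
  -- to the centre.
  obtain ⟨s, hs, hss⟩ := hf2 (ENNReal.ofReal (r / 2)) (by simpa using by linarith)
  have hB : P ⁻¹' Metric.ball (P x) (r / 2) ∈ 𝓝 x :=
    hP.continuous.continuousAt.preimage_mem_nhds (Metric.ball_mem_nhds _ (by linarith))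
  obtain ⟨q, ⟨hqN, hqB⟩, y₀, hy₀, rfl⟩ := clusterPt_iff_nonempty.1 hcl
    (inter_mem hNx hB) (image_mem_map hs)
  rw [mem_map]
  filter_upwards [hs] with y hy
  apply hNO
  have hd := hss _ hy₀ _ hy
  rw [FlatSpace.edist_eq] at hd
  obtain ⟨C, hC, h0, h1, h2⟩ := exists_isPreconnected_of_flatEDist_lt hd
  refine hN ((↑) '' C) (hC.image _ continuous_subtype_val.continuousOn) ?_ ⟨_, ⟨_, h0, rfl⟩, hqN⟩
    ⟨_, h1, rfl⟩
  rintro _ ⟨w, hw, rfl⟩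
  have h3 : dist (P (FlatSpace.val P T y₀)) (P x) < r / 2 := hqB
  have h4 : dist (P w) (P (FlatSpace.val P T y₀)) < r / 2 := h2 w hw
  calc dist (P w) (P x) ≤ _ := dist_triangle _ (P (FlatSpace.val P T y₀)) _
    _ < r := by linarith

theorem continuous_flat_val (hN : HasTraps P) : Continuous (FlatSpace.val P T) := by
  rw [continuous_iff_continuousAt]
  intro y₀ O hO
  obtain ⟨r, hr, N, hNO, hNx, hN⟩ := hN _ O hO
  rw [mem_map]
  have hb : Metric.eball y₀ (ENNReal.ofReal r) ∈ 𝓝 y₀ :=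
    Metric.eball_mem_nhds _ (by simpa using hr)
  filter_upwards [hb] with y hy
  apply hNO
  rw [Metric.mem_eball, edist_comm, FlatSpace.edist_eq] at hy
  obtain ⟨C, hC, h0, h1, h2⟩ := exists_isPreconnected_of_flatEDist_lt hy
  refine hN ((↑) '' C) (hC.image _ continuous_subtype_val.continuousOn) ?_
    ⟨_, ⟨_, h0, rfl⟩, mem_of_mem_nhds hNx⟩ ⟨_, h1, rfl⟩
  rintro _ ⟨w, hw, rfl⟩
  exact h2 w hw

theorem continuous_toFlatCompletion_subtype (hd : HasSmallNhds P T) :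
    Continuous (toFlatCompletion (P ∘ ((↑) : T → X))) := by
  have h : Continuous (FlatSpace.of (P ∘ ((↑) : T → X))) := by
    rw [continuous_iff_continuousAt]
    intro y
    rw [ContinuousAt, EMetric.tendsto_nhds]
    intro ε hε
    obtain ⟨ε', hε', hlt⟩ := exists_between hε
    obtain ⟨O, hO, hOd⟩ := hd y ε' hε'
    filter_upwards [continuous_subtype_val.continuousAt.preimage_mem_nhds hO] with y' hy'
    exact (hOd y' y hy' (mem_of_mem_nhds hO)).trans_lt hlt
  exact (UniformSpace.Completion.continuous_coe _).comp h

/-- The completion of a dense open part of a space that is proper over the plane is that space. -/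
theorem exists_homeomorph_flatCompletion [T2Space X] [RegularSpace X] (hP : IsProperMap P) (hT : Dense T)
    (hN : HasTraps P) (hd : HasSmallNhds P T) :
    ∃ e : FlatCompletion (P ∘ ((↑) : T → X)) ≃ₜ X,
      ∀ y : T, e (toFlatCompletion _ y) = y := by
  set Q := P ∘ ((↑) : T → X) with hQ
  have i₁ : IsDenseInducing ((↑) : T → X) := hT.isDenseInducing_val
  have i₂ : IsDenseInducing (UniformSpace.Completion.coe' (α := FlatSpace Q)) :=
    UniformSpace.Completion.isDenseInducing_coe
  -- Both inclusions of `T` extend by density: Cauchy filters converge in `X` by properness and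
  -- traps, and neighbourhoods of small flat diameter have Cauchy traces on `T`. The two extensions
  -- are mutually inverse because they are so on `T`.
  have c₂ : ∀ ξ : FlatCompletion Q, ∃ x, Tendsto (FlatSpace.val P T)
      (comap (UniformSpace.Completion.coe' (α := FlatSpace Q)) (𝓝 ξ)) (𝓝 x) := by
    intro ξ
    refine tendsto_val_of_cauchy hP hN (cauchy_nhds.comap' ?_ (i₂.comap_nhds_neBot ξ))
    exact (UniformSpace.Completion.isUniformInducing_coe _).comap_uniformity.le
  have c₁ : ∀ x : X, ∃ ξ, Tendsto (toFlatCompletion Q) (comap ((↑) : T → X) (𝓝 x)) (𝓝 ξ) := by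
    intro x
    have hne := i₁.comap_nhds_neBot x
    have hc : Cauchy (map (FlatSpace.of Q) (comap ((↑) : T → X) (𝓝 x))) := by
      rw [EMetric.cauchy_iff]
      refine ⟨(hne.map _).ne, fun ε hε => ?_⟩
      obtain ⟨ε', hε', hlt⟩ := exists_between hε
      obtain ⟨O, hO, hOd⟩ := hd x ε' hε'
      refine ⟨_, image_mem_map (preimage_mem_comap hO), ?_⟩
      rintro _ ⟨y, hy, rfl⟩ _ ⟨y', hy', rfl⟩
      exact (hOd y y' hy hy').trans_lt hlt
    exact CompleteSpace.complete (hc.map (UniformSpace.Completion.uniformContinuous_coe _))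
  have hΨ : Continuous (i₂.extend (FlatSpace.val P T)) := i₂.continuous_extend c₂
  have hΦ : Continuous (i₁.extend (toFlatCompletion Q)) := i₁.continuous_extend c₁
  have eΨ : ∀ y : T, i₂.extend (FlatSpace.val P T) (toFlatCompletion Q y) = y := fun y =>
    i₂.extend_eq (continuous_flat_val hN) y
  have eΦ : ∀ y : T, i₁.extend (toFlatCompletion Q) (y : X) = toFlatCompletion Q y := fun y =>
    i₁.extend_eq (continuous_toFlatCompletion_subtype hd) y
  refine ⟨{ toFun := i₂.extend (FlatSpace.val P T), invFun := i₁.extend (toFlatCompletion Q)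
            left_inv := ?_, right_inv := ?_
            continuous_toFun := hΨ, continuous_invFun := hΦ }, eΨ⟩
  · refine congrFun (i₂.dense.equalizer (hΦ.comp hΨ) continuous_id (funext fun y => ?_))
    exact (congrArg _ (eΨ y)).trans (eΦ y)
  · refine congrFun (i₁.dense.equalizer (hΨ.comp hΦ) continuous_id (funext fun y => ?_))
    exact (congrArg _ (eΦ y)).trans (eΨ y)

theorem regularSpace_of_isProperMap [T2Space X] (hP : IsProperMap P) : RegularSpace X := by
  have : WeaklyLocallyCompactSpace X := ⟨fun x => ⟨P ⁻¹' Metric.closedBall (P x) 1,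
    hP.isCompact_preimage (isCompact_closedBall _ _),
    hP.continuous.continuousAt.preimage_mem_nhds (Metric.closedBall_mem_nhds _ one_pos)⟩⟩
  infer_instance

end Completion

/-- Points are first pushed down vertically to height at most `M`; the convex lower part is then
contracted along segments. -/
theorem contractibleSpace_of_down {A : Set ℂ} {M : ℝ}
    (hA : ∀ z ∈ A, ∀ t ≤ z.im, (⟨z.re, t⟩ : ℂ) ∈ A)
    (hC : Convex ℝ {z ∈ A | z.im ≤ M}) (hne : A.Nonempty) : ContractibleSpace A := by
  obtain ⟨z₀, hz₀⟩ := hne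
  have hc : (⟨z₀.re, min z₀.im M⟩ : ℂ) ∈ {z ∈ A | z.im ≤ M} :=
    ⟨hA _ hz₀ _ (min_le_left _ _), min_le_right _ _⟩
  have hr : ∀ z ∈ A, (⟨z.re, min z.im M⟩ : ℂ) ∈ {z ∈ A | z.im ≤ M} := fun z hz =>
    ⟨hA _ hz _ (min_le_left _ _), min_le_right _ _⟩
  have hcont : Continuous fun z : A => (⟨(z : ℂ).re, min (z : ℂ).im M⟩ : ℂ) := by
    simp only [Complex.mk_eq_add_mul_I]
    fun_prop
  rw [contractible_iff_id_nullhomotopic]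
  refine ⟨⟨_, hc.1⟩, ContinuousMap.Homotopic.trans (g := ⟨fun z => ⟨_, (hr z z.2).1⟩,
    hcont.subtype_mk _⟩) ⟨⟨⟨fun p => ⟨⟨(p.2 : ℂ).re, (1 - p.1) * (p.2 : ℂ).im +
      p.1 * min (p.2 : ℂ).im M⟩, ?_⟩, ?_⟩, ?_, ?_⟩⟩
    ⟨⟨⟨fun p => ⟨AffineMap.lineMap (⟨(p.2 : ℂ).re, min (p.2 : ℂ).im M⟩ : ℂ)
      (⟨z₀.re, min z₀.im M⟩ : ℂ) (p.1 : ℝ), ?_⟩, ?_⟩, ?_, ?_⟩⟩⟩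
  · refine hA _ p.2.2 _ ?_
    have h1 := p.1.2.1
    have := min_le_left (p.2 : ℂ).im M
    nlinarith
  · refine Continuous.subtype_mk ?_ _
    simp only [Complex.mk_eq_add_mul_I]
    fun_prop
  · intro z; ext <;> simp
  · intro z; ext <;> simp
  · exact (hC.lineMap_mem (hr _ p.2.2) hc p.1.2).1
  · refine Continuous.subtype_mk ?_ _
    simp only [AffineMap.lineMap_apply_module, Complex.mk_eq_add_mul_I]
    fun_prop
  · intro z; ext <;> simp
  · intro z; ext <;> simp

namespace SlitData

variable {I : Type u} (D : SlitData I)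

/-! ### Regular points -/

/-- A point is regular when only one sheet passes through it. -/
def IsReg (p : D.Space) : Prop := ∀ z i, p = D.pt z i → ∀ k, D.Rel z z i k → k = i

theorem isReg_pt {z : ℂ} {i : I} : D.IsReg (D.pt z i) ↔ ∀ k, D.Rel z z i k → k = i := by
  refine ⟨fun h => h z i rfl, fun h z' i' he k hk => ?_⟩
  obtain ⟨rfl, h'⟩ := D.pt_eq_pt.1 he
  obtain rfl := h _ h'
  exact h k hk

theorem isReg_of_ne_height {z : ℂ} (h : z.im ≠ D.height z.re) (i : I) : D.IsReg (D.pt z i) :=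
  D.isReg_pt.2 fun k hk => by rwa [rel_self _ h] at hk

theorem isReg_of_eq_height {z : ℂ} (h : z.im = D.height z.re) {i : I} :
    D.IsReg (D.pt z i) ↔ D.perm z.re i = i := by
  rw [isReg_pt]
  simp only [D.rel_node h]
  constructor
  · exact fun h => h _ (Equiv.Perm.sameCycle_apply_right.2 (by rfl))
  · rintro h k hk
    exact (Equiv.Perm.SameCycle.eq_of_left hk h).symm

theorem Good.isReg {D : SlitData I} {z : ℂ} {r : ℝ} (hg : D.Good z r) {z' : ℂ}
    (hz' : dist z' z < r) (hne : z' ≠ z) (i : I) : D.IsReg (D.pt z' i) :=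
  D.isReg_pt.2 fun _ hk => hg.eq_of_rel hz' hne hk

theorem finite_not_isReg [Finite I] : {p | ¬ D.IsReg p}.Finite := by
  refine (D.finite_support.biUnion (t := fun a => range (D.pt (D.node a)))
    fun a _ => finite_range _).subset ?_
  refine fun p => ?_
  revert p
  refine D.ind fun z i h => ?_
  have hz : z.im = D.height z.re := by
    by_contra hz; exact h (D.isReg_of_ne_height hz i)
  refine mem_biUnion (x := z.re) ?_ ⟨i, ?_⟩
  · intro h1
    exact h ((D.isReg_of_eq_height hz).2 (by rw [h1]; rfl))
  · congr 1
    exact Complex.ext rfl hz.symm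

/-- The set of regular points. -/
def reg : Set D.Space := {p | D.IsReg p}

theorem isOpen_reg [Finite I] : IsOpen D.reg := by
  have := D.finite_not_isReg.isClosed.isOpen_compl
  convert this using 1
  ext p
  simp [reg]

theorem dense_reg : Dense D.reg := by
  refine fun p => ?_
  revert p
  refine D.ind fun z i => ?_
  rw [mem_closure_iff_nhds]
  intro O hO
  rw [mem_nhds_iff] at hO
  obtain ⟨r, hr⟩ := D.exists_good z
  have h1 : ∀ᶠ z' in 𝓝 z, dist z' z < r := Metric.ball_mem_nhds z hr.1
  have h2 : ∀ᶠ z' in 𝓝[≠] z, dist z' z < r ∧ (∀ i', D.Rel z z' i i' → D.pt z' i' ∈ O) ∧ z' ≠ z := by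
    filter_upwards [h1.filter_mono nhdsWithin_le_nhds, hO.filter_mono nhdsWithin_le_nhds,
      self_mem_nhdsWithin] with z' h h' h'' using ⟨h, h', h''⟩
  obtain ⟨z', h3, h4, h5⟩ := h2.exists
  obtain ⟨i', hi'⟩ := D.exists_rel_right z z' i
  exact ⟨_, h4 _ hi', hr.isReg h3 h5 _⟩

/-! ### Sections -/

/-- The plane with the closed slits removed. -/
def slitPlane : Set ℂ := {z | D.perm z.re = 1 ∨ z.im < D.height z.re}

theorem rel_of_mem_slitPlane {z : ℂ} (h : z ∈ D.slitPlane) {z' : ℂ} {i i' : I} :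
    D.Rel z z' i i' ↔ i' = i := by
  by_cases hz : z.im = D.height z.re
  · have h1 : D.perm z.re = 1 := h.resolve_right (by rw [hz]; exact lt_irrefl _)
    rw [rel_node _ hz, h1, Equiv.Perm.sameCycle_one, eq_comm]
  · have hc : D.cross z = 1 := by
      unfold cross
      rcases h with h | h
      · rw [h, ite_self]
      · rw [if_neg h.not_gt]
    by_cases hle : z'.re ≤ z.re
    · rw [rel_of_le _ hz hle]
    · rw [rel_of_lt _ hz (not_le.1 hle), hc]; rfl

theorem isReg_of_mem_slitPlane {z : ℂ} (h : z ∈ D.slitPlane) (i : I) : D.IsReg (D.pt z i) :=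
  D.isReg_pt.2 fun _ => (D.rel_of_mem_slitPlane h).1

theorem continuousOn_sheet (i : I) : ContinuousOn (fun z => D.pt z i) D.slitPlane :=
  fun _ hz => D.tendsto_pt (tendsto_id.mono_left nhdsWithin_le_nhds)
    (Eventually.of_forall fun _ => (D.rel_of_mem_slitPlane hz).2 rfl)

/-- The section crossing the slit over `a` from sheet `i` on the left. -/
def crossing (a : ℝ) (i : I) (z : ℂ) : D.Space :=
  open Classical in D.pt z (if z.re ≤ a then i else D.perm a i)

theorem crossing_of_le {a : ℝ} {z : ℂ} (h : z.re ≤ a) (i : I) : D.crossing a i z = D.pt z i := by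
  simp [crossing, h]

theorem crossing_of_lt {a : ℝ} {z : ℂ} (h : a < z.re) (i : I) :
    D.crossing a i z = D.pt z (D.perm a i) := by
  simp [crossing, h.not_ge]

theorem continuousAt_crossing {a : ℝ} {z : ℂ} (h : ∀ b, b ≠ a → b = z.re → D.perm b = 1)
    (hz : z.re = a → D.height a < z.im) (i : I) : ContinuousAt (D.crossing a i) z := by
  refine D.tendsto_pt tendsto_id ?_
  rcases lt_trichotomy z.re a with hlt | heq | hgt
  · have hs : z ∈ D.slitPlane := Or.inl (h _ hlt.ne rfl)
    filter_upwards [Complex.continuous_re.continuousAt.eventually_lt continuousAt_const hlt]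
      with z' hz'
    rw [D.rel_of_mem_slitPlane hs, if_pos hlt.le, if_pos hz'.le]
  · have hn : z.im ≠ D.height z.re := by rw [heq]; exact (hz heq).ne'
    refine Eventually.of_forall fun z' => ?_
    rw [if_pos heq.le]
    by_cases hle : z'.re ≤ z.re
    · rw [rel_of_le _ hn hle, if_pos (heq ▸ hle)]
    · rw [rel_of_lt _ hn (not_le.1 hle), if_neg (heq ▸ hle), cross, heq, if_pos (hz heq)]
  · have hs : z ∈ D.slitPlane := Or.inl (h _ hgt.ne' rfl)
    filter_upwards [continuousAt_const.eventually_lt Complex.continuous_re.continuousAt hgt]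
      with z' hz'
    rw [D.rel_of_mem_slitPlane hs, if_neg hgt.not_ge, if_neg hz'.not_ge]

/-- At a node, regularity says that the permutation fixes `i`, so the label stays constant.
Elsewhere the label is `i` up to the vertical line and `cross z i` beyond it. -/
theorem Good.exists_section {D : SlitData I} {z : ℂ} {r : ℝ} (hg : D.Good z r) {i : I}
    (hi : D.IsReg (D.pt z i)) : ∃ s : ℂ → D.Space, ContinuousOn s (Metric.ball z r) ∧
      (∀ z', D.pr (s z') = z') ∧ (∀ z' ∈ Metric.ball z r, s z' ∈ D.reg) ∧
      ∀ p ∈ D.cone z i r, p = s (D.pr p) := by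
  by_cases hz : z.im = D.height z.re
  · have h1 := (D.isReg_of_eq_height hz).1 hi
    refine ⟨fun z' => D.pt z' i, ?_, fun _ => rfl, ?_, ?_⟩
    · intro z' hz'
      refine ContinuousAt.continuousWithinAt (D.tendsto_pt tendsto_id (Eventually.of_forall
        fun z'' => ?_))
      by_cases hn : z'.im = D.height z'.re
      · rw [rel_node _ hn]
      · by_cases hle : z''.re ≤ z'.re
        · exact (D.rel_of_le hn hle).2 rfl
        · refine (D.rel_of_lt hn (not_le.1 hle)).2 ?_
          rcases hg.cross_mem hz' hz with h | h
          · rw [h]; rfl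
          · rw [h, h1]
    · intro z' hz'
      by_cases hne : z' = z
      · rw [hne]; exact hi
      · exact hg.isReg hz' hne i
    · rintro _ ⟨z', i', h2, h3, rfl⟩
      rw [rel_node _ hz] at h3
      rw [pr_pt, Equiv.Perm.SameCycle.eq_of_left h3 h1]
  · classical
    refine ⟨fun z' => D.pt z' (if z'.re ≤ z.re then i else D.cross z i), ?_, fun _ => rfl, ?_, ?_⟩
    · intro z' hz'
      refine ContinuousAt.continuousWithinAt ?_
      have hrel := (hg.rel_trans hz' (i := i) (i' := if z'.re ≤ z.re then i else D.cross z i)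
        (by simp [Rel, hz]))
      refine D.tendsto_pt tendsto_id ?_
      filter_upwards [hrel] with z'' h''
      obtain ⟨k, hk⟩ := D.exists_rel_right z' z'' (if z'.re ≤ z.re then i else D.cross z i)
      have := h'' _ hk
      simp only [Rel, hz, if_false] at this
      rwa [this] at hk
    · intro z' hz'
      by_cases hne : z' = z
      · rw [hne]; show D.IsReg _; simpa using hi
      · exact hg.isReg hz' hne _
    · rintro _ ⟨z', i', h2, h3, rfl⟩
      simp only [Rel, hz, if_false] at h3
      rw [pr_pt, h3]

/-! ### The flat completion of the regular part -/

/-- The projection, rotated by `θ`. -/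
def proj (θ : ℂ) (p : D.Space) : ℂ := θ * D.pr p

variable {θ : ℂ} (hθ : ‖θ‖ = 1)

section proj
include hθ

theorem dist_mul_unit (z z' : ℂ) : dist (θ * z) (θ * z') = dist z z' := by
  rw [dist_eq_norm, ← mul_sub, norm_mul, hθ, one_mul, dist_eq_norm]

theorem unit_ne_zero : θ ≠ 0 := by rintro rfl; simp at hθ

theorem isProperMap_proj [Finite I] : IsProperMap (D.proj θ) :=
  (Homeomorph.mulLeft₀ θ (unit_ne_zero hθ)).isProperMap.comp D.isProperMap_pr

/-- The cones over a good disc are open and are disjoint or equal, so a connected set lying over the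
disc cannot pass from one to another. -/
theorem hasTraps : HasTraps (D.proj θ) := by
  refine fun p => ?_
  revert p
  refine D.ind fun z i O hO => ?_
  obtain ⟨r, hr, hrO⟩ := (D.nhds_hasBasis z i).mem_iff.1 hO
  refine ⟨r, hr.1, D.cone z i r, hrO, (D.nhds_hasBasis z i).mem_of_mem hr, fun C hC h => ?_⟩
  rintro ⟨p, hp, hp'⟩
  refine hr.subset_cone hC (fun q hq => ?_) hp hp'
  have := h q hq
  rwa [proj, proj, dist_mul_unit hθ] at this

/-- The flat distance on the regular part between points on a section. -/
theorem flatEDist_sec {C : Set ℂ} (hC : Convex ℝ C) {s : ℂ → D.Space} (hs : ContinuousOn s C)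
    (hpr : ∀ z ∈ C, D.pr (s z) = z) (hreg : ∀ z ∈ C, s z ∈ D.reg) {y y' : D.reg} {z z' : ℂ}
    (hz : z ∈ C) (hz' : z' ∈ C) (hy : (y : D.Space) = s z) (hy' : (y' : D.Space) = s z') :
    flatEDist (D.proj θ ∘ ((↑) : D.reg → D.Space)) y y' ≤ edist z z' := by
  classical
  let t : ℂ → D.reg := fun w => if h : w ∈ C then ⟨s w, hreg w h⟩ else y
  have ht : ∀ w ∈ C, ((t w : D.reg) : D.Space) = s w := fun w hw => by simp [t, hw]
  have htc : ContinuousOn t C := by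
    rw [Topology.IsInducing.subtypeVal.continuousOn_iff]
    exact hs.congr ht
  have e : y = t z := Subtype.ext (hy.trans (ht z hz).symm)
  have e' : y' = t z' := Subtype.ext (hy'.trans (ht z' hz').symm)
  have key := flatEDist_section_le (π := D.proj θ ∘ ((↑) : D.reg → D.Space)) hC htc (θ := θ)
    (fun w hw => by simp [ht w hw, proj, hpr w hw]) hz hz'
  rw [e, e']
  refine key.trans_eq ?_
  simp only [Function.comp, ht z hz, ht z' hz', proj, hpr z hz, hpr z' hz']
  rw [edist_dist, edist_dist, dist_mul_unit hθ]

end proj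
end SlitData

/-! ### Flat diameter of the neighbourhoods of nodes -/

namespace SlitData

variable {I : Type u} {D : SlitData I} {θ : ℂ} (hθ : ‖θ‖ = 1)

theorem Good.mem_slitPlane {z : ℂ} {r : ℝ} (hg : D.Good z r) (hz : z.im = D.height z.re) {w : ℂ}
    (hw : dist w z < r) (h : w.re ≠ z.re ∨ w.im < z.im) : w ∈ D.slitPlane := by
  by_cases hre : w.re = z.re
  · right
    rw [hre, ← hz]
    exact h.resolve_left fun h' => h' hre
  · exact Or.inl (hg.perm_eq_one hw hre)

section node
include hθ

variable {z : ℂ} {r : ℝ} (hg : D.Good z r) (hz : z.im = D.height z.re)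
include hg

theorem Good.flatEDist_ball_sec {C : Set ℂ} (hC : Convex ℝ C) (hCb : C ⊆ Metric.ball z r)
    {s : ℂ → D.Space} (hs : ∀ w ∈ C, ContinuousAt s w)
    (hpr : ∀ z ∈ C, D.pr (s z) = z) (hreg : ∀ z ∈ C, s z ∈ D.reg) {y y' : D.reg} {w w' : ℂ}
    (hw : w ∈ C) (hw' : w' ∈ C) (hy : (y : D.Space) = s w) (hy' : (y' : D.Space) = s w') :
    flatEDist (D.proj θ ∘ ((↑) : D.reg → D.Space)) y y' ≤ ENNReal.ofReal (2 * r) := by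
  refine (D.flatEDist_sec hθ hC (fun w hw => (hs w hw).continuousWithinAt) hpr hreg hw hw' hy
    hy').trans ?_
  rw [edist_dist]
  refine ENNReal.ofReal_le_ofReal ?_
  have := dist_triangle_right w w' z
  linarith [Metric.mem_ball.1 (hCb hw), Metric.mem_ball.1 (hCb hw')]

include hz

theorem Good.flatEDist_sheet {H : Set ℂ} (hH : Convex ℝ H) (hs : ∀ w ∈ H, w.re ≠ z.re ∨ w.im < z.im)
    {y y' : D.reg} {w w' : ℂ} {k : I} (hw : w ∈ H) (hw' : w' ∈ H) (hb : dist w z < r)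
    (hb' : dist w' z < r) (hy : (y : D.Space) = D.pt w k) (hy' : (y' : D.Space) = D.pt w' k) :
    flatEDist (D.proj θ ∘ ((↑) : D.reg → D.Space)) y y' ≤ ENNReal.ofReal (2 * r) := by
  have hm : ∀ w ∈ H ∩ Metric.ball z r, w ∈ D.slitPlane := fun w hw =>
    hg.mem_slitPlane hz hw.2 (hs w hw.1)
  exact hg.flatEDist_ball_sec hθ (hH.inter (convex_ball z r)) inter_subset_right
    (s := fun w => D.pt w k)
    (fun w hw => D.tendsto_pt tendsto_id (Eventually.of_forall fun _ =>
      (D.rel_of_mem_slitPlane (hm w hw)).2 rfl)) (fun _ _ => rfl)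
    (fun w hw => D.isReg_of_mem_slitPlane (hm w hw) k) ⟨hw, hb⟩ ⟨hw', hb'⟩ hy hy'

theorem Good.flatEDist_crossing {y y' : D.reg} {w w' : ℂ} {k : I} (hw : z.im < w.im)
    (hw' : z.im < w'.im) (hb : dist w z < r) (hb' : dist w' z < r)
    (hy : (y : D.Space) = D.crossing z.re k w) (hy' : (y' : D.Space) = D.crossing z.re k w') :
    flatEDist (D.proj θ ∘ ((↑) : D.reg → D.Space)) y y' ≤ ENNReal.ofReal (2 * r) := by
  refine hg.flatEDist_ball_sec hθ (C := {w | z.im < w.im} ∩ Metric.ball z r)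
    ((convex_halfSpace_im_gt z.im).inter (convex_ball z r)) inter_subset_right
    (fun w hw => continuousAt_crossing D (fun b hb hbw => ?_) (fun _ => hz ▸ hw.1) k)
    (fun _ _ => rfl) (fun w hw => hg.isReg hw.2 (fun h => absurd hw.1 (by simp [h])) _)
    ⟨hw, hb⟩ ⟨hw', hb'⟩ hy hy'
  rw [hbw] at hb ⊢
  exact hg.perm_eq_one hw.2 hb

-- Such points are at distance at most `r / √2` from the centre.
omit hz in
theorem Good.corner {s t : ℝ} (hs : |s| ≤ 1 / 2) (ht : |t| ≤ 1 / 2) :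
    dist (⟨z.re + s * r, z.im + t * r⟩ : ℂ) z < r := by
  have hr := hg.1
  rw [Complex.dist_eq_re_im]
  simp only [add_sub_cancel_left]
  rw [Real.sqrt_lt' hr]
  have h1 := sq_le_sq' (abs_le.1 hs).1 (abs_le.1 hs).2
  have h2 := sq_le_sq' (abs_le.1 ht).1 (abs_le.1 ht).2
  nlinarith [sq_nonneg r, mul_pos hr hr]

/-- The base point of sheet `k` in the neighbourhood of a node. -/
def Good.basePt (k : I) : D.reg :=
  ⟨D.pt ⟨z.re + 0 * r, z.im + (-1 / 2) * r⟩ k, D.isReg_of_mem_slitPlane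
    (hg.mem_slitPlane hz (hg.corner hθ (s := 0) (t := -1 / 2) (by norm_num)
      (by norm_num [abs_of_neg])) (Or.inr (by simp; linarith [hg.1]))) _⟩

/-- The route descends in the left half disc and then crosses the lower half disc. These are two
convex pieces free of slits, each costing at most the diameter `2 * r`. -/
theorem Good.exists_left (k : I) : ∃ c : D.reg,
    (c : D.Space) = D.pt ⟨z.re + (-1/2) * r, z.im + (1/2) * r⟩ k ∧
    flatEDist (D.proj θ ∘ ((↑) : D.reg → D.Space)) c (hg.basePt hθ hz k) ≤
      ENNReal.ofReal (4 * r) := by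
  have hr := hg.1
  have c1 := hg.corner hθ (s := -1/2) (t := 1/2) (by norm_num [abs_of_neg]) (by norm_num)
  have c2 := hg.corner hθ (s := -1/2) (t := -1/2) (by norm_num [abs_of_neg]) (by norm_num [abs_of_neg])
  have c3 := hg.corner hθ (s := 0) (t := -1/2) (by norm_num) (by norm_num [abs_of_neg])
  refine ⟨⟨_, D.isReg_of_mem_slitPlane (hg.mem_slitPlane hz c1 (Or.inl (by simp; linarith))) k⟩,
    rfl, ?_⟩
  let d : D.reg := ⟨_, D.isReg_of_mem_slitPlane (hg.mem_slitPlane hz c2 (Or.inl (by simp; linarith))) k⟩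
  refine (flatEDist_triangle _ _ d _).trans ?_
  rw [show 4 * r = 2 * r + 2 * r by ring, ENNReal.ofReal_add (by linarith) (by linarith)]
  refine add_le_add ?_ ?_
  · exact hg.flatEDist_sheet hθ hz (convex_halfSpace_re_lt z.re) (fun w hw => Or.inl (ne_of_lt hw))
      (by simp; linarith) (by simp; linarith) c1 c2 rfl rfl
  · exact hg.flatEDist_sheet hθ hz (convex_halfSpace_im_lt z.im) (fun w hw => Or.inr hw)
      (by simp; linarith) (by simp; linarith) c2 c3 rfl rfl

theorem Good.exists_right (k : I) : ∃ c : D.reg,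
    (c : D.Space) = D.pt ⟨z.re + (1/2) * r, z.im + (1/2) * r⟩ k ∧
    flatEDist (D.proj θ ∘ ((↑) : D.reg → D.Space)) c (hg.basePt hθ hz k) ≤
      ENNReal.ofReal (4 * r) := by
  have hr := hg.1
  have c1 := hg.corner hθ (s := 1/2) (t := 1/2) (by norm_num) (by norm_num)
  have c2 := hg.corner hθ (s := 1/2) (t := -1/2) (by norm_num) (by norm_num [abs_of_neg])
  have c3 := hg.corner hθ (s := 0) (t := -1/2) (by norm_num) (by norm_num [abs_of_neg])
  refine ⟨⟨_, D.isReg_of_mem_slitPlane (hg.mem_slitPlane hz c1 (Or.inl (by simp; linarith))) k⟩,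
    rfl, ?_⟩
  let d : D.reg := ⟨_, D.isReg_of_mem_slitPlane (hg.mem_slitPlane hz c2 (Or.inl (by simp; linarith))) k⟩
  refine (flatEDist_triangle _ _ d _).trans ?_
  rw [show 4 * r = 2 * r + 2 * r by ring, ENNReal.ofReal_add (by linarith) (by linarith)]
  refine add_le_add ?_ ?_
  · exact hg.flatEDist_sheet hθ hz (convex_halfSpace_re_gt z.re) (fun w hw => Or.inl (ne_of_gt hw))
      (by simp; linarith) (by simp; linarith) c1 c2 rfl rfl
  · exact hg.flatEDist_sheet hθ hz (convex_halfSpace_im_lt z.im) (fun w hw => Or.inr hw)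
      (by simp; linarith) (by simp; linarith) c2 c3 rfl rfl

/-- One turn around the node: up on the left for `4 * r`, across the slit for `2 * r`, down on the
right for `4 * r`. -/
theorem Good.flatEDist_basePt_perm (k : I) :
    flatEDist (D.proj θ ∘ ((↑) : D.reg → D.Space)) (hg.basePt hθ hz k)
      (hg.basePt hθ hz (D.perm z.re k)) ≤ ENNReal.ofReal (10 * r) := by
  have hr := hg.1
  have c1 := hg.corner hθ (s := -1/2) (t := 1/2) (by norm_num [abs_of_neg]) (by norm_num)
  have c2 := hg.corner hθ (s := 1/2) (t := 1/2) (by norm_num) (by norm_num)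
  obtain ⟨c, hc, h1⟩ := hg.exists_left hθ hz k
  obtain ⟨c', hc', h2⟩ := hg.exists_right hθ hz (D.perm z.re k)
  refine (flatEDist_triangle _ _ c _).trans ?_
  rw [show 10 * r = 4 * r + (2 * r + 4 * r) by ring, ENNReal.ofReal_add (by linarith)
    (by linarith), ENNReal.ofReal_add (p := 2 * r) (by linarith) (by linarith)]
  refine add_le_add ((flatEDist_comm_le _ _ _).trans h1) ((flatEDist_triangle _ _ c' _).trans
    (add_le_add ?_ h2))
  refine hg.flatEDist_crossing hθ hz (k := k) (by simp; linarith) (by simp; linarith) c1 c2 ?_ ?_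
  · rw [hc, D.crossing_of_le (by simp; linarith)]
  · rw [hc', D.crossing_of_lt (by simp; linarith)]

theorem Good.flatEDist_basePt_pow (k : I) (n : ℕ) :
    flatEDist (D.proj θ ∘ ((↑) : D.reg → D.Space)) (hg.basePt hθ hz k)
      (hg.basePt hθ hz ((D.perm z.re ^ n) k)) ≤ ENNReal.ofReal (n * (10 * r)) := by
  induction n with
  | zero => simp [flatEDist_self]
  | succ n ih =>
    have hr := hg.1
    refine (flatEDist_triangle _ _ _ _).trans ((add_le_add ih ?_).trans_eq
      (ENNReal.ofReal_add (q := 10 * r) (by positivity) (by positivity)).symm |>.trans_eq ?_)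
    · rw [pow_succ', Equiv.Perm.mul_apply]
      exact hg.flatEDist_basePt_perm hθ hz _
    · push_cast; congr 1; ring

/-- One convex piece joins the point to an upper corner for `2 * r`, and the corner is within `4 *
r` of the base point. Points straight below the node reach the base point directly, and points on
the slit use the crossing section. -/
theorem Good.flatEDist_basePt {w : ℂ} (hw : dist w z < r) (hne : w ≠ z) {k : I} {y : D.reg}
    (hy : (y : D.Space) = D.pt w k) :
    flatEDist (D.proj θ ∘ ((↑) : D.reg → D.Space)) y (hg.basePt hθ hz k) ≤
      ENNReal.ofReal (6 * r) := by
  have hr := hg.1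
  obtain ⟨c, hc, h1⟩ := hg.exists_left hθ hz k
  obtain ⟨c', hc', h2⟩ := hg.exists_right hθ hz k
  have c1 := hg.corner hθ (s := -1/2) (t := 1/2) (by norm_num [abs_of_neg]) (by norm_num)
  have c2 := hg.corner hθ (s := 1/2) (t := 1/2) (by norm_num) (by norm_num)
  have c3 := hg.corner hθ (s := 0) (t := -1/2) (by norm_num) (by norm_num [abs_of_neg])
  rw [show 6 * r = 2 * r + 4 * r by ring, ENNReal.ofReal_add (by linarith) (by linarith)]
  rcases lt_trichotomy w.re z.re with hre | hre | hre
  · exact (flatEDist_triangle _ _ c _).trans (add_le_add (hg.flatEDist_sheet hθ hz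
      (convex_halfSpace_re_lt z.re) (fun w hw => Or.inl (ne_of_lt hw))
      hre (by simp; linarith) hw c1 hy hc) h1)
  · rcases lt_trichotomy w.im z.im with him | him | him
    · exact (hg.flatEDist_sheet hθ hz (convex_halfSpace_im_lt z.im) (fun w hw => Or.inr hw)
        him (by simp; linarith) hw c3 hy rfl).trans le_self_add
    · exact absurd (Complex.ext hre him) hne
    · refine (flatEDist_triangle _ _ c _).trans (add_le_add (hg.flatEDist_crossing hθ hz (k := k)
        him (by simp; linarith) hw c1 ?_ ?_) h1)
      · rw [hy, D.crossing_of_le hre.le]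
      · rw [hc, D.crossing_of_le (by simp; linarith)]
  · exact (flatEDist_triangle _ _ c' _).trans (add_le_add (hg.flatEDist_sheet hθ hz
      (convex_halfSpace_re_gt z.re) (fun w hw => Or.inl (ne_of_gt hw))
      hre (by simp; linarith) hw c2 hy hc') h2)

end node

include hθ in
theorem hasSmallNhds [Finite I] : HasSmallNhds (D.proj θ) D.reg := by
  refine fun p => ?_
  revert p
  refine D.ind fun z i ε hε => ?_
  obtain ⟨r₀, hr₀⟩ := D.exists_good z
  obtain ⟨ε', h0, hε'⟩ : ∃ ε' : ℝ, 0 < ε' ∧ ENNReal.ofReal ε' ≤ ε := by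
    obtain ⟨q, hq, h⟩ := ENNReal.lt_iff_exists_nnreal_btwn.1 hε
    exact ⟨q, by simpa using hq, by simpa using h.le⟩
  -- Going from a point to its base point costs `6 * r`, twice in all, and each of the fewer than
  -- `orderOf` turns around the node costs `10 * r`.
  set M : ℝ := 12 + orderOf (D.perm z.re) * 10 with hM
  have hM0 : 0 < M := by positivity
  set r := min r₀ (ε' / M) with hr
  have hg : D.Good z r := hr₀.mono (lt_min hr₀.1 (by positivity)) (min_le_left _ _)
  have hrM : M * r ≤ ε' := by
    rw [mul_comm, ← le_div_iff₀ hM0]; exact min_le_right _ _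
  have hr0 := hg.1
  refine ⟨_, (hg.isOpen_cone i).mem_nhds (D.mem_cone_self hr0 i), fun y y' hy hy' =>
    le_trans ?_ hε'⟩
  by_cases hreg : D.IsReg (D.pt z i)
  · obtain ⟨s, hs, h1, h2, h3⟩ := hg.exists_section hreg
    refine (D.flatEDist_sec hθ (convex_ball z r) hs (fun w _ => h1 w) h2 (D.cone_subset _ _ _ hy)
      (D.cone_subset _ _ _ hy') (h3 _ hy) (h3 _ hy')).trans ?_
    rw [edist_dist]
    refine ENNReal.ofReal_le_ofReal (le_trans ?_ hrM)
    have h4 : dist (D.pr y) z < r := D.cone_subset _ _ _ hy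
    have h5 : dist (D.pr y') z < r := D.cone_subset _ _ _ hy'
    have h6 : 2 * r ≤ M * r := by
      refine mul_le_mul_of_nonneg_right ?_ hr0.le
      have : (0 : ℝ) ≤ orderOf (D.perm z.re) := by positivity
      linarith
    linarith [dist_triangle_right (D.pr y) (D.pr y') z]
  · have hz : z.im = D.height z.re := by
      by_contra hz; exact hreg (D.isReg_of_ne_height hz i)
    have key : ∀ y : D.reg, (y : D.Space) ∈ D.cone z i r → ∃ k, (D.perm z.re).SameCycle i k ∧
        flatEDist (D.proj θ ∘ ((↑) : D.reg → D.Space)) y (hg.basePt hθ hz k) ≤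
          ENNReal.ofReal (6 * r) := by
      rintro ⟨y, hyr⟩ ⟨w, k, h1, h2, rfl⟩
      rw [rel_node _ hz] at h2
      refine ⟨k, h2, hg.flatEDist_basePt hθ hz h1 ?_ rfl⟩
      rintro rfl
      rw [← D.pt_eq_pt'.2 ((D.rel_node hz).2 h2)] at hyr
      exact hreg hyr
    obtain ⟨k, hk, h1⟩ := key y hy
    obtain ⟨k', hk', h2⟩ := key y' hy'
    obtain ⟨n, hn, rfl⟩ : ∃ n < orderOf (D.perm z.re), (D.perm z.re ^ n) k = k' :=
      (hk.symm.trans hk').exists_pow_eq'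
    refine (flatEDist_triangle _ _ (hg.basePt hθ hz k) _).trans ((add_le_add h1
      ((flatEDist_triangle _ _ _ _).trans (add_le_add (hg.flatEDist_basePt_pow hθ hz k n)
      ((flatEDist_comm_le _ _ _).trans h2)))).trans ?_)
    rw [← ENNReal.ofReal_add (by positivity) (by positivity), ← ENNReal.ofReal_add (by positivity)
      (by positivity)]
    refine ENNReal.ofReal_le_ofReal (le_trans ?_ hrM)
    have : (n : ℝ) ≤ orderOf (D.perm z.re) := by exact_mod_cast hn.le
    have := mul_le_mul_of_nonneg_right this (by positivity : 0 ≤ 10 * r)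
    rw [hM]; linarith

end SlitData

/-! ### Surfaces from local homeomorphisms -/

section Constructor

variable {X : Type u} [TopologicalSpace X]

/-- The charted space structure whose charts are the restrictions of a local homeomorphism. -/
@[reducible] def IsLocalHomeomorph.etaleChartedSpace {Y : Type v} [TopologicalSpace Y] {π : X → Y}
    (hπ : IsLocalHomeomorph π) : ChartedSpace Y X where
  atlas := {e | π = e}
  chartAt x := (hπ x).choose
  mem_chart_source x := (hπ x).choose_spec.1
  chart_mem_atlas x := (hπ x).choose_spec.2

theorem IsLocalHomeomorph.isManifold {π : X → ℂ} (hπ : IsLocalHomeomorph π) :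
    @IsManifold ℂ _ ℂ _ _ ℂ _ 𝓘(ℂ) ω X _ hπ.etaleChartedSpace := by
  let _ := hπ.etaleChartedSpace
  refine isManifold_of_contDiffOn _ _ _ fun e e' (he : π = e) (he' : π = e') => ?_
  refine contDiffOn_id.congr fun z hz => ?_
  have h1 : z ∈ e.target := by simp at hz; exact hz.1
  simp [← he', he, e.right_inv h1]

theorem IsLocalHomeomorph.isLocalDiffeomorph {π : X → ℂ} (hπ : IsLocalHomeomorph π) :
    @IsLocalDiffeomorph ℂ _ ℂ _ _ ℂ _ _ ℂ _ ℂ _ 𝓘(ℂ) 𝓘(ℂ) X _ hπ.etaleChartedSpace ℂ _ _ ω π := by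
  let _ := hπ.etaleChartedSpace
  have _ := hπ.isManifold
  intro x
  obtain ⟨e, hx, he⟩ := hπ x
  have hm : e ∈ IsManifold.maximalAtlas 𝓘(ℂ) ω X := IsManifold.subset_maximalAtlas he
  exact ⟨{ toPartialEquiv := e.toPartialEquiv
           open_source := e.open_source
           open_target := e.open_target
           contMDiffOn_toFun := contMDiffOn_of_mem_maximalAtlas hm
           contMDiffOn_invFun := contMDiffOn_symm_of_mem_maximalAtlas hm }, hx, fun y _ =>
    congrFun he y⟩

/-- The log-Riemann surface given by a local homeomorphism to the plane. -/
@[reducible] def LogRiemannSurface.ofIsLocalHomeomorph [T2Space X] [ConnectedSpace X] {π : X → ℂ}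
    (hπ : IsLocalHomeomorph π) (hd : DiscreteTopology (ramificationSet π)) : LogRiemannSurface.{u} :=
  { carrier := X
    chartedSpace := hπ.etaleChartedSpace
    isManifold := hπ.isManifold
    π := π
    isLocalDiffeomorph := hπ.isLocalDiffeomorph
    discrete := hd }

end Constructor

theorem JoinedIn.of_section {X : Type u} [TopologicalSpace X] {C : Set ℂ} (hC : Convex ℝ C)
    {s : ℂ → X} (hs : ContinuousOn s C) {F : Set X} (hF : ∀ z ∈ C, s z ∈ F) {z z' : ℂ}
    (hz : z ∈ C) (hz' : z' ∈ C) : JoinedIn F (s z) (s z') :=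
  JoinedIn.mono ((hC.isPathConnected ⟨z, hz⟩).image' hs |>.joinedIn _ (mem_image_of_mem _ hz) _
    (mem_image_of_mem _ hz')) (image_subset_iff.2 hF)

namespace SlitData

variable {I : Type u} (D : SlitData I)

/-! ### The regular part is a log-Riemann surface -/

section
variable {θ : ℂ} (hθ : ‖θ‖ = 1)
include hθ

theorem isLocalHomeomorph_proj [Finite I] :
    IsLocalHomeomorph (D.proj θ ∘ ((↑) : D.reg → D.Space)) := by
  rw [isLocalHomeomorph_iff_isOpenEmbedding_restrict]
  rintro ⟨p, hp⟩
  revert p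
  refine D.ind fun z i hp => ?_
  obtain ⟨r, hg⟩ := D.exists_good z
  obtain ⟨s, -, -, -, hs⟩ := hg.exists_section hp
  have ho := (hg.isOpen_cone i).preimage (continuous_subtype_val (p := (· ∈ D.reg)))
  refine ⟨_, ho.mem_nhds (D.mem_cone_self hg.1 i), .of_continuous_injective_isOpenMap ?_ ?_ ?_⟩
  · exact ((D.isProperMap_proj hθ).continuous.comp continuous_subtype_val).comp
      continuous_subtype_val
  · rintro ⟨y, hy⟩ ⟨y', hy'⟩ h
    have h1 : D.pr y = D.pr y' := mul_left_cancel₀ (unit_ne_zero hθ) h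
    exact Subtype.ext (Subtype.ext ((hs _ hy).trans (h1 ▸ (hs _ hy').symm)))
  · exact (((Homeomorph.mulLeft₀ θ (unit_ne_zero hθ)).isOpenMap.comp D.isOpenMap_pr).comp
      D.isOpen_reg.isOpenMap_subtype_val).comp ho.isOpenMap_subtype_val

end

/-- Any two sheets are connected by the permutations. -/
def Transitive : Prop := ∀ i i' : I, Relation.EqvGen (fun k k' => ∃ a, D.perm a k = k') i i'

theorem isConnected_slitPlane : IsConnected D.slitPlane := by
  obtain ⟨M, hM⟩ : ∃ M, ∀ a, D.perm a ≠ 1 → M < D.height a := by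
    obtain ⟨M, hM⟩ := (D.finite_support.image D.height).bddBelow
    exact ⟨M - 1, fun a ha => by linarith [hM ⟨a, ha, rfl⟩]⟩
  have hlow : ∀ z : ℂ, z.im ≤ M → z ∈ D.slitPlane := fun z hz => by
    by_cases h : D.perm z.re = 1
    exacts [Or.inl h, Or.inr (hz.trans_lt (hM _ h))]
  have hne : D.slitPlane.Nonempty := ⟨⟨0, M⟩, hlow _ le_rfl⟩
  have := contractibleSpace_of_down (A := D.slitPlane) (M := M)
    (fun z hz t ht => hz.imp id ht.trans_lt) (by
      convert convex_halfSpace_im_le M using 1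
      ext z
      exact ⟨fun h => h.2, fun h => ⟨hlow z h, h⟩⟩) hne
  rw [isConnected_iff_connectedSpace]
  infer_instance

/-- Each sheet over the slit plane is connected, neighbouring sheets are joined across a slit, and
transitivity reaches all of them. Their union is dense in the regular part, and components are
closed. -/
theorem connectedSpace_reg [Finite I] [Nonempty I] (hD : D.Transitive) : ConnectedSpace D.reg := by
  let σ : I → D.slitPlane → D.reg := fun i z => ⟨D.pt z i, D.isReg_of_mem_slitPlane z.2 i⟩
  have hσ : ∀ i, Continuous (σ i) := fun i =>
    (continuousOn_iff_continuous_domRestrict.1 (D.continuousOn_sheet i)).subtype_mk _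
  have : ConnectedSpace D.slitPlane := isConnected_iff_connectedSpace.1 D.isConnected_slitPlane
  have h1 : ∀ i z z', connectedComponent (σ i z) = connectedComponent (σ i z') := fun i z z' =>
    connectedComponent_eq ((isPreconnected_range (hσ i)).subset_connectedComponent ⟨z, rfl⟩ ⟨z', rfl⟩)
  obtain ⟨z₀⟩ : Nonempty D.slitPlane := inferInstance
  have h2 : ∀ i a, connectedComponent (σ i z₀) = connectedComponent (σ (D.perm a i) z₀) := by
    intro i a
    -- A section over a disc about the point one unit above the node joins sheet `i` on the left to
    -- sheet `perm a i` on the right.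
    obtain ⟨r, hg⟩ := D.exists_good ⟨a, D.height a + 1⟩
    have hr := hg.1
    have hr1 : r ≤ 1 := by simpa using hg.2.2 (by simp)
    have hreg : D.IsReg (D.pt ⟨a, D.height a + 1⟩ i) := D.isReg_of_ne_height (by simp) i
    have hb : ∀ t : ℝ, |t| < r → dist (⟨a + t, D.height a + 1⟩ : ℂ) ⟨a, D.height a + 1⟩ < r := by
      intro t ht
      rw [Complex.dist_eq_re_im]
      simpa [Real.sqrt_sq_eq_abs] using ht
    obtain ⟨s, hs, hpr, hsr, hcs⟩ := hg.exists_section hreg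
    have hl := hb (-(r / 2)) (by rw [abs_neg, abs_of_pos] <;> linarith)
    have hr' := hb (r / 2) (by rw [abs_of_pos] <;> linarith)
    have e1 := hcs (D.pt ⟨a + -(r / 2), D.height a + 1⟩ i)
      (hg.mem_cone.2 ⟨hl, (D.rel_of_le (by simp) (by simp; linarith)).2 rfl⟩)
    have e2 := hcs (D.pt ⟨a + r / 2, D.height a + 1⟩ (D.perm a i))
      (hg.mem_cone.2 ⟨hr', (D.rel_of_lt (by simp) (by simp; linarith)).2 (by simp [cross])⟩)
    have m1 := hg.perm_eq_one hl (by simp; linarith)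
    have m2 := hg.perm_eq_one hr' (by simp; linarith)
    rw [h1 i z₀ ⟨_, Or.inl m1⟩, h1 _ z₀ ⟨_, Or.inl m2⟩]
    refine connectedComponent_eq ?_
    have hpre : IsPreconnected (((↑) : D.reg → D.Space) ⁻¹' (s '' Metric.ball
        ⟨a, D.height a + 1⟩ r)) := by
      rw [← Topology.IsInducing.subtypeVal.isPreconnected_image, image_preimage_eq_of_subset]
      · exact (convex_ball _ _).isPreconnected.image _ hs
      · rintro _ ⟨z, hz, rfl⟩
        exact ⟨⟨_, hsr z hz⟩, rfl⟩
    refine hpre.subset_connectedComponent (x := σ i ⟨_, Or.inl m1⟩)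
      ⟨_, hl, e1.symm⟩ ⟨_, hr', e2.symm⟩
  have h3 : ∀ i i', connectedComponent (σ i z₀) = connectedComponent (σ i' z₀) := by
    intro i i'
    induction hD i i' with
    | rel _ _ h => obtain ⟨a, rfl⟩ := h; exact h2 _ a
    | refl => rfl
    | symm _ _ _ h => exact h.symm
    | trans _ _ _ _ _ h h' => exact h.trans h'
  obtain ⟨i₀⟩ := ‹Nonempty I›
  have h4 : connectedComponent (σ i₀ z₀) = univ := by
    refine eq_univ_of_forall fun y => ?_
    obtain ⟨p, hp⟩ := y
    revert p
    refine D.ind fun z i hp => ?_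
    rw [← isClosed_connectedComponent.closure_eq, mem_closure_iff_nhds]
    intro O hO
    obtain ⟨O', hO', hOO⟩ := mem_nhds_subtype _ _ _ |>.1 hO
    obtain ⟨r, hg⟩ := D.exists_good z
    rw [D.mem_nhds_iff] at hO'
    obtain ⟨ε, hε, hb⟩ := Metric.eventually_nhds_iff.1 hO'
    -- A small shift to the left leaves the slits and keeps the label `i`, even when the point is a
    -- node.
    set δ := min r ε / 2 with hδ
    have hm := lt_min hg.1 hε
    have hd : dist (⟨z.re - δ, z.im⟩ : ℂ) z < min r ε := by
      rw [Complex.dist_eq_re_im]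
      simp only [sub_sub_cancel_left, sub_self]
      rw [neg_sq, zero_pow two_ne_zero, add_zero, Real.sqrt_sq (by positivity)]
      linarith
    have hne : (⟨z.re - δ, z.im⟩ : ℂ).re ≠ z.re := by simp; positivity
    have m := hg.perm_eq_one (hd.trans_le (min_le_left _ _)) hne
    have hrel : D.Rel z ⟨z.re - δ, z.im⟩ i i := by
      by_cases hz : z.im = D.height z.re
      · rw [rel_node _ hz]
      · rw [rel_of_le _ hz (by simp; positivity)]
    refine ⟨σ i ⟨_, Or.inl m⟩, hOO (hb (hd.trans_le (min_le_right _ _)) i hrel), ?_⟩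
    rw [h3 i₀ i, h1 i z₀ ⟨_, Or.inl m⟩]
    exact mem_connectedComponent
  exact connectedSpace_iff_connectedComponent.2 ⟨_, h4⟩

section
variable {θ : ℂ} (hθ : ‖θ‖ = 1) [Finite I]
include hθ

theorem exists_homeomorph_completion :
    ∃ e : FlatCompletion (D.proj θ ∘ ((↑) : D.reg → D.Space)) ≃ₜ D.Space,
      ∀ y : D.reg, e (toFlatCompletion _ y) = y :=
  have := regularSpace_of_isProperMap (D.isProperMap_proj hθ)
  exists_homeomorph_flatCompletion (D.isProperMap_proj hθ) D.dense_reg (D.hasTraps hθ)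
    (hasSmallNhds hθ)

/-- The flat completion of the regular part is the branched covering. -/
def completionHomeo : FlatCompletion (D.proj θ ∘ ((↑) : D.reg → D.Space)) ≃ₜ D.Space :=
  (D.exists_homeomorph_completion hθ).choose

theorem completionHomeo_coe (y : D.reg) : D.completionHomeo hθ (toFlatCompletion _ y) = y :=
  (D.exists_homeomorph_completion hθ).choose_spec y

theorem ramificationSet_proj : ramificationSet (D.proj θ ∘ ((↑) : D.reg → D.Space)) =
    D.completionHomeo hθ ⁻¹' D.regᶜ := by
  rw [ramificationSet, preimage_compl]
  congr 1
  ext w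
  constructor
  · rintro ⟨y, rfl⟩
    rw [mem_preimage, completionHomeo_coe]; exact y.2
  · intro h
    exact ⟨⟨_, h⟩, (D.completionHomeo hθ).injective (D.completionHomeo_coe hθ _)⟩

theorem finite_ramificationSet :
    (ramificationSet (D.proj θ ∘ ((↑) : D.reg → D.Space))).Finite := by
  rw [D.ramificationSet_proj hθ]
  exact D.finite_not_isReg.preimage (D.completionHomeo hθ).injective.injOn

theorem flatExtension_proj (w : FlatCompletion (D.proj θ ∘ ((↑) : D.reg → D.Space))) :
    flatExtension _ w = D.proj θ (D.completionHomeo hθ w) := by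
  have h1 : Continuous (flatExtension (D.proj θ ∘ ((↑) : D.reg → D.Space))) :=
    UniformSpace.Completion.continuous_extension
  have h2 : Continuous (D.proj θ ∘ D.completionHomeo hθ) :=
    (D.isProperMap_proj hθ).continuous.comp (D.completionHomeo hθ).continuous
  refine congrFun (h1.ext_on (s := range (toFlatCompletion (D.proj θ ∘ ((↑) : D.reg → D.Space))))
    UniformSpace.Completion.denseRange_coe h2 ?_) w
  rintro _ ⟨y, rfl⟩
  rw [flatExtension_toFlatCompletion, Function.comp_apply, Function.comp_apply,
    completionHomeo_coe]

end

/-- The log-Riemann surface described by slit data. -/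
def surface {θ : ℂ} (hθ : ‖θ‖ = 1) [Finite I] [Nonempty I] (hD : D.Transitive) :
    LogRiemannSurface.{u} :=
  have := D.connectedSpace_reg hD
  have := (D.finite_ramificationSet hθ).to_subtype
  .ofIsLocalHomeomorph (D.isLocalHomeomorph_proj hθ) inferInstance

end SlitData

/-! ### Punctured neighbourhoods of nodes and ramification orders -/

namespace SlitData

variable {I : Type u} {D : SlitData I}

section node
variable {z : ℂ} {r : ℝ} (hg : D.Good z r) (hz : z.im = D.height z.re) {i : I}
include hg

theorem Good.mem_puncturedCone {w : ℂ} {k : I} (hi : ¬ D.IsReg (D.pt z i)) :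
    D.pt w k ∈ D.cone z i r ∩ D.reg ↔ dist w z < r ∧ D.Rel z w i k ∧ w ≠ z := by
  rw [mem_inter_iff, hg.mem_cone, and_assoc]
  refine and_congr_right fun h1 => and_congr_right fun h2 => ⟨?_, fun h => hg.isReg h1 h k⟩
  rintro h rfl
  rw [← D.pt_eq_pt'.2 h2] at h
  exact hi h

include hz

theorem Good.joinedIn_sheet {H : Set ℂ} (hH : Convex ℝ H) (hs : ∀ w ∈ H, w.re ≠ z.re ∨ w.im < z.im)
    {w w' : ℂ} {k : I} (hk : (D.perm z.re).SameCycle i k) (hw : w ∈ H) (hw' : w' ∈ H)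
    (hb : dist w z < r) (hb' : dist w' z < r) :
    JoinedIn (D.cone z i r ∩ D.reg) (D.pt w k) (D.pt w' k) := by
  have hm : ∀ w ∈ H ∩ Metric.ball z r, w ∈ D.slitPlane := fun w hw =>
    hg.mem_slitPlane hz hw.2 (hs w hw.1)
  exact JoinedIn.of_section (hH.inter (convex_ball z r))
    (s := fun w => D.pt w k) (F := D.cone z i r ∩ D.reg)
    ((D.continuousOn_sheet k).mono hm) (fun w hw => ⟨hg.mem_cone.2 ⟨hw.2, (D.rel_node hz).2 hk⟩,
      D.isReg_of_mem_slitPlane (hm w hw) k⟩) ⟨hw, hb⟩ ⟨hw', hb'⟩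

theorem Good.joinedIn_crossing {w w' : ℂ} {k : I} (hk : (D.perm z.re).SameCycle i k)
    (hw : z.im < w.im) (hw' : z.im < w'.im) (hb : dist w z < r) (hb' : dist w' z < r) :
    JoinedIn (D.cone z i r ∩ D.reg) (D.crossing z.re k w) (D.crossing z.re k w') := by
  refine JoinedIn.of_section (C := {w | z.im < w.im} ∩ Metric.ball z r)
    (s := D.crossing z.re k) (F := D.cone z i r ∩ D.reg)
    ((convex_halfSpace_im_gt z.im).inter (convex_ball z r))
    (fun w hw => (continuousAt_crossing D (fun b hb hbw => ?_) (fun _ => hz ▸ hw.1)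
      k).continuousWithinAt)
    (fun w hw => ⟨hg.mem_cone.2 ⟨hw.2, (D.rel_node hz).2 ?_⟩,
      hg.isReg hw.2 (fun h => absurd hw.1 (by simp [h])) _⟩)
    ⟨hw, hb⟩ ⟨hw', hb'⟩
  · rw [hbw] at hb ⊢
    exact hg.perm_eq_one hw.2 hb
  · split_ifs
    exacts [hk, Equiv.Perm.sameCycle_apply_right.2 hk]

theorem Good.joinedIn_low {w : ℂ} {k : I} (hk : (D.perm z.re).SameCycle i k) (hw : dist w z < r)
    (h : w.re ≠ z.re ∨ w.im < z.im) :
    JoinedIn (D.cone z i r ∩ D.reg) (D.pt w k) (D.pt ⟨z.re + 0 * r, z.im + (-1/2) * r⟩ k) := by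
  have hr := hg.1
  have c1 := hg.corner (s := -1/2) (t := -1/2) norm_one (by norm_num [abs_of_neg])
    (by norm_num [abs_of_neg])
  have c2 := hg.corner (s := 1/2) (t := -1/2) norm_one (by norm_num) (by norm_num [abs_of_neg])
  have c3 := hg.corner (s := 0) (t := -1/2) norm_one (by norm_num) (by norm_num [abs_of_neg])
  have low : ∀ {w w' : ℂ}, w.im < z.im → w'.im < z.im → dist w z < r → dist w' z < r →
      JoinedIn (D.cone z i r ∩ D.reg) (D.pt w k) (D.pt w' k) := fun h h' =>
    hg.joinedIn_sheet hz (convex_halfSpace_im_lt z.im) (fun w hw => Or.inr hw) hk h h'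
  rcases h with h | h
  · rcases lt_or_gt_of_ne h with h | h
    · exact (hg.joinedIn_sheet hz (convex_halfSpace_re_lt z.re) (fun w hw => Or.inl (ne_of_lt hw))
        hk h (by simp; linarith) hw c1).trans (low (by simp; linarith) (by simp; linarith) c1 c3)
    · exact (hg.joinedIn_sheet hz (convex_halfSpace_re_gt z.re) (fun w hw => Or.inl (ne_of_gt hw))
        hk h (by simp; linarith) hw c2).trans (low (by simp; linarith) (by simp; linarith) c2 c3)
  · exact low h (by simp; linarith) hw c3

theorem Good.joinedIn_perm {k : I} (hk : (D.perm z.re).SameCycle i k) :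
    JoinedIn (D.cone z i r ∩ D.reg) (D.pt ⟨z.re + 0 * r, z.im + (-1/2) * r⟩ k)
      (D.pt ⟨z.re + 0 * r, z.im + (-1/2) * r⟩ (D.perm z.re k)) := by
  have hr := hg.1
  have c1 := hg.corner (s := -1/2) (t := 1/2) norm_one (by norm_num [abs_of_neg]) (by norm_num)
  have c2 := hg.corner (s := 1/2) (t := 1/2) norm_one (by norm_num) (by norm_num)
  have h := hg.joinedIn_crossing hz hk (by simp; linarith) (by simp; linarith) c1 c2
  rw [D.crossing_of_le (by simp; linarith), D.crossing_of_lt (by simp; linarith)] at h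
  exact (hg.joinedIn_low hz hk c1 (Or.inl (by simp; linarith))).symm.trans (h.trans
    (hg.joinedIn_low hz (Equiv.Perm.sameCycle_apply_right.2 hk) c2 (Or.inl (by simp; linarith))))

/-- Every point descends to the base point below the node on some sheet of the cycle. Going around
the node moves from one sheet to the next, and powers exhaust the cycle because it is finite. -/
theorem Good.isPathConnected_puncturedCone [Finite I] (hi : ¬ D.IsReg (D.pt z i)) :
    IsPathConnected (D.cone z i r ∩ D.reg) := by
  have hr := hg.1
  have c3 := hg.corner (s := 0) (t := -1/2) norm_one (by norm_num) (by norm_num [abs_of_neg])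
  have hpow : ∀ n : ℕ, JoinedIn (D.cone z i r ∩ D.reg)
      (D.pt ⟨z.re + 0 * r, z.im + (-1/2) * r⟩ i)
      (D.pt ⟨z.re + 0 * r, z.im + (-1/2) * r⟩ ((D.perm z.re ^ n) i)) := by
    intro n
    induction n with
    | zero => exact JoinedIn.refl ((hg.mem_puncturedCone hi).2 ⟨c3, (D.rel_node hz).2 (by rfl),
        fun h => by simpa [hr.ne'] using congrArg Complex.im h⟩)
    | succ n ih =>
      rw [pow_succ', Equiv.Perm.mul_apply]
      exact ih.trans (hg.joinedIn_perm hz (Equiv.Perm.sameCycle_pow_right.2 (by rfl)))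
  have hbase : ∀ k, (D.perm z.re).SameCycle i k → JoinedIn (D.cone z i r ∩ D.reg)
      (D.pt ⟨z.re + 0 * r, z.im + (-1/2) * r⟩ i) (D.pt ⟨z.re + 0 * r, z.im + (-1/2) * r⟩ k) := by
    intro k hk
    obtain ⟨n, -, rfl⟩ := hk.exists_pow_eq'
    exact hpow n
  suffices h : ∀ p, p ∈ D.cone z i r ∩ D.reg → JoinedIn (D.cone z i r ∩ D.reg)
      (D.pt ⟨z.re + 0 * r, z.im + (-1/2) * r⟩ i) p from ⟨_, (hpow 0).source_mem, fun {p} => h p⟩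
  refine D.ind fun w k hp => ?_
  obtain ⟨h1, h2, h3⟩ := (hg.mem_puncturedCone hi).1 hp
  rw [rel_node _ hz] at h2
  by_cases h : w.re ≠ z.re ∨ w.im < z.im
  · exact (hbase k h2).trans (hg.joinedIn_low hz h2 h1 h).symm
  · push Not at h
    have him : z.im < w.im := lt_of_le_of_ne h.2 fun h' => h3 (Complex.ext h.1 h'.symm)
    have c1 := hg.corner (s := -1/2) (t := 1/2) norm_one (by norm_num [abs_of_neg]) (by norm_num)
    have h4 := hg.joinedIn_crossing hz h2 (by simp; linarith) him c1 h1
    rw [D.crossing_of_le (by simp; linarith), D.crossing_of_le h.1.le] at h4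
    exact (hbase k h2).trans ((hg.joinedIn_low hz h2 c1 (Or.inl (by simp; linarith))).symm.trans h4)

end node

section order
variable {θ : ℂ} (hθ : ‖θ‖ = 1) [Finite I]
include hθ

/-- The order is the length of the cycle. The punctured cone is connected, and its projection is a
proper local homeomorphism onto the punctured disc whose fibres are in bijection with the cycle,
hence a finite covering. -/
theorem hasFiniteRamificationOrder (D : SlitData I)
    {w : FlatCompletion (D.proj θ ∘ ((↑) : D.reg → D.Space))}
    (hw : w ∈ ramificationSet (D.proj θ ∘ ((↑) : D.reg → D.Space))) :
    HasFiniteRamificationOrder (D.proj θ ∘ ((↑) : D.reg → D.Space)) w := by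
  have hwr := hw
  rw [D.ramificationSet_proj hθ] at hwr
  obtain ⟨z, i, hzi⟩ : ∃ z i, D.completionHomeo hθ w = D.pt z i := by
    generalize D.completionHomeo hθ w = p
    revert p
    exact D.ind fun z i => ⟨z, i, rfl⟩
  have hi : ¬ D.IsReg (D.pt z i) := by rw [← hzi]; exact hwr
  have hz : z.im = D.height z.re := by
    by_contra hz; exact hi (D.isReg_of_ne_height hz i)
  obtain ⟨r, hg⟩ := D.exists_good z
  have hext : flatExtension (D.proj θ ∘ ((↑) : D.reg → D.Space)) w = θ * z := by
    rw [D.flatExtension_proj hθ, hzi]; rfl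
  let W : Set D.reg := (↑) ⁻¹' D.cone z i r
  have hWim : ((↑) : D.reg → D.Space) '' W = D.cone z i r ∩ D.reg := by
    rw [Subtype.image_preimage_coe, inter_comm]
  have hmaps : MapsTo (D.proj θ ∘ ((↑) : D.reg → D.Space)) W
      (Metric.ball (θ * z) r \ {θ * z}) := by
    rintro ⟨p, hp⟩ hpW
    revert p
    refine D.ind fun w k hp hpW => ?_
    obtain ⟨h1, -, h3⟩ := (hg.mem_puncturedCone hi).1 ⟨hpW, hp⟩
    refine ⟨?_, fun h => h3 (mul_left_cancel₀ (unit_ne_zero hθ) h)⟩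
    rwa [Metric.mem_ball, Function.comp_apply, proj, dist_mul_unit hθ]
  refine ⟨{k | (D.perm z.re).SameCycle i k}.ncard, hw, ?_, r, W, hg.1, ?_, ?_, ?_⟩
  · rw [Nat.cast_ne_zero]
    exact (ncard_pos (toFinite _)).2 ⟨i, Equiv.Perm.SameCycle.refl _ _⟩ |>.ne'
  · refine ⟨?_, ?_⟩
    · obtain ⟨p, hp⟩ := (hg.isPathConnected_puncturedCone hz hi).nonempty
      exact ⟨⟨p, hp.2⟩, hp.1⟩
    · rw [← Topology.IsInducing.subtypeVal.isPreconnected_image, hWim]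
      exact (hg.isPathConnected_puncturedCone hz hi).isConnected.isPreconnected
  · convert (hg.isOpen_cone i).preimage (D.completionHomeo hθ).continuous using 1
    ext ξ
    rw [mem_insert_iff, mem_preimage]
    constructor
    · rintro (rfl | ⟨y, hy, rfl⟩)
      · rw [hzi]; exact D.mem_cone_self hg.1 i
      · rw [completionHomeo_coe]; exact hy
    · intro h
      by_cases hr : D.completionHomeo hθ ξ ∈ D.reg
      · exact Or.inr ⟨⟨_, hr⟩, h, (D.completionHomeo hθ).injective (D.completionHomeo_coe hθ _)⟩
      · left
        apply (D.completionHomeo hθ).injective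
        rw [hzi]
        obtain ⟨w', k, h1, h2, h3⟩ := h
        rw [h3] at hr ⊢
        by_cases hne : w' = z
        · subst hne; exact (D.pt_eq_pt'.2 h2).symm
        · exact absurd (hg.isReg h1 hne k) hr
  · rw [hext]
    refine ⟨hmaps, ?_, ?_⟩
    · have hfib : ∀ q, (hmaps.restrict ⁻¹' {q}).Finite := by
        intro q
        refine Finite.of_finite_image (f := fun y : W => ((y : D.reg) : D.Space))
          ((finite_range fun k => D.pt (θ⁻¹ * q) k).subset ?_)
          ((Subtype.val_injective.comp Subtype.val_injective).injOn)
        rintro _ ⟨⟨⟨p, hp⟩, hpW⟩, hq, rfl⟩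
        revert p
        refine D.ind fun w k hp hpW hq => ⟨k, ?_⟩
        have : θ * w = q := congrArg Subtype.val hq
        rw [← this, inv_mul_cancel_left₀ (unit_ne_zero hθ)]
      -- Properness is inherited from the whole covering. The limit point stays in the cone, because
      -- the rest of the preimage of the disc is open, and it is regular because it does not lie
      -- over the centre.
      have hproper : IsProperMap hmaps.restrict := by
        have hc : Continuous hmaps.restrict :=
          (((D.isProperMap_proj hθ).continuous.comp continuous_subtype_val).comp
            continuous_subtype_val).subtype_mk _
        rw [isProperMap_iff_ultrafilter]
        refine ⟨hc, fun 𝒰 q hq => ?_⟩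
        have h1 : Tendsto (D.proj θ) ((𝒰.map fun y : W => ((y : D.reg) : D.Space) :
            Ultrafilter D.Space) : Filter D.Space) (𝓝 q) := by
          rw [Ultrafilter.coe_map, tendsto_map'_iff]
          exact continuous_subtype_val.continuousAt.tendsto.comp hq
        obtain ⟨p, hp, hle⟩ := (isProperMap_iff_ultrafilter.1 (D.isProperMap_proj hθ)).2 h1
        have hball : dist (D.pr p) z < r := by
          have h2 := q.2.1
          rw [← hp, Metric.mem_ball, proj, dist_mul_unit hθ] at h2
          exact h2
        have hne : D.pr p ≠ z := by
          intro h
          exact q.2.2 (by rw [← hp, proj, h]; rfl)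
        have hpc : p ∈ D.cone z i r := by
          by_contra hpc
          have ho : IsOpen (D.pr ⁻¹' Metric.ball z r \ D.cone z i r) := by
            rw [hg.preimage_ball_diff]; exact isOpen_iUnion fun k => hg.isOpen_cone _
          have h3 := hle (ho.mem_nhds ⟨hball, hpc⟩)
          rw [Ultrafilter.coe_map, mem_map] at h3
          obtain ⟨y, hy⟩ := 𝒰.nonempty_of_mem h3
          exact hy.2 y.2
        have hpr : p ∈ D.reg := by
          revert p
          exact D.ind fun w k _ _ hb hne _ => hg.isReg hb hne k
        refine ⟨⟨⟨p, hpr⟩, hpc⟩, Subtype.ext hp, ?_⟩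
        have hind : IsInducing (fun y : W => ((y : D.reg) : D.Space)) :=
          IsInducing.subtypeVal.comp IsInducing.subtypeVal
        rw [hind.nhds_eq_comap, ← map_le_iff_le_comap]
        exact hle
      have hlocal : IsLocalHomeomorph hmaps.restrict := by
        have h1 : IsLocalHomeomorph ((D.proj θ ∘ ((↑) : D.reg → D.Space)) ∘ ((↑) : W → D.reg)) :=
          (D.isLocalHomeomorph_proj hθ).comp ((hg.isOpen_cone i).preimage
            continuous_subtype_val).isOpenEmbedding_subtypeVal.isLocalHomeomorph
        have h2 : IsLocalHomeomorph ((↑) : (Metric.ball (θ * z) r \ {θ * z} : Set ℂ) → ℂ) :=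
          (Metric.isOpen_ball.sdiff isClosed_singleton).isOpenEmbedding_subtypeVal.isLocalHomeomorph
        exact IsLocalHomeomorph.of_comp (f := hmaps.restrict) (g := Subtype.val) h1 h2
          hproper.continuous
      rw [isCoveringMap_iff_isCoveringMapOn_univ]
      exact hproper.isClosedMap.isCoveringMapOn_of_isLocalHomeomorphOn (fun q _ => hfib q)
        hlocal.isLocalHomeomorphOn
    · intro q
      have hq := q.2
      have hbq : dist (θ⁻¹ * q) z < r := by
        rw [← dist_mul_unit hθ, mul_inv_cancel_left₀ (unit_ne_zero hθ)]; exact hq.1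
      have hneq : θ⁻¹ * (q : ℂ) ≠ z := fun h => hq.2
        (((mul_inv_cancel_left₀ (unit_ne_zero hθ) _).symm.trans (congrArg (θ * ·) h) :))
      rw [← (toFinite {k | (D.perm z.re).SameCycle i k}).cast_ncard_eq.symm]
      have hm : ∀ k, (D.perm z.re).SameCycle i k → D.pt (θ⁻¹ * q) k ∈ D.cone z i r ∩ D.reg :=
        fun k hk => (hg.mem_puncturedCone hi).2 ⟨hbq, (D.rel_node hz).2 hk, hneq⟩
      have e : {k | (D.perm z.re).SameCycle i k} ≃ (hmaps.restrict ⁻¹' {q} : Set W) := by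
        refine Equiv.ofBijective (fun k => ⟨⟨⟨_, (hm k k.2).2⟩, (hm k k.2).1⟩, Subtype.ext ?_⟩) ⟨?_, ?_⟩
        · exact mul_inv_cancel_left₀ (unit_ne_zero hθ) _
        · rintro ⟨k, hk⟩ ⟨k', hk'⟩ h
          have h1 : D.pt (θ⁻¹ * q) k = D.pt (θ⁻¹ * q) k' :=
            congrArg (fun y => (((y : W) : D.reg) : D.Space)) (congrArg Subtype.val h)
          exact Subtype.ext (hg.eq_of_rel hbq hneq (D.pt_eq_pt'.1 h1)).symm
        · rintro ⟨⟨⟨p, hp⟩, hpW⟩, hpq⟩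
          revert p
          refine D.ind fun w k hp hpW hpq => ?_
          have h1 : θ * w = q := congrArg Subtype.val hpq
          have h2 : w = θ⁻¹ * q := by rw [← h1, inv_mul_cancel_left₀ (unit_ne_zero hθ)]
          subst h2
          exact ⟨⟨k, (D.rel_node hz).1 ((hg.mem_puncturedCone hi).1 ⟨hpW, hp⟩).2.1⟩, rfl⟩
      exact (Set.encard_congr e).symm

end order

section surface
variable {θ : ℂ} (hθ : ‖θ‖ = 1) [Finite I] [Nonempty I] (D : SlitData I) (hD : D.Transitive)

theorem finite_ram_surface : (D.surface hθ hD).ram.Finite := D.finite_ramificationSet hθ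

theorem hasFiniteRamificationOrder_surface :
    ∀ w ∈ (D.surface hθ hD).ram, HasFiniteRamificationOrder (D.surface hθ hD).π w :=
  fun _ hw => D.hasFiniteRamificationOrder hθ hw

/-- All added points have finite order, so the finite completion is the whole completion, which is
the branched covering itself. -/
theorem simplyConnectedSpace_finiteCompletion [SimplyConnectedSpace D.Space] :
    SimplyConnectedSpace (D.surface hθ hD).finiteCompletion := by
  have h : (D.surface hθ hD).finiteCompletion = univ := by
    refine eq_univ_of_forall fun w => ?_
    by_cases hw : w ∈ range (toFlatCompletion (D.surface hθ hD).π)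
    exacts [Or.inl hw, Or.inr (D.hasFiniteRamificationOrder hθ hw)]
  rw [h]
  let e : (univ : Set (FlatCompletion (D.surface hθ hD).π)) ≃ₜ D.Space :=
    (Homeomorph.Set.univ _).trans (D.completionHomeo hθ)
  exact e.toHomotopyEquiv.simplyConnectedSpace

end surface
end SlitData

/-! ### Unions of simply connected sets -/

section SimplyConnected

variable {X : Type u} [TopologicalSpace X]

theorem IsSimplyConnected.mk_eq_mk {A : Set X} (hA : IsSimplyConnected A) {x y : X}
    {p q : Path x y} (hp : ∀ t, p t ∈ A) (hq : ∀ t, q t ∈ A) :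
    Path.Homotopic.Quotient.mk p = Path.Homotopic.Quotient.mk q := by
  have := hA.simplyConnectedSpace
  have hx : x ∈ A := by simpa using hp 0
  have hy : y ∈ A := by simpa using hp 1
  let p' : Path (⟨x, hx⟩ : A) ⟨y, hy⟩ :=
    { toFun := fun t => ⟨p t, hp t⟩, source' := by simp, target' := by simp }
  let q' : Path (⟨x, hx⟩ : A) ⟨y, hy⟩ :=
    { toFun := fun t => ⟨q t, hq t⟩, source' := by simp, target' := by simp }
  exact Quotient.sound ((SimplyConnectedSpace.paths_homotopic p' q').map ⟨_, continuous_subtype_val⟩)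

-- The simply connected case of van Kampen. Each point `y` gets a preferred class `K y` of paths
-- from `x₀`, and every path from `x` to `y` carries `K x` to `K y`. Any two paths with the same
-- endpoints are therefore homotopic.
open Path.Homotopic Quotient in
theorem simplyConnectedSpace_of_union {A B : Set X} (hAo : IsOpen A) (hBo : IsOpen B)
    (hA : IsSimplyConnected A) (hB : IsSimplyConnected B) (hAB : IsPathConnected (A ∩ B))
    (h : A ∪ B = univ) : SimplyConnectedSpace X := by
  obtain ⟨x₀, hx₀⟩ := hAB.nonempty
  -- For a point of `A ∩ B` a path inside the intersection serves both sets at once, so the two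
  -- candidates for the class agree.
  have hK : ∀ y : X, ∃ K : Path.Homotopic.Quotient x₀ y,
      (∀ p : Path x₀ y, (∀ t, p t ∈ A) → mk p = K) ∧
      (∀ p : Path x₀ y, (∀ t, p t ∈ B) → mk p = K) := by
    intro y
    by_cases hy : y ∈ A
    · by_cases hy' : y ∈ B
      · obtain ⟨γ, hγ⟩ := hAB.joinedIn x₀ hx₀ y ⟨hy, hy'⟩
        exact ⟨mk γ, fun p hp => hA.mk_eq_mk hp fun t => (hγ t).1,
          fun p hp => hB.mk_eq_mk hp fun t => (hγ t).2⟩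
      · obtain ⟨γ, hγ⟩ := hA.isPathConnected.joinedIn x₀ hx₀.1 y hy
        exact ⟨mk γ, fun p hp => hA.mk_eq_mk hp hγ, fun p hp => absurd (by simpa using hp 1) hy'⟩
    · have hy' : y ∈ B := (h.ge (mem_univ y)).resolve_left hy
      obtain ⟨γ, hγ⟩ := hB.isPathConnected.joinedIn x₀ hx₀.2 y hy'
      exact ⟨mk γ, fun p hp => absurd (by simpa using hp 1) hy, fun p hp => hB.mk_eq_mk hp hγ⟩
  choose K hKA hKB using hK
  have stepA : ∀ {x y : X} (p : Path x y), (∀ t, p t ∈ A) → (K x).trans (mk p) = K y := by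
    intro x y p hp
    obtain ⟨γ, hγ⟩ := hA.isPathConnected.joinedIn x₀ hx₀.1 x (by simpa using hp 0)
    rw [← hKA x γ hγ, ← mk_trans]
    refine hKA y _ fun t => ?_
    rw [Path.trans_apply]
    split_ifs
    exacts [hγ _, hp _]
  have stepB : ∀ {x y : X} (p : Path x y), (∀ t, p t ∈ B) → (K x).trans (mk p) = K y := by
    intro x y p hp
    obtain ⟨γ, hγ⟩ := hB.isPathConnected.joinedIn x₀ hx₀.2 x (by simpa using hp 0)
    rw [← hKB x γ hγ, ← mk_trans]
    refine hKB y _ fun t => ?_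
    rw [Path.trans_apply]
    split_ifs
    exacts [hγ _, hp _]
  have key : ∀ {x y : X} (p : Path x y), (K x).trans (mk p) = K y := by
    intro x y p
    -- A Lebesgue subdivision cuts the path into pieces lying in `A` or in `B`, to which `stepA` and
    -- `stepB` apply.
    obtain ⟨t, ht0, hmono, ⟨n, hn⟩, ht⟩ := exists_monotone_Icc_subset_open_cover_unitInterval
      (c := fun b : Bool => p ⁻¹' (if b then A else B))
      (fun b => by cases b <;> simp [hAo.preimage p.continuous, hBo.preimage p.continuous])
      (fun s _ => by
        rcases h.ge (mem_univ (p s)) with hs | hs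
        exacts [mem_iUnion.2 ⟨true, by simpa using hs⟩, mem_iUnion.2 ⟨false, by simpa using hs⟩])
    have ind : ∀ m, (K (p (t 0))).trans (mk (p.subpath (t 0) (t m))) = K (p (t m)) := by
      intro m
      induction m with
      | zero =>
        rw [Path.subpath_self]
        rcases h.ge (mem_univ (p (t 0))) with hs | hs
        exacts [stepA _ fun _ => hs, stepB _ fun _ => hs]
      | succ m ih =>
        have h1 : mk (p.subpath (t 0) (t (m + 1))) =
            (mk (p.subpath (t 0) (t m))).trans (mk (p.subpath (t m) (t (m + 1)))) := by
          rw [← mk_trans]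
          exact Quotient.sound (Path.Homotopic.symm ⟨Path.Homotopy.subpathTransSubpath p _ _ _⟩)
        rw [h1, ← Path.Homotopic.Quotient.trans_assoc, ih]
        have hr := Path.range_subpath_of_le p _ _ (hmono (Nat.le_succ m))
        obtain ⟨b, hb⟩ := ht m
        have hb' : ∀ s, p.subpath (t m) (t (m + 1)) s ∈ if b then A else B := fun s => by
          obtain ⟨s', hs', he⟩ := hr.le (mem_range_self s)
          rw [← he]; exact hb hs'
        cases b
        · exact stepB _ (by simpa using hb')
        · exact stepA _ (by simpa using hb')
    have h1 := ind n
    rw [hn n le_rfl, ht0, Path.subpath_zero_one] at h1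
    have gen : ∀ {x' y' : X} (hx : x' = x) (hy : y' = y),
        (K x').trans (mk (p.cast hx hy)) = K y' → (K x).trans (mk p) = K y := by
      rintro x' y' rfl rfl h; exact h
    exact gen _ _ h1
  rw [simply_connected_iff_paths_homotopic']
  refine ⟨?_, fun {x y} p q => ?_⟩
  · rw [pathConnectedSpace_iff_univ, ← h]
    exact hA.isPathConnected.union hB.isPathConnected ⟨x₀, hx₀⟩
  · have h1 := (key p).trans (key q).symm
    have h2 := congrArg (fun c => (K x).symm.trans c) h1
    simp only [← Path.Homotopic.Quotient.trans_assoc, Path.Homotopic.Quotient.symm_trans,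
      Path.Homotopic.Quotient.refl_trans] at h2
    exact Quotient.exact h2

theorem IsSimplyConnected.union {A B : Set X} (hAo : IsOpen A) (hBo : IsOpen B)
    (hA : IsSimplyConnected A) (hB : IsSimplyConnected B) (hAB : IsPathConnected (A ∩ B)) :
    IsSimplyConnected (A ∪ B) := by
  have hs : ∀ {C : Set X}, C ⊆ A ∪ B → ((↑) : ↥(A ∪ B) → X) '' ((↑) ⁻¹' C) = C := fun h => by
    rw [Subtype.image_preimage_coe, inter_eq_right.2 h]
  refine simplyConnectedSpace_of_union (A := ((↑) : ↥(A ∪ B) → X) ⁻¹' A) (B := (↑) ⁻¹' B)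
    (hAo.preimage continuous_subtype_val) (hBo.preimage continuous_subtype_val) ?_ ?_ ?_ ?_
  · rw [← IsEmbedding.subtypeVal.isSimplyConnected_image, hs subset_union_left]; exact hA
  · rw [← IsEmbedding.subtypeVal.isSimplyConnected_image, hs subset_union_right]; exact hB
  · rw [← preimage_inter, IsInducing.subtypeVal.isPathConnected_iff,
      hs (inter_subset_left.trans subset_union_left)]
    exact hAB
  · ext ⟨x, hx⟩; simpa using hx

/-- A finite union of simply connected open sets arranged as a tree is simply connected. -/
theorem isSimplyConnected_biUnion_of_tree {κ : Type v} {P : κ → Set X} (hPo : ∀ m, IsOpen (P m))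
    (hP : ∀ m, IsSimplyConnected (P m)) {rank : κ → ℕ} {root : κ} {par : κ → κ}
    (hroot : ∀ m ≠ root, rank root < rank m) (hpar : ∀ m ≠ root, rank (par m) < rank m)
    (hint : ∀ m ≠ root, IsPathConnected (P m ∩ P (par m)))
    (hdisj : ∀ m ≠ root, ∀ k ≠ m, rank k ≤ rank m → k ≠ par m → Disjoint (P m) (P k))
    (S : Finset κ) (hS : root ∈ S) (hSp : ∀ m ∈ S, m ≠ root → par m ∈ S) :
    IsSimplyConnected (⋃ m ∈ S, P m) := by
  classical
  induction S using Finset.strongInduction with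
  | H S ih =>
    -- A piece of maximal rank is a leaf: among the others it meets only its parent, so it can be
    -- removed and glued back by van Kampen.
    obtain ⟨m, hm, hmax⟩ := S.exists_max_image rank ⟨root, hS⟩
    by_cases hmr : m = root
    · have : S = {root} := by
        refine Finset.eq_singleton_iff_unique_mem.2 ⟨hS, fun k hk => ?_⟩
        by_contra hne
        have := hmax k hk
        rw [hmr] at this
        exact (hroot k hne).not_ge this
      rw [this]; simpa using hP root
    · have h1 := ih (S.erase m) (Finset.erase_ssubset hm) (Finset.mem_erase.2 ⟨Ne.symm hmr, hS⟩)
        (fun k hk hkr => Finset.mem_erase.2 ⟨fun he => by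
          have := hmax k (Finset.mem_of_mem_erase hk)
          exact (he ▸ hpar k hkr).not_ge this, hSp k (Finset.mem_of_mem_erase hk) hkr⟩)
      have h2 : ⋃ k ∈ S, P k = P m ∪ ⋃ k ∈ S.erase m, P k := by
        rw [← Finset.set_biUnion_insert, Finset.insert_erase hm]
      rw [h2]
      refine (hP m).union (hPo m) (isOpen_biUnion fun k _ => hPo k) h1 ?_
      convert hint m hmr using 1
      refine subset_antisymm ?_ (inter_subset_inter_right _ ?_)
      · rintro p ⟨hp, hp'⟩
        obtain ⟨k, hk, hpk⟩ := mem_iUnion₂.1 hp'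
        by_cases hkp : k = par m
        · exact ⟨hp, hkp ▸ hpk⟩
        · exact ((hdisj m hmr k (Finset.ne_of_mem_erase hk) (hmax k (Finset.mem_of_mem_erase hk))
            hkp).le_bot ⟨hp, hpk⟩).elim
      · refine subset_biUnion_of_mem (u := P) (show par m ∈ S.erase m from ?_)
        exact Finset.mem_erase.2 ⟨fun he => (hpar m hmr).ne (by rw [he]), hSp m hm hmr⟩

end SimplyConnected

namespace SlitData

variable {I : Type u} (D : SlitData I)

/-! ### Branched coverings glued along a tree -/

/-- The sheets are arranged as a rooted tree by the cycles of the permutations. -/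
def IsTree : Prop :=
  ∃ (depth : I → ℕ) (root : I), (∀ i ≠ root, depth root < depth i) ∧
    -- Every cycle has a unique sheet of least depth, by which it hangs on the tree, and every sheet
    -- other than the root is attached to shallower ones through exactly one cycle.
    (∀ a i, ∃ l, (D.perm a).SameCycle i l ∧ ∀ k, (D.perm a).SameCycle i k → k ≠ l →
      depth l < depth k) ∧
    ∀ i ≠ root, ∃! a, ∃ k, (D.perm a).SameCycle i k ∧ depth k < depth i

/-- The open sheet over the slit plane. -/
def sheet (i : I) : Set D.Space := (fun z => D.pt z i) '' D.slitPlane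

/-- The sheets of the `perm a`-cycle of `l`, over the vertical strip of half-width `δ` about `a`. -/
def strip (δ : ℝ) (a : ℝ) (l : I) : Set D.Space :=
  {p | ∃ z k, |z.re - a| < δ ∧ (D.perm a).SameCycle l k ∧ p = D.pt z k}

variable {D}

theorem pt_mem_sheet {z : ℂ} {i k : I} : D.pt z k ∈ D.sheet i ↔ z ∈ D.slitPlane ∧ k = i := by
  constructor
  · rintro ⟨z', hz', h⟩
    obtain ⟨rfl, h'⟩ := D.pt_eq_pt.1 h
    exact ⟨hz', (D.rel_of_mem_slitPlane hz').1 h'⟩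
  · rintro ⟨h, rfl⟩; exact ⟨z, h, rfl⟩

theorem isOpen_slitPlane : IsOpen D.slitPlane := by
  rw [isOpen_iff_mem_nhds]
  intro z hz
  obtain ⟨r, hg⟩ := D.exists_good z
  by_cases hn : z.im = D.height z.re
  · have hp : D.perm z.re = 1 := hz.resolve_right (by rw [hn]; exact lt_irrefl _)
    filter_upwards [Metric.ball_mem_nhds z hg.1] with w hw
    by_cases hre : w.re = z.re
    exacts [Or.inl (by rw [hre, hp]), Or.inl (hg.perm_eq_one hw hre)]
  · filter_upwards [Metric.ball_mem_nhds z hg.1] with w hw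
    by_cases hre : w.re = z.re
    · rcases hz with hz | hz
      · exact Or.inl (by rw [hre, hz])
      · have h1 := hg.2.2 hn
        have h2 : |w.im - z.im| < r := lt_of_le_of_lt (by
          rw [Complex.dist_eq, ← Complex.sub_im]; exact Complex.abs_im_le_norm _)
          (Metric.mem_ball.1 hw)
        rw [abs_of_neg (by linarith)] at h1
        right; rw [hre]; linarith [(abs_lt.1 h2).2]
    · exact Or.inl (hg.perm_eq_one hw hre)

theorem isOpen_sheet (i : I) : IsOpen (D.sheet i) := by
  rw [D.isOpen_iff]
  intro z k h
  obtain ⟨hz, rfl⟩ := pt_mem_sheet.1 h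
  filter_upwards [isOpen_slitPlane.mem_nhds hz] with z' hz' i' hi'
  exact pt_mem_sheet.2 ⟨hz', (D.rel_of_mem_slitPlane hz).1 hi'⟩

theorem contractibleSpace_slitPlane : ContractibleSpace D.slitPlane := by
  obtain ⟨M, hM⟩ : ∃ M, ∀ a, D.perm a ≠ 1 → M < D.height a := by
    obtain ⟨M, hM⟩ := (D.finite_support.image D.height).bddBelow
    exact ⟨M - 1, fun a ha => by linarith [hM ⟨a, ha, rfl⟩]⟩
  have hlow : ∀ z : ℂ, z.im ≤ M → z ∈ D.slitPlane := fun z hz => by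
    by_cases h : D.perm z.re = 1
    exacts [Or.inl h, Or.inr (hz.trans_lt (hM _ h))]
  refine contractibleSpace_of_down (A := D.slitPlane) (M := M)
    (fun z hz t ht => hz.imp id ht.trans_lt) ?_ ⟨⟨0, M⟩, hlow _ le_rfl⟩
  convert convex_halfSpace_im_le M using 1
  ext z
  exact ⟨fun h => h.2, fun h => ⟨hlow z h, h⟩⟩

theorem isSimplyConnected_sheet (i : I) : IsSimplyConnected (D.sheet i) := by
  have := contractibleSpace_slitPlane (D := D)
  have hmem : ∀ p : D.sheet i, D.pr p ∈ D.slitPlane := by rintro ⟨_, z, hz, rfl⟩; exact hz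
  let e : D.sheet i ≃ₜ D.slitPlane :=
    { toFun := fun p => ⟨D.pr p, hmem p⟩
      invFun := fun z => ⟨D.pt z i, z, z.2, rfl⟩
      left_inv := by rintro ⟨_, z, hz, rfl⟩; rfl
      right_inv := fun z => rfl
      continuous_toFun := (D.continuous_pr.comp continuous_subtype_val).subtype_mk hmem
      continuous_invFun :=
        (continuousOn_iff_continuous_domRestrict.1 (D.continuousOn_sheet i)).subtype_mk _ }
  have h : SimplyConnectedSpace D.slitPlane := inferInstance
  exact e.toHomotopyEquiv.simplyConnectedSpace

theorem disjoint_sheet {i k : I} (h : i ≠ k) : Disjoint (D.sheet i) (D.sheet k) := by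
  rw [Set.disjoint_left]
  rintro _ ⟨z, hz, rfl⟩ h'
  exact h (pt_mem_sheet.1 h').2

section strip

variable {δ a : ℝ} (hδ : ∀ b, D.perm b ≠ 1 → b ≠ a → δ ≤ |b - a|)
include hδ

theorem perm_eq_one_of_strip {b : ℝ} (hb : |b - a| < δ) (h : b ≠ a) : D.perm b = 1 := by
  by_contra h'
  exact (hδ b h' h).not_gt hb

theorem pt_mem_strip {z : ℂ} {k l : I} :
    D.pt z k ∈ D.strip δ a l ↔ |z.re - a| < δ ∧ (D.perm a).SameCycle l k := by
  constructor
  · rintro ⟨z', k', hz', hk', h⟩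
    obtain ⟨rfl, h'⟩ := D.pt_eq_pt.1 h
    refine ⟨hz', ?_⟩
    have h'' := D.rel_symm h'
    by_cases hn : z.im = D.height z.re
    · rw [rel_node _ hn] at h''
      by_cases hre : z.re = a
      · rw [hre] at h''; exact hk'.trans h''
      · rw [perm_eq_one_of_strip hδ hz' hre, Equiv.Perm.sameCycle_one] at h''
        rwa [← h'']
    · rw [rel_self _ hn] at h''
      rwa [h'']
  · rintro ⟨h, h'⟩; exact ⟨z, k, h, h', rfl⟩

theorem sameCycle_of_rel {z z' : ℂ} {k k' : I} (hz : |z.re - a| < δ) (h : D.Rel z z' k k') :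
    (D.perm a).SameCycle k k' := by
  by_cases hre : z.re = a
  · by_cases hn : z.im = D.height z.re
    · rwa [rel_node _ hn, hre] at h
    · by_cases hle : z'.re ≤ z.re
      · rw [rel_of_le _ hn hle] at h; rw [h]
      · rw [rel_of_lt _ hn (not_le.1 hle), cross, hre] at h
        split_ifs at h
        · rw [h]; exact Equiv.Perm.sameCycle_apply_right.2 (by rfl)
        · rw [h]; rfl
  · rw [D.rel_of_mem_slitPlane (Or.inl (perm_eq_one_of_strip hδ hz hre))] at h
    rw [h]

theorem isOpen_strip (l : I) : IsOpen (D.strip δ a l) := by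
  rw [D.isOpen_iff]
  intro z k h
  obtain ⟨hz, hk⟩ := (pt_mem_strip hδ).1 h
  have ho : IsOpen {z : ℂ | |z.re - a| < δ} :=
    isOpen_lt (by fun_prop) continuous_const
  filter_upwards [ho.mem_nhds hz] with z' hz' i' hi'
  exact (pt_mem_strip hδ).2 ⟨hz', hk.trans (sameCycle_of_rel hδ hz hi')⟩

theorem disjoint_strip {l l' : I} (h : ¬ (D.perm a).SameCycle l l') :
    Disjoint (D.strip δ a l) (D.strip δ a l') := by
  rw [Set.disjoint_left]
  rintro _ ⟨z, k, hz, hk, rfl⟩ h'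
  exact h (hk.trans ((pt_mem_strip hδ).1 h').2.symm)

theorem disjoint_sheet_strip {i l : I} (h : ¬ (D.perm a).SameCycle l i) :
    Disjoint (D.sheet i) (D.strip δ a l) := by
  rw [Set.disjoint_left]
  rintro _ ⟨z, hz, rfl⟩ h'
  exact h ((pt_mem_strip hδ).1 h').2

theorem isPathConnected_sheet_inter_strip {i l : I} (hδ0 : 0 < δ) (h : (D.perm a).SameCycle l i) :
    IsPathConnected (D.sheet i ∩ D.strip δ a l) := by
  have h1 : D.sheet i ∩ D.strip δ a l =
      (fun z => D.pt z i) '' (D.slitPlane ∩ {z | |z.re - a| < δ}) := by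
    ext p
    constructor
    · rintro ⟨⟨z, hz, rfl⟩, hp⟩
      exact ⟨z, ⟨hz, ((pt_mem_strip hδ).1 hp).1⟩, rfl⟩
    · rintro ⟨z, ⟨hz, hz'⟩, rfl⟩
      exact ⟨⟨z, hz, rfl⟩, (pt_mem_strip hδ).2 ⟨hz', h⟩⟩
  rw [h1]
  refine IsPathConnected.image' ?_ ((D.continuousOn_sheet i).mono inter_subset_left)
  have hlow : ∀ z : ℂ, |z.re - a| < δ → z.im ≤ D.height a - 1 → z ∈ D.slitPlane := by
    intro z hz hz'
    by_cases hre : z.re = a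
    · right; rw [hre]; linarith
    · exact Or.inl (perm_eq_one_of_strip hδ hz hre)
  have hc : Convex ℝ {z : ℂ | |z.re - a| < δ} := by
    have : {z : ℂ | |z.re - a| < δ} = Complex.reLm ⁻¹' Ioo (a - δ) (a + δ) := by
      ext z
      simp only [mem_ofPred_eq, mem_preimage, Complex.reLm_coe, mem_Ioo, abs_lt]
      constructor <;> rintro ⟨h1, h2⟩ <;> constructor <;> linarith
    rw [this]
    exact (convex_Ioo _ _).linear_preimage _
  have := contractibleSpace_of_down (A := D.slitPlane ∩ {z | |z.re - a| < δ})
    (M := D.height a - 1) (fun z hz t ht => ⟨hz.1.imp id ht.trans_lt, hz.2⟩) (by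
      convert hc.inter (convex_halfSpace_im_le (D.height a - 1)) using 1
      ext z
      exact ⟨fun h => ⟨h.1.2, h.2⟩, fun h => ⟨⟨hlow z h.1 h.2, h.1⟩, h.2⟩⟩)
    ⟨⟨a, D.height a - 1⟩, hlow _ (by simpa) le_rfl, by simpa⟩
  rw [isPathConnected_iff_pathConnectedSpace]
  infer_instance

/-- The homothety centred at the node preserves the slit and the two sides of the strip, so it acts
on the sheets without changing labels. At ratio zero all sheets of the cycle collapse to the single
point over the node. -/
theorem contractibleSpace_strip (hδ0 : 0 < δ) (l : I) : ContractibleSpace (D.strip δ a l) := by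
  let v := D.node a
  let ζ : unitInterval → ℂ → ℂ := fun t z => v + (t : ℝ) * (z - v)
  have hre : ∀ t z, (ζ t z).re - a = t * (z.re - a) := by
    intro t z; simp [ζ, v, node]
  have him : ∀ t z, (ζ t z).im - D.height a = t * (z.im - D.height a) := by
    intro t z; simp [ζ, v, node]
  have hζ : ∀ t z, |z.re - a| < δ → |(ζ t z).re - a| < δ := by
    intro t z h
    rw [hre, abs_mul, abs_of_nonneg t.2.1]
    exact (mul_le_of_le_one_left (abs_nonneg _) t.2.2).trans_lt h
  have hrel : ∀ (t t' : unitInterval) z z' k k', 0 < (t : ℝ) → 0 < (t' : ℝ) → |z.re - a| < δ →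
      D.Rel z z' k k' → D.Rel (ζ t z) (ζ t' z') k k' := by
    intro t t' z z' k k' ht ht' hz h
    by_cases hza : z.re = a
    · have hza' : (ζ t z).re = a := by
        have := hre t z; rw [hza, sub_self, mul_zero] at this; linarith
      by_cases hn : z.im = D.height z.re
      · have hn' : (ζ t z).im = D.height (ζ t z).re := by
          rw [hza'] at *; rw [hza] at hn
          have := him t z; rw [hn, sub_self, mul_zero] at this; linarith
        rw [rel_node _ hn, hza] at h
        rwa [rel_node _ hn', hza']
      · have hs : D.height a < (ζ t z).im ↔ D.height a < z.im := by
          rw [← sub_pos, him, ← sub_pos (a := z.im)]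
          exact mul_pos_iff_of_pos_left ht
        have hn' : (ζ t z).im ≠ D.height (ζ t z).re := by
          rw [hza'] ; rw [hza] at hn
          rw [ne_eq, ← sub_eq_zero, him, mul_eq_zero, sub_eq_zero]
          push Not; exact ⟨ht.ne', hn⟩
        have hc : D.cross (ζ t z) = D.cross z := by
          unfold cross; rw [hza', hza]; simp only [hs]
        have hle : (ζ t' z').re ≤ (ζ t z).re ↔ z'.re ≤ z.re := by
          rw [hza', hza, ← sub_nonpos, hre, ← sub_nonpos (a := z'.re)]
          refine ⟨fun h => ?_, fun h => mul_nonpos_of_nonneg_of_nonpos ht'.le h⟩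
          by_contra hc
          exact h.not_gt (mul_pos ht' (not_le.1 hc))
        by_cases hle' : z'.re ≤ z.re
        · rw [rel_of_le _ hn hle'] at h
          rwa [rel_of_le _ hn' (hle.2 hle')]
        · rw [rel_of_lt _ hn (not_le.1 hle')] at h
          rwa [rel_of_lt _ hn' (not_le.1 (hle.not.2 hle')), hc]
    · have hza' : (ζ t z).re ≠ a := by
        rw [ne_eq, ← sub_eq_zero, hre, mul_eq_zero, sub_eq_zero]
        push Not; exact ⟨ht.ne', hza⟩
      rw [D.rel_of_mem_slitPlane (Or.inl (perm_eq_one_of_strip hδ hz hza))] at h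
      rwa [D.rel_of_mem_slitPlane (Or.inl (perm_eq_one_of_strip hδ (hζ t z hz) hza'))]
  -- An arbitrary choice of a label at each point, with no continuity in itself; only the resulting
  -- points of the covering matter.
  let σ : D.Space → I := fun p => (Quotient.out (s := D.setoid) p).2
  have hσ : ∀ p : D.Space, D.pt (D.pr p) (σ p) = p := fun p => by
    have h : D.pt (Quotient.out (s := D.setoid) p).1 (σ p) = p := Quotient.out_eq (s := D.setoid) p
    have h' : (Quotient.out (s := D.setoid) p).1 = D.pr p := congrArg D.pr h
    rwa [h'] at h
  have hv : D.pt v l ∈ D.strip δ a l := (pt_mem_strip hδ).2 ⟨by simpa [v, node], by rfl⟩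
  have hm : ∀ (p : D.strip δ a l), |(D.pr p).re - a| < δ ∧ (D.perm a).SameCycle l (σ p) := by
    rintro ⟨p, hp⟩
    rw [← hσ p] at hp
    exact (pt_mem_strip hδ).1 hp
  rw [contractible_iff_id_nullhomotopic]
  refine ⟨⟨_, hv⟩, ContinuousMap.Homotopic.symm ⟨⟨⟨fun q => ⟨D.pt (ζ q.1 (D.pr q.2)) (σ q.2),
    (pt_mem_strip hδ).2 ⟨hζ _ _ (hm q.2).1, (hm q.2).2⟩⟩, ?_⟩, ?_, ?_⟩⟩⟩
  · refine Continuous.subtype_mk ?_ _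
    have hcont : Continuous fun q : unitInterval × D.strip δ a l => ζ q.1 (D.pr q.2) := by
      have := D.continuous_pr
      fun_prop
    rw [continuous_iff_continuousAt]
    rintro ⟨t, p⟩
    refine D.tendsto_pt hcont.continuousAt ?_
    -- At ratio zero the limit is the node, where any two labels of the cycle are related, so the
    -- choice made by `σ` is harmless. At positive ratios the homothety respects `Rel`.
    rcases t.2.1.eq_or_lt with ht | ht
    · refine Eventually.of_forall fun q => ?_
      have h1 : ζ t (D.pr p) = v := by simp [ζ, ← ht]
      change D.Rel (ζ t (D.pr p)) _ _ _
      rw [h1, rel_node _ rfl]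
      exact (hm p).2.symm.trans (hm q.2).2
    · obtain ⟨r, hg⟩ := D.exists_good (D.pr p)
      have h1 : ∀ᶠ q : unitInterval × D.strip δ a l in 𝓝 (t, p), (0 : ℝ) < q.1 :=
        continuousAt_const.eventually_lt (by fun_prop) ht
      have h2 : ∀ᶠ q : unitInterval × D.strip δ a l in 𝓝 (t, p),
          (q.2 : D.Space) ∈ D.cone (D.pr p) (σ p) r := by
        refine (continuous_subtype_val.comp continuous_snd).continuousAt.eventually_mem
          ((hg.isOpen_cone _).mem_nhds ?_)
        have := D.mem_cone_self hg.1 (z := D.pr p) (σ p)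
        rwa [hσ] at this
      filter_upwards [h1, h2] with q h3 h4
      rw [← hσ q.2, hg.mem_cone] at h4
      exact hrel _ _ _ _ _ _ ht h3 (hm p).1 h4.2
  · rintro ⟨p, hp⟩
    ext
    change D.pt (ζ 0 (D.pr p)) (σ p) = D.pt v l
    have h1 : ζ 0 (D.pr p) = v := by simp [ζ]
    rw [h1, D.pt_eq_pt', rel_node _ rfl]
    exact (hm ⟨p, hp⟩).2.symm
  · rintro ⟨p, hp⟩
    ext
    change D.pt (ζ 1 (D.pr p)) (σ p) = p
    have h1 : ζ 1 (D.pr p) = D.pr p := by simp [ζ]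
    rw [h1, hσ]

end strip

/-- The covering is the union of the open sheets over the slit plane and of one strip for each cycle
at an abscissa with nontrivial permutation. A sheet meets a strip only when it belongs to its cycle,
so the incidence pattern of these contractible pieces is the given tree. -/
theorem IsTree.simplyConnectedSpace [Finite I] (hD : D.IsTree) : SimplyConnectedSpace D.Space := by
  classical
  obtain ⟨depth, root, hroot, hmin, hup⟩ := hD
  choose low hlow1 hlow2 using hmin
  choose! top htop htop' using hup
  have hlowlow : ∀ a i k, (D.perm a).SameCycle i k → low a k = low a i := by
    intro a i k h
    by_contra hne
    have h1 := hlow2 a i _ (h.trans (hlow1 a k)) hne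
    have h2 := hlow2 a k _ (h.symm.trans (hlow1 a i)) (Ne.symm hne)
    exact lt_asymm h1 h2
  -- The factor two keeps the strips about different abscissae disjoint.
  obtain ⟨δ, hδ0, hδ⟩ : ∃ δ > 0, ∀ a b, D.perm a ≠ 1 → D.perm b ≠ 1 → b ≠ a →
      2 * δ ≤ |b - a| := by
    have hfin := D.finite_support.offDiag.image (fun x : ℝ × ℝ => |x.2 - x.1| / 2)
    rcases Set.eq_empty_or_nonempty ((fun x : ℝ × ℝ => |x.2 - x.1| / 2) ''
      {a | D.perm a ≠ 1}.offDiag) with h | h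
    · refine ⟨1, one_pos, fun a b ha hb hab => ?_⟩
      rw [image_eq_empty] at h
      exact (h.le (show (a, b) ∈ _ from ⟨ha, hb, hab.symm⟩)).elim
    · obtain ⟨_, ⟨⟨a, b⟩, ⟨ha, hb, hab⟩, rfl⟩, hm⟩ := exists_min_image _ id hfin h
      refine ⟨|b - a| / 2, ?_, fun a' b' ha' hb' hab' => ?_⟩
      · have : 0 < |b - a| := abs_pos.2 (sub_ne_zero.2 (Ne.symm hab))
        positivity
      · have := hm _ ⟨(a', b'), ⟨ha', hb', hab'.symm⟩, rfl⟩
        simp only [id] at this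
        linarith
  have hδ' : ∀ a, D.perm a ≠ 1 → ∀ b, D.perm b ≠ 1 → b ≠ a → δ ≤ |b - a| := fun a ha b hb h =>
    by linarith [hδ a b ha hb h]
  -- A cycle is named by its lowest sheet, so that each strip occurs once.
  let κ := I ⊕ {c : {a // D.perm a ≠ 1} × I // low c.1 c.2 = c.2}
  have : Finite {a // D.perm a ≠ 1} := D.finite_support.to_subtype
  have : Fintype κ := Fintype.ofFinite κ
  let P : κ → Set D.Space := Sum.elim D.sheet fun c => D.strip δ c.1.1 c.1.2
  -- Doubling the depth leaves room for a strip between its lowest sheet, which is its parent, and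
  -- the other sheets of the cycle, whose parent it is.
  let rank : κ → ℕ := Sum.elim (fun i => 2 * depth i) fun c => 2 * depth c.1.2 + 1
  have hsupp : ∀ i, i ≠ root → D.perm (top i) ≠ 1 := by
    intro i hi h1
    obtain ⟨k, hk, hlt⟩ := htop i hi
    rw [h1, Equiv.Perm.sameCycle_one] at hk
    exact hlt.ne (by rw [hk])
  have hll : ∀ a i, low a (low a i) = low a i := fun a i => hlowlow a i _ (hlow1 a i)
  let par : κ → κ := Sum.elim (fun i => if hi : i = root then Sum.inl root else
    Sum.inr ⟨(⟨top i, hsupp i hi⟩, low (top i) i), hll _ _⟩) fun c => Sum.inl c.1.2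
  have hroot' : ∀ i, depth root ≤ depth i := fun i => by
    by_cases h : i = root
    exacts [h ▸ le_rfl, (hroot i h).le]
  have htoplow : ∀ i, i ≠ root → depth (low (top i) i) < depth i := by
    intro i hi
    obtain ⟨k, hk, hlt⟩ := htop i hi
    by_cases h : k = low (top i) i
    · rwa [← h]
    · exact (hlow2 _ _ k hk h).trans hlt
  have key := isSimplyConnected_biUnion_of_tree (P := P) (rank := rank) (root := Sum.inl root)
    (par := par) ?_ ?_ ?_ ?_ ?_ ?_ Finset.univ (Finset.mem_univ _) (fun _ _ _ => Finset.mem_univ _)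
  · have hu : (⋃ m ∈ (Finset.univ : Finset κ), P m) = univ := by
      refine eq_univ_of_forall fun p => ?_
      revert p
      refine D.ind fun z i => ?_
      simp only [Finset.mem_univ, iUnion_true, mem_iUnion]
      by_cases h : D.perm z.re = 1
      · exact ⟨Sum.inl i, z, Or.inl h, rfl⟩
      · exact ⟨Sum.inr ⟨(⟨z.re, h⟩, low z.re i), hll _ _⟩, z, i, by simpa, (hlow1 _ _).symm, rfl⟩
    rw [hu] at key
    have := key.simplyConnectedSpace
    exact (Homeomorph.Set.univ D.Space).symm.toHomotopyEquiv.simplyConnectedSpace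
  · rintro (i | c)
    exacts [isOpen_sheet i, isOpen_strip (hδ' _ c.1.1.2) _]
  · rintro (i | c)
    · exact isSimplyConnected_sheet i
    · have := contractibleSpace_strip (hδ' _ c.1.1.2) hδ0 c.1.2
      have h : SimplyConnectedSpace (D.strip δ c.1.1 c.1.2) := inferInstance
      exact h
  · rintro (i | c) h
    · have := hroot i (fun h' => h (by rw [h']))
      change 2 * _ < 2 * _; omega
    · have := hroot' c.1.2
      change 2 * _ < 2 * _ + 1; omega
  · rintro (i | c) h
    · have hi : i ≠ root := fun h' => h (by rw [h'])
      have := htoplow i hi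
      simp only [par, Sum.elim_inl, hi, dif_neg, not_false_eq_true, rank, Sum.elim_inr]
      omega
    · simp [par, rank]
  · rintro (i | c) h
    · have hi : i ≠ root := fun h' => h (by rw [h'])
      simp only [par, Sum.elim_inl, hi, dif_neg, not_false_eq_true, P, Sum.elim_inr]
      exact isPathConnected_sheet_inter_strip (hδ' _ (hsupp i hi)) hδ0 (hlow1 _ _).symm
    · rw [inter_comm]
      exact isPathConnected_sheet_inter_strip (hδ' _ c.1.1.2) hδ0 (by rfl)
  · rintro (i | c) h (k | d) hne hrank hpar
    · exact disjoint_sheet fun h' => hne (by rw [h'])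
    · have hi : i ≠ root := fun h' => h (by rw [h'])
      refine disjoint_sheet_strip (hδ' _ d.1.1.2) fun hs => hpar ?_
      have h1 : depth d.1.2 < depth i := by
        have : 2 * depth d.1.2 + 1 ≤ 2 * depth i := hrank
        omega
      have h2 : d.1.1.1 = top i := htop' i hi _ ⟨_, hs.symm, h1⟩
      simp only [par, Sum.elim_inl, hi, dif_neg, not_false_eq_true]
      congr 1
      ext1
      have h3 : low d.1.1.1 i = d.1.2 := by rw [hlowlow _ _ _ hs, d.2]
      refine Prod.ext (Subtype.ext h2) ?_
      simp only
      rw [← h3, h2]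
    · refine (disjoint_sheet_strip (hδ' _ c.1.1.2) fun hs => hpar ?_).symm
      have h1 : depth k ≤ depth c.1.2 := by
        have : 2 * depth k ≤ 2 * depth c.1.2 + 1 := hrank
        omega
      change Sum.inl k = Sum.inl c.1.2
      congr 1
      by_contra hk
      have := hlow2 c.1.1 c.1.2 k hs (by rwa [c.2])
      rw [c.2] at this
      omega
    · by_cases h1 : c.1.1 = d.1.1
      · obtain ⟨⟨ca, ci⟩, hc⟩ := c
        obtain ⟨⟨da, di⟩, hd⟩ := d
        simp only at h1 hc hd
        subst h1
        refine disjoint_strip (hδ' _ ca.2) fun hs => hne ?_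
        congr 1
        ext1
        simp only
        rw [← hc, ← hd, hlowlow _ _ _ hs]
      · rw [Set.disjoint_left]
        rintro _ ⟨z, k, hz, -, rfl⟩ ⟨z', k', hz', -, h'⟩
        obtain ⟨rfl, -⟩ := D.pt_eq_pt.1 h'
        have := hδ _ _ c.1.1.2 d.1.1.2 (fun h => h1 (Subtype.ext h.symm))
        have h4 := abs_sub_le d.1.1.1 z.re c.1.1.1
        rw [abs_sub_comm d.1.1.1 z.re] at h4
        linarith

end SlitData

/-! ### Sections of coverings of the plane -/

section Covering

variable {E : Type u} [TopologicalSpace E] {p : E → ℂ} {s : Set ℂ}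

theorem IsCoveringMapOn.exists_section (hp : IsCoveringMapOn p s) {A : Set ℂ} (hA : A ⊆ s)
    [SimplyConnectedSpace A] [LocallyPathConnectedSpace A] (e : E) (he : p e ∈ A) :
    ∃ σ : ℂ → E, ContinuousOn σ A ∧ (∀ z ∈ A, p (σ z) = z) ∧ σ (p e) = e := by
  classical
  obtain ⟨F, ⟨h1, h2⟩, -⟩ := hp.existsUnique_continuousMap_lifts (A := A)
    ⟨((↑) : A → ℂ), continuous_subtype_val⟩ (a₀ := ⟨p e, he⟩) (e₀ := e) rfl (fun a => hA a.2)
  refine ⟨fun z => if h : z ∈ A then F ⟨z, h⟩ else e, ?_, fun z hz => ?_, ?_⟩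
  · rw [continuousOn_iff_continuous_domRestrict]
    convert F.continuous using 1
    ext ⟨z, hz⟩
    simp [hz]
  · simp only [dif_pos hz]; exact congrFun h2 ⟨z, hz⟩
  · simp only [dif_pos he]; exact h1

theorem IsCoveringMapOn.eqOn_section (hp : IsCoveringMapOn p s) {A : Set ℂ} (hA : A ⊆ s)
    [SimplyConnectedSpace A] [LocallyPathConnectedSpace A] {σ τ : ℂ → E} (hσ : ContinuousOn σ A)
    (hτ : ContinuousOn τ A) (hpσ : ∀ z ∈ A, p (σ z) = z) (hpτ : ∀ z ∈ A, p (τ z) = z) {z : ℂ}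
    (hz : z ∈ A) (h : σ z = τ z) : EqOn σ τ A := by
  have h1 := hp.existsUnique_continuousMap_lifts (A := A)
    ⟨((↑) : A → ℂ), continuous_subtype_val⟩ (a₀ := ⟨z, hz⟩) (e₀ := σ z) (hpσ z hz) (fun a => hA a.2)
  have h2 := h1.unique (y₁ := ⟨_, continuousOn_iff_continuous_domRestrict.1 hσ⟩)
    (y₂ := ⟨_, continuousOn_iff_continuous_domRestrict.1 hτ⟩)
    ⟨rfl, funext fun a => hpσ a a.2⟩ ⟨h.symm, funext fun a => hpτ a a.2⟩
  exact fun w hw => congrArg (fun F : C(A, E) => F ⟨w, hw⟩) h2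

/-- For `y` near `x`, both `y` and `σ (p y)` lie in one chart, on which `p` is injective. -/
theorem IsLocalHomeomorph.eventually_eq_section {E : Type u} [TopologicalSpace E] {p : E → ℂ}
    (hp : IsLocalHomeomorph p) {σ : ℂ → E} {x : E} (hσ : ContinuousAt σ (p x)) (hx : σ (p x) = x)
    (hpσ : ∀ᶠ z in 𝓝 (p x), p (σ z) = z) : ∀ᶠ y in 𝓝 x, σ (p y) = y := by
  obtain ⟨e, hxe, rfl⟩ := hp x
  have hc : ContinuousAt e x := e.continuousAt hxe
  have h1 : ∀ᶠ y in 𝓝 x, σ (e y) ∈ e.source := by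
    have : Tendsto (fun y => σ (e y)) (𝓝 x) (𝓝 x) := by
      have h := ContinuousAt.comp (g := σ) hσ hc
      rwa [ContinuousAt, Function.comp_apply, hx] at h
    exact this.eventually (e.open_source.mem_nhds hxe)
  filter_upwards [h1, e.open_source.mem_nhds hxe, hc.eventually hpσ] with y h2 h3 h4
  exact e.injOn h2 h3 h4

end Covering

/-- Over the plane `Ω` slit above the points of `N`, which is contractible, the covering splits into
sheets indexed by one fibre. It also splits over the half strip above each `v ∈ N`, and comparing
the sheets on the left and on the right of the slit gives the permutation `cr v`. A point on a slit
takes its label from the left. -/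
theorem exists_slitData_of_isCoveringMapOn {E : Type u} [TopologicalSpace E] {p : E → ℂ}
    {N : Set ℂ} (hN : N.Finite) (hre : InjOn Complex.re N) (hp : IsCoveringMapOn p Nᶜ)
    (hpN : ∀ x, p x ∉ N) (hfin : ∀ z, (p ⁻¹' {z}).Finite) :
    ∃ (I : Type u) (_ : Finite I) (D : SlitData I) (Φ : E → D.Space), Continuous Φ ∧
      Function.Injective Φ ∧ ∀ x, D.pr (Φ x) = p x := by
  classical
  rcases isEmpty_or_nonempty E with hE | hE
  · exact ⟨PEmpty, inferInstance, ⟨0, 1, by simp⟩, isEmptyElim, by fun_prop,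
      fun x => isEmptyElim x, isEmptyElim⟩
  have hloc : IsLocalHomeomorph p := by
    have h := hp.isLocalHomeomorphOn
    rw [isLocalHomeomorph_iff_isLocalHomeomorphOn_univ]
    convert h
    exact (eq_univ_of_forall hpN).symm
  have hpc : Continuous p := hloc.continuous
  -- the slit plane
  let Ω : Set ℂ := {z | ∀ v ∈ N, z.re = v.re → z.im < v.im}
  have hΩo : IsOpen Ω := by
    have : Ω = ⋂ v ∈ N, ({z : ℂ | z.re ≠ v.re} ∪ {z : ℂ | z.im < v.im}) := by
      ext z
      simp only [Ω, mem_ofPred_eq, mem_iInter, mem_union, imp_iff_not_or, ne_eq]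
    rw [this]
    exact hN.isOpen_biInter fun v _ => (isOpen_ne_fun Complex.continuous_re continuous_const).union
      (isOpen_lt Complex.continuous_im continuous_const)
  have hΩN : Ω ⊆ Nᶜ := fun z hz hzN => lt_irrefl _ (hz z hzN rfl)
  obtain ⟨M, hM⟩ : ∃ M, ∀ v ∈ N, M < v.im := by
    obtain ⟨M, hM⟩ := (hN.image Complex.im).bddBelow
    exact ⟨M - 1, fun v hv => by linarith [hM ⟨v, hv, rfl⟩]⟩
  have hlow : ∀ z : ℂ, z.im ≤ M → z ∈ Ω := fun z hz v hv _ => hz.trans_lt (hM v hv)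
  have hΩc : ContractibleSpace Ω := by
    refine contractibleSpace_of_down (A := Ω) (M := M)
      (fun z hz t ht v hv h => ht.trans_lt (hz v hv h)) ?_ ⟨⟨0, M⟩, hlow _ le_rfl⟩
    convert convex_halfSpace_im_le M using 1
    ext z
    exact ⟨fun h => h.2, fun h => ⟨hlow z h, h⟩⟩
  have hΩl : LocallyPathConnectedSpace Ω := hΩo.locallyPathConnectedSpace
  let z₀ : ℂ := ⟨0, M⟩
  have hz₀ : z₀ ∈ Ω := hlow _ le_rfl
  let I : Type u := p ⁻¹' {z₀}
  have hI : Finite I := (hfin z₀).to_subtype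
  have hsec : ∀ e : I, ∃ σ : ℂ → E, ContinuousOn σ Ω ∧ (∀ z ∈ Ω, p (σ z) = z) ∧ σ z₀ = e := by
    intro e
    have he : p e = z₀ := e.2
    obtain ⟨σ, h1, h2, h3⟩ := hp.exists_section hΩN (e : E) (by rw [he]; exact hz₀)
    exact ⟨σ, h1, h2, (congrArg σ he).symm.trans h3⟩
  choose s hs hps hs0 using hsec
  have hex : ∀ x, p x ∈ Ω → ∃ e, s e (p x) = x := by
    intro x hx
    obtain ⟨σ, h1, h2, h3⟩ := hp.exists_section hΩN x hx
    refine ⟨⟨σ z₀, h2 _ hz₀⟩, ?_⟩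
    rw [hp.eqOn_section hΩN (hs _) h1 (hps _) h2 hz₀ (hs0 _) hx, h3]
  have huniq : ∀ {e e' z}, z ∈ Ω → s e z = s e' z → e = e' := by
    intro e e' z hz h
    have := hp.eqOn_section hΩN (hs _) (hs _) (hps _) (hps _) hz h hz₀
    rw [hs0, hs0] at this
    exact Subtype.ext this
  -- the half strips above the points of `N`
  obtain ⟨δ, hδ0, hδ⟩ : ∃ δ > 0, ∀ v ∈ N, ∀ w ∈ N, w ≠ v → δ ≤ |w.re - v.re| := by
    have hf := hN.offDiag.image (fun x : ℂ × ℂ => |x.2.re - x.1.re|)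
    rcases Set.eq_empty_or_nonempty ((fun x : ℂ × ℂ => |x.2.re - x.1.re|) '' N.offDiag) with h | h
    · refine ⟨1, one_pos, fun a ha b hb hab => ?_⟩
      rw [image_eq_empty] at h
      exact (h.le (show (a, b) ∈ _ from ⟨ha, hb, hab.symm⟩)).elim
    · obtain ⟨_, ⟨⟨a, b⟩, ⟨ha, hb, hab⟩, rfl⟩, hm⟩ := exists_min_image _ id hf h
      refine ⟨|b.re - a.re|, abs_pos.2 (sub_ne_zero.2 fun h => hab (hre ha hb h.symm)),
        fun a' ha' b' hb' hab' => hm _ ⟨(a', b'), ⟨ha', hb', hab'.symm⟩, rfl⟩⟩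
  have hstrip : ∀ v ∈ N, ∀ z : ℂ, |z.re - v.re| < δ → z.re ≠ v.re → z ∈ Ω := by
    intro v hv z hz hne w hw h
    by_cases hwv : w = v
    · exact absurd (hwv ▸ h) hne
    · exact absurd (h ▸ hz) (hδ v hv w hw hwv).not_gt
  let R : ℂ → Set ℂ := fun v => {z | |z.re - v.re| < δ ∧ v.im < z.im}
  have hRc : ∀ v, Convex ℝ (R v) := by
    intro v
    have : R v = Complex.reLm ⁻¹' Ioo (v.re - δ) (v.re + δ) ∩ {z | v.im < z.im} := by
      ext z
      simp only [R, mem_inter_iff, mem_ofPred_eq, mem_preimage, Complex.reLm_coe, mem_Ioo, abs_lt]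
      refine and_congr_left fun _ => ?_
      constructor <;> rintro ⟨h1, h2⟩ <;> constructor <;> linarith
    rw [this]
    exact ((convex_Ioo _ _).linear_preimage _).inter (convex_halfSpace_im_gt _)
  have hRo : ∀ v, IsOpen (R v) := fun v =>
    (isOpen_lt (f := fun z : ℂ => |z.re - v.re|) (by fun_prop) continuous_const).inter
      (isOpen_lt continuous_const Complex.continuous_im)
  have hRN : ∀ v ∈ N, R v ⊆ Nᶜ := by
    rintro v hv z ⟨hz, hz'⟩ hzN
    by_cases h : z.re = v.re
    · rw [hre hzN hv h] at hz'; exact lt_irrefl _ hz'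
    · exact hΩN (hstrip v hv z hz h) hzN
  have conv : ∀ {A : Set ℂ}, Convex ℝ A → A.Nonempty →
      SimplyConnectedSpace A ∧ LocallyPathConnectedSpace A := by
    intro A hA hne
    have := hA.contractibleSpace hne
    exact ⟨inferInstance, hA.locallyPathConnectedSpace⟩
  let zl : ℂ → ℂ := fun v => ⟨v.re - δ / 2, v.im + 1⟩
  let zr : ℂ → ℂ := fun v => ⟨v.re + δ / 2, v.im + 1⟩
  have hzl : ∀ v, zl v ∈ R v ∩ {z | z.re < v.re} := fun v => by
    refine ⟨⟨?_, ?_⟩, ?_⟩ <;> simp only [zl, mem_ofPred_eq, sub_sub_cancel_left, abs_neg]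
    · rw [abs_of_pos] <;> linarith
    · linarith
    · linarith
  have hzr : ∀ v, zr v ∈ R v ∩ {z | v.re < z.re} := fun v => by
    refine ⟨⟨?_, ?_⟩, ?_⟩ <;> simp only [zr, mem_ofPred_eq, add_sub_cancel_left]
    · rw [abs_of_pos] <;> linarith
    · linarith
    · linarith
  have hl : ∀ v ∈ N, R v ∩ {z | z.re < v.re} ⊆ Ω := fun v hv z hz =>
    hstrip v hv z hz.1.1 (ne_of_lt hz.2)
  have hr : ∀ v ∈ N, R v ∩ {z | v.re < z.re} ⊆ Ω := fun v hv z hz =>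
    hstrip v hv z hz.1.1 (ne_of_gt hz.2)
  have eqR : ∀ v ∈ N, ∀ {σ τ : ℂ → E}, ContinuousOn σ (R v) → ContinuousOn τ (R v) →
      (∀ z ∈ R v, p (σ z) = z) → (∀ z ∈ R v, p (τ z) = z) → ∀ z ∈ R v, σ z = τ z →
      EqOn σ τ (R v) := by
    intro v hv σ τ h1 h2 h3 h4 z hz h
    obtain ⟨_, _⟩ := conv (hRc v) ⟨_, (hzl v).1⟩
    exact hp.eqOn_section (hRN v hv) h1 h2 h3 h4 hz h
  have eql : ∀ v ∈ N, ∀ {σ τ : ℂ → E}, ContinuousOn σ (R v) → ContinuousOn τ Ω →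
      (∀ z ∈ R v, p (σ z) = z) → (∀ z ∈ Ω, p (τ z) = z) → ∀ z ∈ R v ∩ {z | z.re < v.re},
      σ z = τ z → EqOn σ τ (R v ∩ {z | z.re < v.re}) := by
    intro v hv σ τ h1 h2 h3 h4 z hz h
    obtain ⟨_, _⟩ := conv ((hRc v).inter (convex_halfSpace_re_lt v.re)) ⟨_, hzl v⟩
    exact hp.eqOn_section (inter_subset_left.trans (hRN v hv)) (h1.mono inter_subset_left)
      (h2.mono (hl v hv)) (fun z hz => h3 z hz.1) (fun z hz => h4 z (hl v hv hz)) hz h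
  have eqr : ∀ v ∈ N, ∀ {σ τ : ℂ → E}, ContinuousOn σ (R v) → ContinuousOn τ Ω →
      (∀ z ∈ R v, p (σ z) = z) → (∀ z ∈ Ω, p (τ z) = z) → ∀ z ∈ R v ∩ {z | v.re < z.re},
      σ z = τ z → EqOn σ τ (R v ∩ {z | v.re < z.re}) := by
    intro v hv σ τ h1 h2 h3 h4 z hz h
    obtain ⟨_, _⟩ := conv ((hRc v).inter (convex_halfSpace_re_gt v.re)) ⟨_, hzr v⟩
    exact hp.eqOn_section (inter_subset_left.trans (hRN v hv)) (h1.mono inter_subset_left)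
      (h2.mono (hr v hv)) (fun z hz => h3 z hz.1) (fun z hz => h4 z (hr v hv hz)) hz h
  have hu : ∀ v ∈ N, ∀ e : I, ∃ σ : ℂ → E, ContinuousOn σ (R v) ∧ (∀ z ∈ R v, p (σ z) = z) ∧
      EqOn σ (s e) (R v ∩ {z | z.re < v.re}) ∧ ∃ e', EqOn σ (s e') (R v ∩ {z | v.re < z.re}) := by
    intro v hv e
    obtain ⟨_, _⟩ := conv (hRc v) ⟨_, (hzl v).1⟩
    have h0 := hps e _ (hl v hv (hzl v))
    obtain ⟨σ, h1, h2, h3⟩ := hp.exists_section (hRN v hv) (s e (zl v)) (by rw [h0]; exact (hzl v).1)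
    rw [h0] at h3
    refine ⟨σ, h1, h2, eql v hv h1 (hs e) h2 (hps e) _ (hzl v) h3, ?_⟩
    have h4 := h2 _ (hzr v).1
    obtain ⟨e', he'⟩ := hex (σ (zr v)) (by rw [h4]; exact hr v hv (hzr v))
    rw [h4] at he'
    exact ⟨e', eqr v hv h1 (hs e') h2 (hps e') _ (hzr v) he'.symm⟩
  have hu' : ∀ v ∈ N, ∃ (w : I → ℂ → E) (cr : I → I), (∀ e, ContinuousOn (w e) (R v)) ∧
      (∀ e, ∀ z ∈ R v, p (w e z) = z) ∧ (∀ e, EqOn (w e) (s e) (R v ∩ {z | z.re < v.re})) ∧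
      ∀ e, EqOn (w e) (s (cr e)) (R v ∩ {z | v.re < z.re}) := by
    intro v hv
    choose w h1 h2 h3 cr h4 using hu v hv
    exact ⟨w, cr, h1, h2, h3, h4⟩
  have : Nonempty (I → I) := ⟨id⟩
  choose! w cr hw hpw hwl hwr using hu'
  -- Two sections over the half strip that agree on the right agree throughout, hence on the left.
  -- Surjectivity follows since the fibre is finite.
  have hcr : ∀ v ∈ N, Function.Bijective (cr v) := by
    intro v hv
    refine Finite.injective_iff_bijective.1 fun e e' h => ?_
    have h1 : w v e (zr v) = w v e' (zr v) := by
      rw [hwr v hv e (hzr v), hwr v hv e' (hzr v), h]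
    have h2 := eqR v hv (hw v hv e) (hw v hv e') (hpw v hv e) (hpw v hv e') _ (hzr v).1 h1 (hzl v).1
    rw [hwl v hv e (hzl v), hwl v hv e' (hzl v)] at h2
    exact huniq (hl v hv (hzl v)) h2
  -- Distinct real parts make the point of `N` over an abscissa unique. The other abscissae get the
  -- identity, so their height `0` is immaterial.
  let D : SlitData I :=
    { height := fun a => if h : ∃ v ∈ N, v.re = a then h.choose.im else 0
      perm := fun a => if h : ∃ v ∈ N, v.re = a then Equiv.ofBijective _ (hcr _ h.choose_spec.1) else 1
      finite_support := by
        refine (hN.image Complex.re).subset fun a ha => ?_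
        by_contra h
        exact ha (dif_neg h) }
  have hD : ∀ v ∈ N, D.height v.re = v.im ∧ ∀ e, D.perm v.re e = cr v e := by
    intro v hv
    have h : ∃ v' ∈ N, v'.re = v.re := ⟨v, hv, rfl⟩
    have h1 : h.choose = v := hre h.choose_spec.1 hv h.choose_spec.2
    have h2 : D.height v.re = h.choose.im := dif_pos h
    have h3 : D.perm v.re = Equiv.ofBijective _ (hcr _ h.choose_spec.1) := dif_pos h
    refine ⟨by rw [h2, h1], fun e => ?_⟩
    rw [h3, Equiv.ofBijective_apply, h1]
  have hD' : ∀ a, D.perm a ≠ 1 → D.node a ∈ N := by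
    intro a ha
    have h : ∃ v ∈ N, v.re = a := by
      by_contra h
      exact ha (dif_neg h)
    obtain ⟨v, hv, rfl⟩ := h
    have : D.node v.re = v := Complex.ext rfl (hD v hv).1
    rwa [this]
  have hDslit : Ω ⊆ D.slitPlane := by
    intro z hz
    by_cases h : D.perm z.re = 1
    · exact Or.inl h
    · exact Or.inr (hz _ (hD' _ h) rfl)
  -- the label of a point
  have hL : ∀ x, ∃ e, (p x ∈ Ω ∧ s e (p x) = x) ∨
      ∃ v ∈ N, (p x).re = v.re ∧ v.im < (p x).im ∧ w v e (p x) = x := by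
    intro x
    by_cases hx : p x ∈ Ω
    · obtain ⟨e, he⟩ := hex x hx
      exact ⟨e, Or.inl ⟨hx, he⟩⟩
    · simp only [Ω, mem_ofPred_eq, not_forall, not_lt] at hx
      obtain ⟨v, hv, h1, h2⟩ := hx
      have h3 : v.im < (p x).im := by
        refine lt_of_le_of_ne h2 fun h => hpN x ?_
        rwa [show p x = v from Complex.ext h1 h.symm]
      have hxR : p x ∈ R v := ⟨by rw [h1, sub_self, abs_zero]; exact hδ0, h3⟩
      obtain ⟨_, _⟩ := conv (hRc v) ⟨_, (hzl v).1⟩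
      obtain ⟨σ, h4, h5, h6⟩ := hp.exists_section (hRN v hv) x hxR
      have h7 := h5 _ (hzl v).1
      obtain ⟨e, he⟩ := hex (σ (zl v)) (by rw [h7]; exact hl v hv (hzl v))
      rw [h7] at he
      refine ⟨e, Or.inr ⟨v, hv, h1, h3, ?_⟩⟩
      rw [eqR v hv (hw v hv e) h4 (hpw v hv e) h5 _ (hzl v).1
        ((hwl v hv e (hzl v)).trans he) hxR, h6]
  choose ℓ hℓ using hL
  have hℓ1 : ∀ {x e}, p x ∈ Ω → s e (p x) = x → ℓ x = e := by
    intro x e hx he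
    rcases hℓ x with ⟨-, h⟩ | ⟨v, hv, h1, h2, -⟩
    · exact huniq hx (h.trans he.symm)
    · exact absurd (hx v hv h1) h2.not_gt
  have hℓ2 : ∀ {x e v}, v ∈ N → (p x).re = v.re → v.im < (p x).im → w v e (p x) = x → ℓ x = e := by
    intro x e v hv h1 h2 h3
    rcases hℓ x with ⟨h, -⟩ | ⟨v', hv', h1', h2', h3'⟩
    · exact absurd (h v hv h1) h2.not_gt
    · obtain rfl := hre hv' hv (h1'.symm.trans h1)
      have hxR : p x ∈ R v' := ⟨by rw [h1, sub_self, abs_zero]; exact hδ0, h2⟩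
      have h4 := eqR v' hv (hw v' hv _) (hw v' hv _) (hpw v' hv _) (hpw v' hv _) _ hxR
        (h3'.trans h3.symm) (hzl v').1
      rw [hwl v' hv _ (hzl v'), hwl v' hv _ (hzl v')] at h4
      exact huniq (hl v' hv (hzl v')) h4
  refine ⟨I, hI, D, fun x => D.pt (p x) (ℓ x), ?_, ?_, fun x => rfl⟩
  · rw [continuous_iff_continuousAt]
    intro x
    rcases hℓ x with ⟨hx, he⟩ | ⟨v, hv, h1, h2, h3⟩
    · refine D.tendsto_pt hpc.continuousAt ?_
      have h1 := hloc.eventually_eq_section ((hs (ℓ x)).continuousAt (hΩo.mem_nhds hx)) he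
        (by filter_upwards [hΩo.mem_nhds hx] with z hz using hps _ z hz)
      filter_upwards [h1, hpc.continuousAt.eventually_mem (hΩo.mem_nhds hx)] with y hy hy'
      rw [D.rel_of_mem_slitPlane (hDslit hx), hℓ1 hy' hy]
    · have hxR : p x ∈ R v := ⟨by rw [h1, sub_self, abs_zero]; exact hδ0, h2⟩
      have hm := (hRo v).mem_nhds hxR
      have h4 := hloc.eventually_eq_section ((hw v hv (ℓ x)).continuousAt hm) h3
        (by filter_upwards [hm] with z hz using hpw v hv _ z hz)
      -- Labels may jump at the slit, but near `x` the map is the crossing section of the slit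
      -- composed with `p`, and that section is continuous.
      have h5 : (fun y => D.pt (p y) (ℓ y)) =ᶠ[𝓝 x] fun y => D.crossing v.re (ℓ x) (p y) := by
        filter_upwards [h4, hpc.continuousAt.eventually_mem hm] with y hy hyR
        rcases lt_trichotomy (p y).re v.re with hlt | heq | hgt
        · rw [D.crossing_of_le hlt.le]
          rw [hwl v hv _ ⟨hyR, hlt⟩] at hy
          rw [hℓ1 (hl v hv ⟨hyR, hlt⟩) hy]
        · rw [D.crossing_of_le heq.le, hℓ2 hv heq hyR.2 hy]
        · rw [D.crossing_of_lt hgt, (hD v hv).2]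
          rw [hwr v hv _ ⟨hyR, hgt⟩] at hy
          rw [hℓ1 (hr v hv ⟨hyR, hgt⟩) hy]
      refine ContinuousAt.congr ?_ h5.symm
      refine ContinuousAt.comp (g := D.crossing v.re (ℓ x)) (D.continuousAt_crossing ?_ ?_ _)
        hpc.continuousAt
      · intro b hb hbx
        exact absurd (hbx.trans h1) hb
      · intro _; rw [(hD v hv).1]; exact h2
  · intro x y hxy
    obtain ⟨h1, h2⟩ := D.pt_eq_pt.1 hxy
    -- Different sheets are glued only at nodes with nontrivial permutation. These lie in `N`, over
    -- which there is no point of `E`.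
    have h3 : ℓ y = ℓ x := by
      by_cases hn : (p x).im = D.height (p x).re
      · rw [SlitData.rel_node _ hn] at h2
        have h4 : D.perm (p x).re = 1 := by
          by_contra h
          refine hpN x ?_
          rw [show p x = D.node (p x).re from Complex.ext rfl hn]
          exact hD' _ h
        rw [h4, Equiv.Perm.sameCycle_one] at h2
        exact h2.symm
      · rwa [SlitData.rel_self _ hn] at h2
    rcases hℓ x with ⟨hx, he⟩ | ⟨v, hv, h4, h5, h6⟩
    · rcases hℓ y with ⟨hy, he'⟩ | ⟨v, hv, h4, h5, -⟩
      · rw [← he, ← he', h1, h3]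
      · exact absurd (hx v hv (h1 ▸ h4)) (by rw [h1]; exact h5.not_gt)
    · rcases hℓ y with ⟨hy, -⟩ | ⟨v', hv', h4', h5', h6'⟩
      · exact absurd (hy v hv (h1 ▸ h4)) (by rw [← h1]; exact h5.not_gt)
      · obtain rfl := hre hv' hv (by rw [← h4, ← h4', h1])
        rw [← h6, ← h6', h1, h3]

/-! ### Sections of local homeomorphisms to the plane -/

section Etale

variable {X : Type u} [TopologicalSpace X] {π : X → ℂ}

theorem IsLocalHomeomorph.exists_disc (hπ : IsLocalHomeomorph π) (x : X) {O : Set X} (hO : O ∈ 𝓝 x) :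
    ∃ r > 0, ∃ σ : ℂ → X, ContinuousOn σ (Metric.ball (π x) r) ∧
      (∀ z ∈ Metric.ball (π x) r, π (σ z) = z) ∧ σ (π x) = x ∧
      ∀ z ∈ Metric.ball (π x) r, σ z ∈ O := by
  obtain ⟨e, hx, rfl⟩ := hπ x
  have h1 : e.target ∈ 𝓝 (e x) := e.open_target.mem_nhds (e.map_source hx)
  have h2 : e.symm ⁻¹' O ∈ 𝓝 (e x) := by
    refine (e.continuousAt_symm (e.map_source hx)).preimage_mem_nhds ?_
    rwa [e.left_inv hx]
  obtain ⟨r, hr, hb⟩ := Metric.mem_nhds_iff.1 (inter_mem h1 h2)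
  exact ⟨r, hr, e.symm, e.continuousOn_symm.mono fun z hz => (hb hz).1,
    fun z hz => e.right_inv (hb hz).1, e.left_inv hx, fun z hz => (hb hz).2⟩

theorem IsLocalHomeomorph.isOpen_image_section (hπ : IsLocalHomeomorph π) {A : Set ℂ}
    (hA : IsOpen A) {σ : ℂ → X} (hσ : ContinuousOn σ A) (hpσ : ∀ z ∈ A, π (σ z) = z) :
    IsOpen (σ '' A) := by
  rw [isOpen_iff_mem_nhds]
  rintro _ ⟨z, hz, rfl⟩
  have hm : A ∈ 𝓝 (π (σ z)) := by rw [hpσ z hz]; exact hA.mem_nhds hz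
  have h1 := hπ.eventually_eq_section (x := σ z) (σ := σ)
    ((hσ.continuousAt (by rw [hpσ z hz]; exact hA.mem_nhds hz)))
    (by rw [hpσ z hz]) (by filter_upwards [hm] with w hw using hpσ w hw)
  filter_upwards [h1, hπ.continuous.continuousAt.eventually_mem hm] with y h2 h3
  exact ⟨π y, h3, h2⟩

variable [T2Space X]

theorem IsLocalHomeomorph.eqOn_section (hπ : IsLocalHomeomorph π) {A : Set ℂ}
    (hA : IsPreconnected A) {σ τ : ℂ → X} (hσ : ContinuousOn σ A) (hτ : ContinuousOn τ A)
    (hpσ : ∀ z ∈ A, π (σ z) = z) (hpτ : ∀ z ∈ A, π (τ z) = z) {z : ℂ} (hz : z ∈ A)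
    (h : σ z = τ z) : EqOn σ τ A :=
  (T2Space.isSeparatedMap π).eqOn_of_comp_eqOn hπ.isLocallyInjective hA hσ hτ
    (fun w hw => by rw [Function.comp_apply, Function.comp_apply, hpσ w hw, hpτ w hw]) hz h

/-- On `C` the maps `σ ∘ π` and the identity are two lifts of `π` that agree at `x`. -/
theorem IsLocalHomeomorph.subset_image_section (hπ : IsLocalHomeomorph π) {A : Set ℂ} {σ : ℂ → X} (hσ : ContinuousOn σ A) (hpσ : ∀ z ∈ A, π (σ z) = z) {C : Set X}
    (hC : IsPreconnected C) (hCA : ∀ y ∈ C, π y ∈ A) {x : X} (hx : x ∈ C) (hx' : σ (π x) = x) :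
    ∀ y ∈ C, σ (π y) = y :=
  (T2Space.isSeparatedMap π).eqOn_of_comp_eqOn hπ.isLocallyInjective hC
    (hσ.comp hπ.continuous.continuousOn hCA) continuousOn_id
    (fun w hw => by simp [hpσ _ (hCA w hw)]) hx hx'

/-! ### σ-compactness -/

/-- `V` is the image of a section over the disc of centre `c` and radius `r`. -/
def IsSheetDisc (π : X → ℂ) (c : ℂ) (r : ℝ) (V : Set X) : Prop :=
  ∃ σ : ℂ → X, ContinuousOn σ (Metric.ball c r) ∧ (∀ z ∈ Metric.ball c r, π (σ z) = z) ∧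
    V = σ '' Metric.ball c r

omit [T2Space X] in
theorem IsLocalHomeomorph.exists_countable_sheetDisc (hπ : IsLocalHomeomorph π) (x : X) :
    ∃ k n : ℕ, ∃ V, IsSheetDisc π (TopologicalSpace.denseSeq ℂ k) (1 / (n + 1)) V ∧ x ∈ V := by
  obtain ⟨r, hr, σ, h1, h2, h3, -⟩ := hπ.exists_disc x univ_mem
  obtain ⟨n, hn⟩ := exists_nat_one_div_lt (half_pos hr)
  have hpos : (0 : ℝ) < 1 / (n + 1) := by positivity
  obtain ⟨k, hk⟩ := (TopologicalSpace.denseRange_denseSeq ℂ).exists_dist_lt (π x) hpos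
  have hsub : Metric.ball (TopologicalSpace.denseSeq ℂ k) (1 / (n + 1)) ⊆ Metric.ball (π x) r :=
    Metric.ball_subset_ball' (by rw [dist_comm]; linarith)
  exact ⟨k, n, _, ⟨σ, h1.mono hsub, fun z hz => h2 z (hsub hz), rfl⟩, π x, hk, h3⟩

/-- The intersection of two discs is convex, so sections meeting above it agree on all of it, and
then on the whole disc. This bounds the number of neighbours in the countability argument. -/
theorem IsLocalHomeomorph.sheetDisc_unique (hπ : IsLocalHomeomorph π) {c c' : ℂ} {r r' : ℝ}
    {V₁ V₂ V' : Set X} (h₁ : IsSheetDisc π c r V₁) (h₂ : IsSheetDisc π c r V₂)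
    (h' : IsSheetDisc π c' r' V') (hV₁ : (V₁ ∩ V').Nonempty) (hV₂ : (V₂ ∩ V').Nonempty) :
    V₁ = V₂ := by
  obtain ⟨σ₁, c₁, p₁, rfl⟩ := h₁
  obtain ⟨σ₂, c₂, p₂, rfl⟩ := h₂
  obtain ⟨τ, ct, pt, rfl⟩ := h'
  have hconv := (convex_ball c r).inter (convex_ball c' r')
  have key : ∀ {σ : ℂ → X}, ContinuousOn σ (Metric.ball c r) →
      (∀ z ∈ Metric.ball c r, π (σ z) = z) → (σ '' Metric.ball c r ∩ τ '' Metric.ball c' r').Nonempty →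
      (Metric.ball c r ∩ Metric.ball c' r').Nonempty ∧
      EqOn σ τ (Metric.ball c r ∩ Metric.ball c' r') := by
    rintro σ cs ps ⟨_, ⟨z, hz, rfl⟩, ⟨w, hw, he⟩⟩
    have hzw : w = z := by rw [← pt w hw, he, ps z hz]
    subst hzw
    exact ⟨⟨w, hz, hw⟩, hπ.eqOn_section hconv.isPreconnected (cs.mono inter_subset_left)
      (ct.mono inter_subset_right) (fun z hz => ps z hz.1) (fun z hz => pt z hz.2) ⟨hz, hw⟩ he.symm⟩
  obtain ⟨⟨z, hz⟩, e₁⟩ := key c₁ p₁ hV₁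
  obtain ⟨-, e₂⟩ := key c₂ p₂ hV₂
  exact (hπ.eqOn_section (convex_ball c r).isPreconnected c₁ c₂ p₁ p₂ hz.1
    ((e₁ hz).trans (e₂ hz).symm)).image_eq

/-- **Poincaré–Volterra**: a connected Hausdorff surface spread over the plane is σ-compact. -/
theorem IsLocalHomeomorph.sigmaCompactSpace (hπ : IsLocalHomeomorph π) [ConnectedSpace X] :
    SigmaCompactSpace X := by
  obtain ⟨x₀⟩ : Nonempty X := inferInstance
  let P : ℕ × ℕ → Set X → Prop := fun q V =>
    IsSheetDisc π (TopologicalSpace.denseSeq ℂ q.1) (1 / (q.2 + 1)) V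
  obtain ⟨k₀, n₀, V₀, hV₀, hx₀⟩ := hπ.exists_countable_sheetDisc x₀
  -- The sheet discs with centre in a dense sequence and radius `1 / (n + 1)` that are reached from
  -- `V₀` by a chain of given length.
  let 𝒟 : ℕ → Set (Set X) := fun n => n.rec {V₀} fun _ 𝒞 =>
    ⋃ V' ∈ 𝒞, ⋃ q, {V | P q V ∧ (V ∩ V').Nonempty}
  have hdisc : ∀ n, ∀ V ∈ 𝒟 n, ∃ q, P q V := by
    intro n V hV
    cases n with
    | zero => obtain rfl : V = V₀ := hV; exact ⟨(k₀, n₀), hV₀⟩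
    | succ n =>
      obtain ⟨V', -, h⟩ := mem_iUnion₂.1 hV
      obtain ⟨q, hq, -⟩ := mem_iUnion.1 h
      exact ⟨q, hq⟩
  have hcount : ∀ n, (𝒟 n).Countable := by
    intro n
    induction n with
    | zero => exact countable_singleton _
    | succ n ih =>
      refine ih.biUnion fun V' hV' => countable_iUnion fun q => Set.Subsingleton.countable ?_
      obtain ⟨q', hq'⟩ := hdisc n V' hV'
      exact fun V₁ h₁ V₂ h₂ => hπ.sheetDisc_unique h₁.1 h₂.1 hq' h₁.2 h₂.2
  have hopen : ∀ n, ∀ V ∈ 𝒟 n, IsOpen V := by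
    intro n V hV
    obtain ⟨q, σ, h1, h2, rfl⟩ := hdisc n V hV
    exact hπ.isOpen_image_section Metric.isOpen_ball h1 h2
  -- If a sheet disc about `x` meets a disc of the chain, it is the next disc of the chain, so `x`
  -- is covered; hence the complement is open.
  have hcl : IsClopen (⋃ n, ⋃ V ∈ 𝒟 n, V) := by
    refine ⟨⟨isOpen_iff_mem_nhds.2 fun x hx => ?_⟩,
      isOpen_iUnion fun n => isOpen_biUnion fun V hV => hopen n V hV⟩
    obtain ⟨k, m, V, hV, hxV⟩ := hπ.exists_countable_sheetDisc x
    have hVo : IsOpen V := by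
      obtain ⟨σ, h1, h2, rfl⟩ := hV
      exact hπ.isOpen_image_section Metric.isOpen_ball h1 h2
    refine mem_of_superset (hVo.mem_nhds hxV) fun y hy hy' => hx ?_
    obtain ⟨n, hn⟩ := mem_iUnion.1 hy'
    obtain ⟨V', hV', hyV'⟩ := mem_iUnion₂.1 hn
    exact mem_iUnion.2 ⟨n + 1, mem_iUnion₂.2 ⟨V, mem_iUnion₂.2 ⟨V', hV', mem_iUnion.2
      ⟨(k, m), hV, y, hy, hyV'⟩⟩, hxV⟩⟩
  have huniv : (⋃ n, ⋃ V ∈ 𝒟 n, V) = univ :=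
    hcl.eq_univ ⟨x₀, mem_iUnion.2 ⟨0, mem_iUnion₂.2 ⟨V₀, rfl, hx₀⟩⟩⟩
  rw [← isSigmaCompact_univ_iff, ← huniv]
  refine isSigmaCompact_iUnion _ fun n => isSigmaCompact_biUnion (hcount n) fun V hV => ?_
  obtain ⟨q, σ, h1, -, rfl⟩ := hdisc n V hV
  refine IsSigmaCompact.image_of_continuousOn ?_ h1
  have : SigmaCompactSpace (Metric.ball (TopologicalSpace.denseSeq ℂ q.1) (1 / ((q.2 : ℝ) + 1))) := by
    have : LocallyCompactSpace (Metric.ball (TopologicalSpace.denseSeq ℂ q.1) (1 / ((q.2 : ℝ) + 1))) :=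
      Metric.isOpen_ball.locallyCompactSpace
    infer_instance
  exact isSigmaCompact_iff_sigmaCompactSpace.2 this

/-! ### The surface inside its flat completion -/

omit [T2Space X] in
theorem IsLocalHomeomorph.continuous_flatSpace_of (hπ : IsLocalHomeomorph π) :
    Continuous (FlatSpace.of π) := by
  rw [continuous_iff_continuousAt]
  intro x
  obtain ⟨r, hr, σ, h1, h2, h3, -⟩ := hπ.exists_disc x univ_mem
  have hb := Metric.ball_mem_nhds (π x) hr
  have hc := hπ.continuous.continuousAt (x := x)
  rw [ContinuousAt, EMetric.tendsto_nhds]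
  intro ε hε
  have h4 := hπ.eventually_eq_section (h1.continuousAt hb) h3
    (by filter_upwards [hb] with z hz using h2 z hz)
  have h5 : ∀ᶠ y in 𝓝 x, edist (π y) (π x) < ε := EMetric.tendsto_nhds.1 hc ε hε
  filter_upwards [h4, hc.eventually_mem hb, h5] with y hy hy' hy''
  rw [FlatSpace.edist_of]
  have h6 := flatEDist_section_le (π := π) (convex_ball (π x) r) h1 (θ := 1)
    (fun z hz => by rw [h2 z hz, one_mul]) hy' (Metric.mem_ball_self hr)
  rw [hy, h3] at h6
  exact h6.trans_lt hy''

/-- A path from `x` shorter than the radius of a section through `x` cannot leave the image of that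
section. -/
theorem IsLocalHomeomorph.isInducing_flatSpace_of (hπ : IsLocalHomeomorph π) :
    IsInducing (FlatSpace.of π) := by
  rw [isInducing_iff_nhds]
  intro x
  refine le_antisymm hπ.continuous_flatSpace_of.continuousAt.le_comap fun O hO => ?_
  obtain ⟨r, hr, σ, h1, h2, h3, h4⟩ := hπ.exists_disc x hO
  refine ⟨Metric.eball (FlatSpace.of π x) (ENNReal.ofReal r),
    Metric.eball_mem_nhds _ (by simpa using hr), fun y hy => ?_⟩
  rw [mem_preimage, Metric.mem_eball, edist_comm, FlatSpace.edist_of] at hy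
  obtain ⟨C, hC, hx, hy, hCb⟩ := exists_isPreconnected_of_flatEDist_lt hy
  have h5 := hπ.subset_image_section h1 h2 hC (fun y hy => hCb y hy) hx h3 y hy
  rw [← h5]
  exact h4 _ (hCb y hy)

/-- The lift of a closed disc about `x` is compact, hence closed in the completion. Surface points
flat-close to `x` lie in it, so by density the points of the completion near `x` lie in it as well,
and the surface is open. -/
theorem IsLocalHomeomorph.isOpenEmbedding_toFlatCompletion (hπ : IsLocalHomeomorph π) :
    IsOpenEmbedding (toFlatCompletion π) := by
  have hind : IsInducing (toFlatCompletion π) :=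
    (UniformSpace.Completion.isUniformInducing_coe (FlatSpace π)).isInducing.comp
      hπ.isInducing_flatSpace_of
  refine ⟨⟨hind, hind.injective⟩, ?_⟩
  rw [isOpen_iff_mem_nhds]
  rintro _ ⟨x, rfl⟩
  obtain ⟨r, hr, σ, h1, h2, h3, -⟩ := hπ.exists_disc x univ_mem
  have hr2 := half_pos hr
  have hK : IsCompact (σ '' Metric.closedBall (π x) (r / 2)) :=
    (isCompact_closedBall _ _).image_of_continuousOn
      (h1.mono (Metric.closedBall_subset_ball (by linarith)))
  have hKc : IsClosed (toFlatCompletion π '' (σ '' Metric.closedBall (π x) (r / 2))) :=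
    (hK.image hind.continuous).isClosed
  have hx := Metric.eball_mem_nhds (FlatSpace.of π x) (ε := ENNReal.ofReal (r / 2)) (by simpa using hr)
  rw [(UniformSpace.Completion.isUniformInducing_coe (FlatSpace π)).isInducing.nhds_eq_comap,
    mem_comap] at hx
  obtain ⟨O', hO', hsub⟩ := hx
  obtain ⟨U, hUO, hU, hxU⟩ := mem_nhds_iff.1 hO'
  refine mem_of_superset (hU.mem_nhds hxU) (Subset.trans (fun ξ hξ => ?_)
    (image_subset_range _ (σ '' Metric.closedBall (π x) (r / 2))))
  rw [← hKc.closure_eq]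
  have hd : ξ ∈ closure (range (toFlatCompletion π)) :=
    UniformSpace.Completion.denseRange_coe (α := FlatSpace π) ξ
  rw [mem_closure_iff_nhds] at hd ⊢
  intro O hO
  obtain ⟨_, ⟨hyO, hyb⟩, y, rfl⟩ := hd _ (inter_mem hO (hU.mem_nhds hξ))
  refine ⟨_, hyO, y, ?_, rfl⟩
  have hyb' : flatEDist π x y < ENNReal.ofReal (r / 2) := by
    have h : FlatSpace.of π y ∈ Metric.eball (FlatSpace.of π x) (ENNReal.ofReal (r / 2)) :=
      hsub (hUO hyb)
    rwa [Metric.mem_eball, edist_comm] at h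
  obtain ⟨C, hC, hx, hy, hCb⟩ := exists_isPreconnected_of_flatEDist_lt hyb'
  have h5 := hπ.subset_image_section h1 h2 hC
    (fun y hy => (hCb y hy).trans (by linarith)) hx h3 y hy
  exact ⟨π y, (hCb y hy).le, h5⟩

omit [T2Space X] in
theorem continuous_flatExtension (π : X → ℂ) : Continuous (flatExtension π) :=
  UniformSpace.Completion.continuous_extension

end Etale

/-! ### Finite cone points of the completion -/

section FiniteCone

variable {X : Type u} [TopologicalSpace X] {π : X → ℂ}

/-- `ξ` has a neighbourhood consisting of `ξ` and of a connected set `W` which `π` maps as a finite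
covering onto the punctured disc of radius `r`. -/
structure IsFiniteCone (π : X → ℂ) (ξ : FlatCompletion π) (r : ℝ) (W : Set X) : Prop where
  pos : 0 < r
  isOpen_insert : IsOpen (insert ξ (toFlatCompletion π '' W))
  isConnected : IsConnected W
  mapsTo : MapsTo π W (Metric.ball (flatExtension π ξ) r \ {flatExtension π ξ})
  isCoveringMap : IsCoveringMap mapsTo.restrict
  finite : ∀ z, (mapsTo.restrict ⁻¹' {z}).Finite

theorem HasFiniteRamificationOrder.exists_isFiniteCone {ξ : FlatCompletion π}
    (h : HasFiniteRamificationOrder π ξ) : ∃ r W, IsFiniteCone π ξ r W := by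
  obtain ⟨m, -, -, r, W, hr, hW, ho, hm, hc, hcard⟩ := h
  exact ⟨r, W, hr, ho, hW, hm, hc, fun z => finite_of_encard_eq_coe (hcard z)⟩

/-- The punctured disc is the image of a half plane under a translate of the exponential. -/
theorem isConnected_ball_diff_center (c : ℂ) {r : ℝ} (hr : 0 < r) :
    IsConnected (Metric.ball c r \ {c}) := by
  have h : Metric.ball c r \ {c} = (fun z => c + Complex.exp z) '' {z | z.re < Real.log r} := by
    ext w
    constructor
    · rintro ⟨hw, hwc⟩
      have hne : w - c ≠ 0 := sub_ne_zero.2 hwc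
      refine ⟨Complex.log (w - c), ?_, by simp [Complex.exp_log hne]⟩
      rw [mem_ofPred_eq, Complex.log_re]
      exact Real.log_lt_log (norm_pos_iff.2 hne) (by rwa [← dist_eq_norm])
    · rintro ⟨z, hz, rfl⟩
      refine ⟨?_, by simp [Complex.exp_ne_zero]⟩
      rw [Metric.mem_ball, dist_eq_norm, add_sub_cancel_left, Complex.norm_exp]
      exact (Real.lt_log_iff_exp_lt hr).1 hz
  rw [h]
  refine IsConnected.image ⟨⟨((Real.log r - 1 : ℝ) : ℂ), ?_⟩, ?_⟩ _ (by fun_prop)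
  · simp
  · exact (convex_halfSpace_re_lt _).isPreconnected

variable [T2Space X] (hπ : IsLocalHomeomorph π)
include hπ

/-- A point of the surface is a cone with one sheet, so it can be treated like a ramification point
of finite order. -/
theorem IsLocalHomeomorph.exists_isFiniteCone (x : X) {O : Set X} (hO : O ∈ 𝓝 x) :
    ∃ r W, IsFiniteCone π (toFlatCompletion π x) r W ∧ W ⊆ O := by
  obtain ⟨r, hr, σ, h1, h2, h3, h4⟩ := hπ.exists_disc x hO
  have hx : flatExtension π (toFlatCompletion π x) = π x := flatExtension_toFlatCompletion π x
  have hsub : Metric.ball (π x) r \ {π x} ⊆ Metric.ball (π x) r := sdiff_subset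
  have hmap : MapsTo π (σ '' (Metric.ball (π x) r \ {π x}))
      (Metric.ball (flatExtension π (toFlatCompletion π x)) r \
        {flatExtension π (toFlatCompletion π x)}) := by
    rw [hx]
    rintro _ ⟨z, hz, rfl⟩
    rwa [h2 z hz.1]
  have hinv : ∀ z : ↥(Metric.ball (flatExtension π (toFlatCompletion π x)) r \
        {flatExtension π (toFlatCompletion π x)}), (z : ℂ) ∈ Metric.ball (π x) r \ {π x} := by
    rintro ⟨z, hz⟩; rwa [hx] at hz
  let e : ↥(σ '' (Metric.ball (π x) r \ {π x})) ≃ₜ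
      ↥(Metric.ball (flatExtension π (toFlatCompletion π x)) r \
        {flatExtension π (toFlatCompletion π x)}) :=
    { toFun := hmap.restrict
      invFun := fun z => ⟨σ z, z, hinv z, rfl⟩
      left_inv := by
        rintro ⟨_, z, hz, rfl⟩
        exact Subtype.ext (congrArg σ (h2 z hz.1))
      right_inv := fun z => Subtype.ext (h2 z (hinv z).1)
      continuous_toFun := (hπ.continuous.comp continuous_subtype_val).subtype_mk _
      continuous_invFun := by
        refine Continuous.subtype_mk ?_ _
        exact (h1.mono hsub).comp_continuous continuous_subtype_val hinv }
  have hcon : IsConnected (Metric.ball (π x) r \ {π x}) := isConnected_ball_diff_center _ hr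
  refine ⟨r, _, ⟨hr, ?_, hcon.image _ (h1.mono hsub), hmap, ?_,
    fun z => ((finite_singleton z).preimage e.injective.injOn)⟩,
    image_subset_iff.2 fun z hz => h4 z hz.1⟩
  swap
  · rw [isCoveringMap_iff_isCoveringMapOn_univ]
    exact e.isClosedMap.isCoveringMapOn_of_isLocalHomeomorphOn
      (fun z _ => (finite_singleton z).preimage e.injective.injOn)
      e.isLocalHomeomorph.isLocalHomeomorphOn
  rw [← image_insert_eq]
  refine hπ.isOpenEmbedding_toFlatCompletion.isOpenMap _ ?_
  convert hπ.isOpen_image_section Metric.isOpen_ball h1 h2 using 1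
  conv_lhs => rw [← h3]
  rw [← image_insert_eq, h3, insert_sdiff_singleton, insert_eq_of_mem (Metric.mem_ball_self hr)]

namespace IsFiniteCone

variable {ξ : FlatCompletion π} {r : ℝ} {W : Set X} (h : IsFiniteCone π ξ r W)
include h

omit [T2Space X] hπ in
theorem notMem : ξ ∉ toFlatCompletion π '' W := by
  rintro ⟨x, hx, rfl⟩
  exact (h.mapsTo hx).2 (flatExtension_toFlatCompletion π x).symm

theorem isOpen : IsOpen W := by
  have hj := hπ.isOpenEmbedding_toFlatCompletion
  have h1 : W = toFlatCompletion π ⁻¹' (insert ξ (toFlatCompletion π '' W) \ {ξ}) := by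
    rw [insert_sdiff_self_of_notMem h.notMem, preimage_image_eq _ hj.injective]
  rw [h1]
  exact (h.isOpen_insert.sdiff isClosed_singleton).preimage hj.continuous

omit [T2Space X] hπ in
theorem isOpen_insert_inter (ρ : ℝ) (hρ : 0 < ρ) : IsOpen (insert ξ (toFlatCompletion π ''
    (W ∩ π ⁻¹' Metric.ball (flatExtension π ξ) ρ))) := by
  convert h.isOpen_insert.inter (Metric.isOpen_ball.preimage (continuous_flatExtension π)
    (t := Metric.ball (flatExtension π ξ) ρ)) using 1
  ext η
  constructor
  · rintro (rfl | ⟨x, ⟨hx, hx'⟩, rfl⟩)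
    · exact ⟨mem_insert _ _, Metric.mem_ball_self hρ⟩
    · exact ⟨Or.inr ⟨x, hx, rfl⟩, by rwa [mem_preimage, flatExtension_toFlatCompletion]⟩
  · rintro ⟨rfl | ⟨x, hx, rfl⟩, hη⟩
    · exact mem_insert _ _
    · refine Or.inr ⟨x, ⟨hx, ?_⟩, rfl⟩
      rwa [mem_preimage, flatExtension_toFlatCompletion] at hη

omit [T2Space X] hπ in
theorem finite_fiber (z : ℂ) : {x ∈ W | π x = z}.Finite := by
  by_cases hz : z ∈ Metric.ball (flatExtension π ξ) r \ {flatExtension π ξ}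
  · refine ((h.finite ⟨z, hz⟩).image Subtype.val).subset ?_
    rintro x ⟨hx, rfl⟩
    exact ⟨⟨x, hx⟩, rfl, rfl⟩
  · convert finite_empty
    refine eq_empty_of_forall_notMem ?_
    rintro x ⟨hx, rfl⟩
    exact hz (h.mapsTo hx)

omit [T2Space X] hπ in
theorem exists_section {A : Set ℂ} (hA : Convex ℝ A)
    (hAb : A ⊆ Metric.ball (flatExtension π ξ) r \ {flatExtension π ξ}) {x : X} (hx : x ∈ W)
    (hxA : π x ∈ A) : ∃ σ : ℂ → X, ContinuousOn σ A ∧ (∀ z ∈ A, π (σ z) = z) ∧ σ (π x) = x ∧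
      ∀ z ∈ A, σ z ∈ W := by
  classical
  have := hA.contractibleSpace ⟨_, hxA⟩
  have := hA.locallyPathConnectedSpace
  obtain ⟨F, ⟨h1, h2⟩, -⟩ := h.isCoveringMap.existsUnique_continuousMap_lifts (A := A)
    ⟨fun a => ⟨a, hAb a.2⟩, by fun_prop⟩ ⟨π x, hxA⟩ ⟨x, hx⟩ rfl
  refine ⟨fun z => if hz : z ∈ A then F ⟨z, hz⟩ else x, ?_, fun z hz => ?_, ?_, fun z hz => ?_⟩
  · rw [continuousOn_iff_continuous_domRestrict]
    convert continuous_subtype_val.comp F.continuous using 1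
    ext ⟨z, hz⟩
    simp [hz]
  · simp only [dif_pos hz]
    exact congrArg Subtype.val (congrFun h2 ⟨z, hz⟩)
  · simp only [dif_pos hxA]
    exact congrArg Subtype.val h1
  · simp only [dif_pos hz]
    exact (F _).2

-- The radial contraction of the punctured disc of radius `r` into the one of radius `ρ` lifts to
-- `W`, so the smaller cone is connected because `W` is.
omit [T2Space X] hπ in
theorem isConnected_inter {ρ : ℝ} (hρ : 0 < ρ) (hρr : ρ ≤ r) :
    IsConnected (W ∩ π ⁻¹' Metric.ball (flatExtension π ξ) ρ) := by
  obtain ⟨c, hc⟩ : ∃ c, c = flatExtension π ξ := ⟨_, rfl⟩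
  obtain ⟨hmaps, hcov⟩ : ∃ hm : MapsTo π W (Metric.ball c r \ {c}), IsCoveringMap hm.restrict := by
    subst hc
    exact ⟨h.mapsTo, h.isCoveringMap⟩
  rw [← hc]
  have hmaps' : ∀ w ∈ W, π w ∈ Metric.ball c r \ {c} := fun w hw => hmaps hw
  have hr := h.pos
  let f : unitInterval → ℝ := fun t => 1 - t * (1 - ρ / r)
  have hq : 0 < ρ / r := div_pos hρ hr
  have hq1 : ρ / r ≤ 1 := (div_le_one hr).2 hρr
  have hf0 : ∀ t, 0 < f t := fun t => by
    have := t.2.2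
    have := t.2.1
    simp only [f]; nlinarith
  have hf1 : ∀ t, f t ≤ 1 := fun t => by
    have := t.2.1
    simp only [f]; nlinarith
  have hcont : Continuous fun q : unitInterval × W => c + (f q.1 : ℂ) * (π q.2 - c) := by
    have hπc : Continuous fun w : W => π w :=
      continuous_subtype_val.comp hcov.continuous
    have hπc' : Continuous fun q : unitInterval × W => π q.2 := hπc.comp continuous_snd
    exact continuous_const.add ((Complex.continuous_ofReal.comp
      (by simp only [f]; fun_prop : Continuous fun q : unitInterval × W => f q.1)).mul
      (hπc'.sub continuous_const))
  have hn : ∀ t (w : W), ‖c + (f t : ℂ) * (π w - c) - c‖ = f t * ‖π w - c‖ := by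
    intro t w
    rw [add_sub_cancel_left, norm_mul, Complex.norm_real, Real.norm_of_nonneg (hf0 t).le]
  have hmem : ∀ q : unitInterval × W, c + (f q.1 : ℂ) * (π q.2 - c) ∈ Metric.ball c r \ {c} := by
    rintro ⟨t, w⟩
    have hw := hmaps' w.1 w.2
    have hw1 : ‖π w - c‖ < r := by rw [← dist_eq_norm]; exact hw.1
    refine ⟨?_, ?_⟩
    · rw [Metric.mem_ball, dist_eq_norm, hn]
      exact (mul_le_of_le_one_left (norm_nonneg _) (hf1 t)).trans_lt hw1
    · rw [mem_singleton_iff, add_eq_left, mul_eq_zero, not_or]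
      exact ⟨by exact_mod_cast (hf0 t).ne', sub_ne_zero.2 hw.2⟩
  let H : C(unitInterval × W, ↥(Metric.ball c r \ {c})) := ⟨fun q => ⟨_, hmem q⟩, hcont.subtype_mk _⟩
  have H0 : ∀ w, H (0, w) = MapsTo.restrict π W (Metric.ball c r \ {c}) hmaps ((ContinuousMap.id W) w) := by
    intro w
    refine Subtype.ext ?_
    change c + (f 0 : ℂ) * (π w - c) = π w
    simp [f]
  let F := hcov.liftHomotopy H (ContinuousMap.id W) H0
  have hF : ∀ t w, π (F (t, w)) = c + (f t : ℂ) * (π w - c) := fun t w =>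
    congrArg Subtype.val (congrFun (hcov.liftHomotopy_lifts H (ContinuousMap.id W) H0) (t, w))
  have hF0 : ∀ w, F (0, w) = w := fun w => hcov.liftHomotopy_zero H (ContinuousMap.id W) H0 w
  have hF1 : ∀ w, (F (1, w) : X) ∈ W ∩ π ⁻¹' Metric.ball c ρ := by
    intro w
    refine ⟨(F (1, w)).2, ?_⟩
    have hw1 : ‖π w - c‖ < r := by rw [← dist_eq_norm]; exact (hmaps' w.1 w.2).1
    rw [mem_preimage, Metric.mem_ball, dist_eq_norm, hF, hn]
    have : f 1 = ρ / r := by simp [f]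
    rw [this, div_mul_eq_mul_div, div_lt_iff₀ hr]
    exact mul_lt_mul_of_pos_left hw1 hρ
  obtain ⟨w₀, hw₀⟩ := h.isConnected.nonempty
  refine ⟨⟨_, hF1 ⟨w₀, hw₀⟩⟩, isPreconnected_of_forall (F (1, ⟨w₀, hw₀⟩) : X) fun y hy => ?_⟩
  have hWc : PreconnectedSpace W := isPreconnected_iff_preconnectedSpace.1 h.isConnected.isPreconnected
  have hFc : Continuous fun w : W => (F (1, w) : X) := by fun_prop
  have hFy : Continuous fun t : unitInterval => (F (t, ⟨y, hy.1⟩) : X) := by fun_prop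
  -- The final image of `W`, together with the track of `y`, is a connected subset of the small cone
  -- that contains `y` and the fixed base point.
  refine ⟨range (fun w : W => (F (1, w) : X)) ∪ range (fun t : unitInterval => (F (t, ⟨y, hy.1⟩) : X)),
    ?_, Or.inl ⟨_, rfl⟩, Or.inr ⟨0, by simp only [hF0]⟩,
    (isPreconnected_range hFc).union' ⟨_, ⟨⟨y, hy.1⟩, rfl⟩, ⟨1, rfl⟩⟩ (isPreconnected_range hFy)⟩
  refine union_subset (range_subset_iff.2 hF1) (range_subset_iff.2 fun t => ⟨(F _).2, ?_⟩)
  have hy1 : ‖π y - c‖ < ρ := by rw [← dist_eq_norm]; exact hy.2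
  rw [mem_preimage, Metric.mem_ball, dist_eq_norm, hF, hn]
  exact (mul_le_of_le_one_left (norm_nonneg _) (hf1 t)).trans_lt hy1

end IsFiniteCone

end FiniteCone

/-! ### Coverings from transition permutations between cells -/

section CellCovering

/-- Given a labelling `c` of the points of `B` by cells, and stars `V b` such that two of them only
meet at points near which `c` is constant or when their centres have the same label, every family
of permutations `T` of a discrete set `F` indexed by pairs of cells is the family of transitions of
a covering of `B` with fibre `F`. -/
theorem exists_isCoveringMap_of_cells {B : Type} [TopologicalSpace B] {C : Type} (c : B → C)
    (V : B → Set B) (hVo : ∀ b, IsOpen (V b)) (hVm : ∀ b, b ∈ V b)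
    (hV : ∀ b b', ∀ x ∈ V b ∩ V b', c b = c b' ∨ ∀ᶠ y in 𝓝 x, c y = c x)
    {F : Type u} (T : C → C → Equiv.Perm F) (hT : ∀ k, T k k = 1) :
    ∃ (E : Type u) (_ : TopologicalSpace E) (p : E → B) (mk : B → F → E), IsCoveringMap p ∧
      (∀ b f, p (mk b f) = b) ∧ (∀ b, Function.Injective (mk b)) ∧
      (∀ b, p ⁻¹' {b} = range (mk b)) ∧
      ∀ {X : Type u} [TopologicalSpace X] (g : X → B) (f : X → F), Continuous g →
        (∀ x, ∀ᶠ y in 𝓝 x, T (c (g x)) (c (g y)) (f x) = f y) →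
        Continuous (fun y => mk (g y) (f y)) := by
  let _ : TopologicalSpace F := ⊥
  have _ : DiscreteTopology F := ⟨rfl⟩
  let Z : FiberBundleCore B B F :=
    { baseSet := V
      isOpen_baseSet := hVo
      indexAt := id
      mem_baseSet_at := hVm
      -- The coordinate over `V b` is a label relative to the cell of `b`: it is carried to the cell
      -- of `x`, and from there back to the cell of `b'`. The cocycle identity is then automatic for
      -- any `T`.
      coordChange := fun b b' x => ⇑((T (c b') (c x))⁻¹ * T (c b) (c x))
      coordChange_self := fun b x _ v => by rw [inv_mul_cancel]; rfl
      continuousOn_coordChange := by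
        rintro b b' ⟨x, v⟩ ⟨hx, -⟩
        refine ContinuousAt.continuousWithinAt ?_
        refine (continuousAt_const (y := ((T (c b') (c x))⁻¹ * T (c b) (c x)) v)).congr ?_
        have h2 : ∀ᶠ q : B × F in 𝓝 (x, v), q.2 = v :=
          continuous_snd.continuousAt.eventually_mem ((isOpen_discrete {v}).mem_nhds (mem_singleton v))
        -- The transition is locally constant in either case: it is the identity when the labels of
        -- the centres agree, and otherwise the label of `x` is locally constant.
        rcases hV b b' x hx with h | h
        · filter_upwards [h2] with q hq
          rw [hq, h, inv_mul_cancel, inv_mul_cancel]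
        · filter_upwards [h2, (continuous_fst.tendsto (x, v)).eventually h] with q hq hq'
          rw [hq, hq']
      coordChange_comp := fun b b' b'' x _ v => by
        simp only [← Equiv.Perm.mul_apply]
        rw [mul_assoc, mul_inv_cancel_left] }
  refine ⟨Z.TotalSpace, inferInstance, Z.proj, fun b f => ⟨b, f⟩, FiberBundle.isCoveringMap,
    fun b f => rfl, fun b f f' h => ?_, fun b => ?_, ?_⟩
  · injection h
  · ext ⟨b', f⟩
    constructor
    · rintro rfl
      exact ⟨f, rfl⟩
    · rintro ⟨f', h⟩
      injection h with h1
      exact h1.symm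
  · intro X _ g f hg hf
    rw [continuous_iff_continuousAt]
    intro x
    rw [FiberBundle.continuousAt_totalSpace]
    refine ⟨hg.continuousAt, ?_⟩
    refine (continuousAt_const (y := f x)).congr ?_
    filter_upwards [hf x] with y hy
    change f x = ((T (c (g x)) (c (g y)))⁻¹ * T (c (g y)) (c (g y))) (f y)
    rw [hT, mul_one, ← hy, ← Equiv.Perm.mul_apply, inv_mul_cancel]
    rfl

/-- A partially defined injection of a finite type extends to a permutation. -/
theorem exists_perm_extending {F : Type u} [Finite F] (R : F → F → Prop)
    (h1 : ∀ f g g', R f g → R f g' → g = g') (h2 : ∀ f f' g, R f g → R f' g → f = f') :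
    ∃ τ : Equiv.Perm F, ∀ f g, R f g → τ f = g := by
  let A := {f // ∃ g, R f g}
  obtain ⟨τ, hτ⟩ := Equiv.Perm.exists_extending_pair (α := A) (fun a => a.1) (fun a => a.2.choose)
    Subtype.val_injective fun a a' h => Subtype.ext (h2 _ _ _ a.2.choose_spec (by
      have := a'.2.choose_spec
      rwa [← show a.2.choose = a'.2.choose from h] at this))
  exact ⟨τ, fun f g hfg => (hτ ⟨f, g, hfg⟩).trans (h1 _ _ _ (Exists.choose_spec _) hfg)⟩

end CellCovering

/-! ### Rectangular grids -/

/-- The vertical and horizontal lines of a rectangular grid. -/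
structure Grid where
  re : Finset ℝ
  im : Finset ℝ

namespace Grid

variable (G : Grid)

/-- The vertices of the grid. -/
def vertices : Set ℂ := {z | z.re ∈ G.re ∧ z.im ∈ G.im}

theorem finite_vertices : G.vertices.Finite := by
  refine Set.Finite.of_finite_image (f := fun z => (z.re, z.im)) ?_ ?_
  · refine (G.re.finite_toSet.prod G.im.finite_toSet).subset ?_
    rintro _ ⟨z, hz, rfl⟩
    exact hz
  · intro z _ w _ h
    exact Complex.ext (congrArg Prod.fst h) (congrArg Prod.snd h)

/-- The label of the half open cell of a point. -/
def label (z : ℂ) : Finset ℝ × Finset ℝ := (G.re.filter (· ≤ z.re), G.im.filter (· ≤ z.im))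

/-- The closed cell with a given label, deprived of the vertices. -/
def cell (k : Finset ℝ × Finset ℝ) : Set ℂ :=
  {z | z ∉ G.vertices ∧ (∀ a ∈ G.re, (a ∈ k.1 → a ≤ z.re) ∧ (a ∉ k.1 → z.re ≤ a)) ∧
    ∀ a ∈ G.im, (a ∈ k.2 → a ≤ z.im) ∧ (a ∉ k.2 → z.im ≤ a)}

/-- The star of a point: it only meets the lines through that point. -/
def star (b : ℂ) : Set ℂ :=
  {z | (∀ a ∈ G.re, a ≠ b.re → |z.re - b.re| < |a - b.re|) ∧
    ∀ a ∈ G.im, a ≠ b.im → |z.im - b.im| < |a - b.im|}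

theorem label_mem (z : ℂ) : G.label z ∈ (G.re.powerset ×ˢ G.im.powerset : Finset _) := by
  simp [label]

theorem mem_star_self (b : ℂ) : b ∈ G.star b :=
  ⟨fun a _ h => by simpa [sub_eq_zero] using h, fun a _ h => by simpa [sub_eq_zero] using h⟩

theorem isOpen_star (b : ℂ) : IsOpen (G.star b) := by
  have h1 : IsOpen {z : ℂ | ∀ a ∈ G.re, a ≠ b.re → |z.re - b.re| < |a - b.re|} := by
    have : {z : ℂ | ∀ a ∈ G.re, a ≠ b.re → |z.re - b.re| < |a - b.re|} =
      ⋂ a ∈ G.re, {z : ℂ | a ≠ b.re → |z.re - b.re| < |a - b.re|} := by ext; simp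
    rw [this]
    refine isOpen_biInter_finset fun a _ => ?_
    by_cases h : a = b.re
    · simp [h]
    · simp only [ne_eq, h, not_false_eq_true, true_imp_iff]
      exact isOpen_lt (by fun_prop) continuous_const
  have h2 : IsOpen {z : ℂ | ∀ a ∈ G.im, a ≠ b.im → |z.im - b.im| < |a - b.im|} := by
    have : {z : ℂ | ∀ a ∈ G.im, a ≠ b.im → |z.im - b.im| < |a - b.im|} =
      ⋂ a ∈ G.im, {z : ℂ | a ≠ b.im → |z.im - b.im| < |a - b.im|} := by ext; simp
    rw [this]
    refine isOpen_biInter_finset fun a _ => ?_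
    by_cases h : a = b.im
    · simp [h]
    · simp only [ne_eq, h, not_false_eq_true, true_imp_iff]
      exact isOpen_lt (by fun_prop) continuous_const
  exact h1.inter h2

theorem le_iff_le_of_abs_lt {a b x : ℝ} (h : |x - b| < |a - b|) : a ≤ x ↔ a ≤ b := by
  rcases le_total a b with hab | hab
  · rw [abs_of_nonpos (sub_nonpos.2 hab), abs_lt] at h
    exact ⟨fun _ => hab, fun _ => by linarith [h.1]⟩
  · rw [abs_of_nonneg (sub_nonneg.2 hab), abs_lt] at h
    exact ⟨fun h' => by linarith [h.2], fun h' => by linarith [h.2, h.1]⟩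

theorem filter_eq_of_near {s : Finset ℝ} {x b : ℝ} (h : ∀ a ∈ s, |x - b| < |a - b|) :
    s.filter (· ≤ x) = s.filter (· ≤ b) :=
  Finset.filter_congr fun a ha => le_iff_le_of_abs_lt (h a ha)

theorem eq_of_mem_of_near {s : Finset ℝ} {x b : ℝ} (h : ∀ a ∈ s, a ≠ b → |x - b| < |a - b|)
    (hx : x ∈ s) : x = b := by
  by_contra hne
  exact lt_irrefl _ (h x hx hne)

/-- A star meets only the lines through its centre. If `x` is on a grid line, both centres are on
that line, are not vertices, and lie in the same interval between the perpendicular lines. If `x` is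
on no line, the label is constant near `x`. -/
theorem label_eq_of_mem_star {b b' x : ℂ} (hb : b ∉ G.vertices) (hb' : b' ∉ G.vertices)
    (hx : x ∈ G.star b) (hx' : x ∈ G.star b') :
    G.label b = G.label b' ∨ ∀ᶠ y in 𝓝 x, G.label y = G.label x := by
  have key : ∀ {s : Finset ℝ} {x b b' : ℝ}, (∀ a ∈ s, a ≠ b → |x - b| < |a - b|) →
      (∀ a ∈ s, a ≠ b' → |x - b'| < |a - b'|) → b ∉ s → b' ∉ s →
      s.filter (· ≤ b) = s.filter (· ≤ b') := by
    intro s x b b' h h' hb hb'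
    rw [← filter_eq_of_near (x := x) fun a ha => h a ha fun e => hb (e ▸ ha),
      ← filter_eq_of_near (x := x) fun a ha => h' a ha fun e => hb' (e ▸ ha)]
  by_cases h1 : x.re ∈ G.re
  · left
    have e1 := eq_of_mem_of_near hx.1 h1
    have e2 := eq_of_mem_of_near hx'.1 h1
    refine Prod.ext (by simp only [label, ← e1, ← e2]) (key hx.2 hx'.2 ?_ ?_)
    · exact fun h => hb ⟨e1 ▸ h1, h⟩
    · exact fun h => hb' ⟨e2 ▸ h1, h⟩
  by_cases h2 : x.im ∈ G.im
  · left
    have e1 := eq_of_mem_of_near hx.2 h2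
    have e2 := eq_of_mem_of_near hx'.2 h2
    refine Prod.ext (key hx.1 hx'.1 ?_ ?_) (by simp only [label, ← e1, ← e2])
    · exact fun h => hb ⟨h, e1 ▸ h2⟩
    · exact fun h => hb' ⟨h, e2 ▸ h2⟩
  right
  filter_upwards [(G.isOpen_star x).mem_nhds (G.mem_star_self x)] with y hy
  exact Prod.ext (filter_eq_of_near fun a ha => hy.1 a ha fun e => h1 (e ▸ ha))
    (filter_eq_of_near fun a ha => hy.2 a ha fun e => h2 (e ▸ ha))

theorem mem_cell_label {z : ℂ} (hz : z ∉ G.vertices) : z ∈ G.cell (G.label z) := by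
  refine ⟨hz, fun a ha => ⟨fun h => (Finset.mem_filter.1 h).2, fun h => ?_⟩,
    fun a ha => ⟨fun h => (Finset.mem_filter.1 h).2, fun h => ?_⟩⟩ <;>
  · by_contra hlt
    exact h (Finset.mem_filter.2 ⟨ha, (not_le.1 hlt).le⟩)

/-- No grid line separates `b` strictly from a point of its star, so `b` belongs to the closed cell
of that point. -/
theorem mem_cell_of_mem_star {b x : ℂ} (hb : b ∉ G.vertices) (hx : x ∈ G.star b) :
    b ∈ G.cell (G.label x) := by
  have key : ∀ {s : Finset ℝ} {x b : ℝ}, (∀ a ∈ s, a ≠ b → |x - b| < |a - b|) → ∀ a ∈ s,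
      (a ∈ s.filter (· ≤ x) → a ≤ b) ∧ (a ∉ s.filter (· ≤ x) → b ≤ a) := by
    intro s x b h a ha
    by_cases hab : a = b
    · exact ⟨fun _ => hab.le, fun _ => hab.ge⟩
    · rw [Finset.mem_filter, le_iff_le_of_abs_lt (h a ha hab)]
      exact ⟨fun h => h.2, fun h => le_of_not_ge fun h' => h ⟨ha, h'⟩⟩
  exact ⟨hb, key hx.1, key hx.2⟩

/-- A vertex in a closed cell is an extreme point of it, so removing the vertices preserves
convexity. -/
theorem convex_cell (k : Finset ℝ × Finset ℝ) : Convex ℝ (G.cell k) := by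
  have key : ∀ {s k : Finset ℝ} {x y t t' : ℝ}, 0 < t → 0 < t' → t + t' = 1 →
      (∀ a ∈ s, (a ∈ k → a ≤ x) ∧ (a ∉ k → x ≤ a)) → (∀ a ∈ s, (a ∈ k → a ≤ y) ∧ (a ∉ k → y ≤ a)) →
      (∀ a ∈ s, (a ∈ k → a ≤ t * x + t' * y) ∧ (a ∉ k → t * x + t' * y ≤ a)) ∧
      (t * x + t' * y ∈ s → x = t * x + t' * y ∧ y = t * x + t' * y) := by
    intro s k x y t t' ht ht' htt hx hy
    have e1 : ∀ a, a = t * a + t' * a := fun a => by rw [← add_mul, htt, one_mul]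
    refine ⟨fun a ha => ⟨fun hk => ?_, fun hk => ?_⟩, fun hs => ?_⟩
    · nlinarith [e1 a, mul_nonneg ht.le (sub_nonneg.2 ((hx a ha).1 hk)),
        mul_nonneg ht'.le (sub_nonneg.2 ((hy a ha).1 hk))]
    · nlinarith [e1 a, mul_nonneg ht.le (sub_nonneg.2 ((hx a ha).2 hk)),
        mul_nonneg ht'.le (sub_nonneg.2 ((hy a ha).2 hk))]
    · obtain ⟨m, hm⟩ : ∃ m, m = t * x + t' * y := ⟨_, rfl⟩
      rw [← hm] at hs ⊢
      have e : t * (x - m) + t' * (y - m) = 0 := by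
        linear_combination hm.symm - m * htt
      by_cases hk : m ∈ k
      · have h1 := (hx m hs).1 hk
        have h2 := (hy m hs).1 hk
        constructor <;> nlinarith [mul_nonneg ht.le (sub_nonneg.2 h1), mul_nonneg ht'.le (sub_nonneg.2 h2)]
      · have h1 := (hx m hs).2 hk
        have h2 := (hy m hs).2 hk
        constructor <;> nlinarith [mul_nonneg ht.le (sub_nonneg.2 h1), mul_nonneg ht'.le (sub_nonneg.2 h2)]
  rw [convex_iff_forall_pos]
  intro z hz w hw t t' ht ht' htt
  obtain ⟨h1, h2⟩ := key ht ht' htt hz.2.1 hw.2.1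
  obtain ⟨h3, h4⟩ := key ht ht' htt hz.2.2 hw.2.2
  have er : (t • z + t' • w).re = t * z.re + t' * w.re := by simp
  have ei : (t • z + t' • w).im = t * z.im + t' * w.im := by simp
  refine ⟨fun h => hz.1 ?_, by rwa [er], by rwa [ei]⟩
  have hh1 := h2 (er ▸ h.1)
  have hh2 := h4 (ei ▸ h.2)
  exact ⟨by rw [hh1.1]; exact er ▸ h.1, by rw [hh2.1]; exact ei ▸ h.2⟩

/-- The square of half side `5 / 8 * r` contains the disc of radius `r / 2`, and its corners are at
distance `5 / 8 * √2 * r < r`. -/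
theorem cell_subset_ball {c : ℂ} {r : ℝ} (hr : 0 < r)
    (h1 : c.re - 5 / 8 * r ∈ G.re) (h2 : c.re + 5 / 8 * r ∈ G.re)
    (h3 : c.im - 5 / 8 * r ∈ G.im) (h4 : c.im + 5 / 8 * r ∈ G.im) {x : ℂ}
    (hx : x ∈ Metric.ball c (r / 2)) : G.cell (G.label x) ⊆ Metric.ball c r := by
  intro z hz
  have hx' : ‖x - c‖ < r / 2 := by rwa [← dist_eq_norm]
  have hre := abs_lt.1 ((Complex.abs_re_le_norm (x - c)).trans_lt hx')
  have him := abs_lt.1 ((Complex.abs_im_le_norm (x - c)).trans_lt hx')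
  rw [Complex.sub_re] at hre
  rw [Complex.sub_im] at him
  have a1 := (hz.2.1 _ h1).1 (Finset.mem_filter.2 ⟨h1, by linarith⟩)
  have a2 := (hz.2.1 _ h2).2 (fun h => by linarith [(Finset.mem_filter.1 h).2])
  have a3 := (hz.2.2 _ h3).1 (Finset.mem_filter.2 ⟨h3, by linarith⟩)
  have a4 := (hz.2.2 _ h4).2 (fun h => by linarith [(Finset.mem_filter.1 h).2])
  rw [Metric.mem_ball, dist_eq_norm, ← sq_lt_sq₀ (norm_nonneg _) hr.le, Complex.sq_norm,
    Complex.normSq_apply, Complex.sub_re, Complex.sub_im]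
  nlinarith [mul_nonneg (sub_nonneg.2 a1) (sub_nonneg.2 a2),
    mul_nonneg (sub_nonneg.2 a3) (sub_nonneg.2 a4)]

end Grid

/-! ### Finite coverings containing a finite family of cones -/

section Cells

variable {X : Type u} [TopologicalSpace X] [T2Space X] {π : X → ℂ}

/-- The subset `Y` is the image of a section of `π` over the cell with label `k`. -/
def IsLiftedCell (G : Grid) (π : X → ℂ) (k : Finset ℝ × Finset ℝ) (Y : Set X) : Prop :=
  ∃ σ : ℂ → X, ContinuousOn σ (G.cell k) ∧ (∀ z ∈ G.cell k, π (σ z) = z) ∧ Y = σ '' G.cell k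

/-- The two cells are convex, so sections over them that meet agree on the connected intersection.
This makes adjacency of lifted cells a partial injection. -/
theorem IsLocalHomeomorph.liftedCell_unique (hπ : IsLocalHomeomorph π) {G : Grid}
    {k k' : Finset ℝ × Finset ℝ} {Y Y₁ Y₂ : Set X} (h : IsLiftedCell G π k Y)
    (h₁ : IsLiftedCell G π k' Y₁) (h₂ : IsLiftedCell G π k' Y₂) (n₁ : (Y ∩ Y₁).Nonempty)
    (n₂ : (Y ∩ Y₂).Nonempty) : Y₁ = Y₂ := by
  obtain ⟨τ, ct, pt, rfl⟩ := h
  obtain ⟨σ₁, c₁, p₁, rfl⟩ := h₁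
  obtain ⟨σ₂, c₂, p₂, rfl⟩ := h₂
  have hconv := (G.convex_cell k).inter (G.convex_cell k')
  have key : ∀ {σ : ℂ → X}, ContinuousOn σ (G.cell k') →
      (∀ z ∈ G.cell k', π (σ z) = z) → (τ '' G.cell k ∩ σ '' G.cell k').Nonempty →
      (G.cell k ∩ G.cell k').Nonempty ∧ EqOn τ σ (G.cell k ∩ G.cell k') := by
    rintro σ cs ps ⟨_, ⟨z, hz, rfl⟩, ⟨w, hw, he⟩⟩
    have hzw : w = z := by rw [← ps w hw, he, pt z hz]
    subst hzw
    exact ⟨⟨w, hz, hw⟩, hπ.eqOn_section hconv.isPreconnected (ct.mono inter_subset_left)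
      (cs.mono inter_subset_right) (fun z hz => pt z hz.1) (fun z hz => ps z hz.2) ⟨hz, hw⟩ he.symm⟩
  obtain ⟨⟨z, hz⟩, e₁⟩ := key c₁ p₁ n₁
  obtain ⟨-, e₂⟩ := key c₂ p₂ n₂
  exact (hπ.eqOn_section (G.convex_cell k').isPreconnected c₁ c₂ p₁ p₂ hz.2
    ((e₁ hz).symm.trans (e₂ hz))).image_eq

end Cells

/-- Some rotation gives pairwise distinct real parts to the points of a given finite set. -/
theorem exists_rotation_injOn_re {N : Set ℂ} (hN : N.Finite) :
    ∃ θ : ℂ, ‖θ‖ = 1 ∧ InjOn (fun z => (θ * z).re) N := by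
  have h1 : (⋃ z ∈ N, ⋃ w ∈ N, {t : ℝ | z ≠ w ∧ (z - w).re - t * (z - w).im = 0}).Finite := by
    refine hN.biUnion fun z _ => hN.biUnion fun w _ => Set.Subsingleton.finite ?_
    rintro t ⟨hne, ht⟩ t' ⟨-, ht'⟩
    have h2 : (t - t') * (z - w).im = 0 := by linear_combination ht' - ht
    rcases mul_eq_zero.1 h2 with h | h
    · exact sub_eq_zero.1 h
    · refine absurd (Complex.ext ?_ h) (sub_ne_zero.2 hne)
      rw [h, mul_zero, sub_zero] at ht
      exact ht
  obtain ⟨t, ht⟩ := h1.infinite_compl.nonempty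
  have hd : (1 + t * Complex.I : ℂ) ≠ 0 := fun h => by simpa using congrArg Complex.re h
  have hn : ‖(1 + t * Complex.I : ℂ)‖ ≠ 0 := norm_ne_zero_iff.2 hd
  refine ⟨(‖(1 + t * Complex.I : ℂ)‖⁻¹ : ℝ) * (1 + t * Complex.I), ?_, fun z hz w hw h => ?_⟩
  · rw [norm_mul, Complex.norm_real, norm_inv, norm_norm, inv_mul_cancel₀ hn]
  · by_contra hne
    refine ht (mem_iUnion₂.2 ⟨z, hz, mem_iUnion₂.2 ⟨w, hw, hne, ?_⟩⟩)
    simp only [mul_assoc, Complex.re_ofReal_mul] at h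
    have h3 := mul_left_cancel₀ (inv_ne_zero hn) h
    simp at h3
    simp only [Complex.sub_re, Complex.sub_im]
    linarith

section Cells

variable {X : Type u} [TopologicalSpace X] [T2Space X] {π : X → ℂ}

/-- The part of the cone `W` that lies over the disc of half the radius. -/
def halfCone (π : X → ℂ) (ξ : FlatCompletion π) (r : ℝ) (W : Set X) : Set X :=
  W ∩ π ⁻¹' Metric.ball (flatExtension π ξ) (r / 2)

theorem IsFiniteCone.exists_liftedCell {ξ : FlatCompletion π} {r : ℝ} {W : Set X}
    (h : IsFiniteCone π ξ r W) {G : Grid} {k : Finset ℝ × Finset ℝ}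
    (hG : G.cell k ⊆ Metric.ball (flatExtension π ξ) r) (hξ : flatExtension π ξ ∈ G.vertices)
    {x : X} (hx : x ∈ W) (hxk : π x ∈ G.cell k) :
    ∃ Y, IsLiftedCell G π k Y ∧ x ∈ Y ∧ Y ⊆ W := by
  obtain ⟨σ, h1, h2, h3, h4⟩ := h.exists_section (G.convex_cell k)
    (fun z hz => ⟨hG hz, fun he => hz.1 (by rw [mem_singleton_iff.1 he]; exact hξ)⟩) hx hxk
  exact ⟨_, ⟨σ, h1, h2, rfl⟩, ⟨_, hxk, h3⟩, image_subset_iff.2 h4⟩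

/-- Such a lift lies inside `W` and is determined by its point over one `z₀` of the cell, which
belongs to a finite fibre of the cone. -/
theorem IsFiniteCone.finite_liftedCell (hπ : IsLocalHomeomorph π) {ξ : FlatCompletion π} {r : ℝ}
    {W : Set X} (h : IsFiniteCone π ξ r W) {G : Grid} {k : Finset ℝ × Finset ℝ}
    (hG : G.cell k ⊆ Metric.ball (flatExtension π ξ) r) (hξ : flatExtension π ξ ∈ G.vertices) :
    {Y | IsLiftedCell G π k Y ∧ (Y ∩ W).Nonempty}.Finite := by
  rcases (G.cell k).eq_empty_or_nonempty with he | ⟨z₀, hz₀⟩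
  · convert finite_empty
    refine eq_empty_of_forall_notMem ?_
    rintro _ ⟨⟨σ, -, -, rfl⟩, hne⟩
    simp [he] at hne
  · refine ((h.finite_fiber z₀).biUnion (t := fun y => {Y | IsLiftedCell G π k Y ∧ y ∈ Y})
      fun y _ => Set.Subsingleton.finite ?_).subset ?_
    · rintro Y₁ ⟨h₁, m₁⟩ Y₂ ⟨h₂, m₂⟩
      exact hπ.liftedCell_unique h₁ h₁ h₂ ⟨y, m₁, m₁⟩ ⟨y, m₁, m₂⟩
    · rintro Y ⟨hY, x, hxY, hxW⟩
      have hxk : π x ∈ G.cell k := by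
        obtain ⟨σ, -, h2, rfl⟩ := hY
        obtain ⟨z, hz, rfl⟩ := hxY
        rwa [h2 z hz]
      obtain ⟨Y', hY', hx', hs⟩ := h.exists_liftedCell hG hξ hxW hxk
      obtain rfl := hπ.liftedCell_unique hY' hY' hY ⟨x, hx', hx'⟩ ⟨x, hx', hxY⟩
      obtain ⟨σ, h1, h2, rfl⟩ := hY
      exact mem_biUnion (x := σ z₀) ⟨hs ⟨z₀, hz₀, rfl⟩, h2 z₀ hz₀⟩
        ⟨⟨σ, h1, h2, rfl⟩, z₀, hz₀, rfl⟩

/-- Away from finitely many fibres, a finite union of half cones embeds into a finite branched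
covering of the plane. -/
theorem exists_slitData_of_halfCones (hπ : IsLocalHomeomorph π) {ι : Type*} [Finite ι]
    {ξ : ι → FlatCompletion π} {r : ι → ℝ} {W : ι → Set X}
    (h : ∀ j, IsFiniteCone π (ξ j) (r j) (W j)) :
    ∃ (N : Set ℂ) (θ : ℂ) (I : Type u) (_ : Finite I) (D : SlitData I)
      (φ : ↥((⋃ j, halfCone π (ξ j) (r j) (W j)) \ π ⁻¹' N) → D.Space),
      N.Finite ∧ (∀ j, flatExtension π (ξ j) ∈ N) ∧ ‖θ‖ = 1 ∧
      Continuous φ ∧ Function.Injective φ ∧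
      ∀ x, D.pr (φ x) = θ * π x := by
  classical
  cases nonempty_fintype ι
  let c : ι → ℂ := fun j => flatExtension π (ξ j)
  -- The lines through the apex make its projection a vertex. The lines at distance `5 / 8 * r`
  -- confine to the full disc the cells that meet the half disc, so these cells lift into the cone.
  let G : Grid :=
    { re := Finset.univ.biUnion fun j =>
        {(c j).re - 5 / 8 * r j, (c j).re, (c j).re + 5 / 8 * r j}
      im := Finset.univ.biUnion fun j =>
        {(c j).im - 5 / 8 * r j, (c j).im, (c j).im + 5 / 8 * r j} }
  have hc : ∀ j, c j ∈ G.vertices := fun j =>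
    ⟨Finset.mem_biUnion.2 ⟨j, Finset.mem_univ _, by simp⟩,
      Finset.mem_biUnion.2 ⟨j, Finset.mem_univ _, by simp⟩⟩
  have hG : ∀ j, ∀ z ∈ Metric.ball (c j) (r j / 2), G.cell (G.label z) ⊆ Metric.ball (c j) (r j) :=
    fun j z hz => G.cell_subset_ball (h j).pos
      (Finset.mem_biUnion.2 ⟨j, Finset.mem_univ _, by simp⟩)
      (Finset.mem_biUnion.2 ⟨j, Finset.mem_univ _, by simp⟩)
      (Finset.mem_biUnion.2 ⟨j, Finset.mem_univ _, by simp⟩)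
      (Finset.mem_biUnion.2 ⟨j, Finset.mem_univ _, by simp⟩) hz
  -- The sheets of the covering to be built: all lifted cells, over whatever label, that carry a
  -- point of some half cone with that label.
  let L : Set ((Finset ℝ × Finset ℝ) × Set X) := {q | IsLiftedCell G π q.1 q.2 ∧
    ∃ x ∈ q.2, G.label (π x) = q.1 ∧ ∃ j, x ∈ halfCone π (ξ j) (r j) (W j)}
  have hL : L.Finite := by
    have h1 : (⋃ j, ⋃ k ∈ {k | k ∈ (G.re.powerset ×ˢ G.im.powerset : Finset _) ∧
        G.cell k ⊆ Metric.ball (c j) (r j)}, Prod.mk k ''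
        {Y | IsLiftedCell G π k Y ∧ (Y ∩ W j).Nonempty}).Finite := by
      refine finite_iUnion fun j => Set.Finite.biUnion
        ((Finset.finite_toSet (G.re.powerset ×ˢ G.im.powerset)).subset fun k hk => hk.1)
        fun k hk => ((h j).finite_liftedCell hπ hk.2 (hc j)).image _
    refine h1.subset ?_
    rintro ⟨k, Y⟩ ⟨hY, x, hx, hk, j, hj⟩
    obtain rfl : G.label (π x) = k := hk
    exact mem_iUnion.2 ⟨j, mem_biUnion (x := G.label (π x)) ⟨G.label_mem _, hG j _ hj.2⟩
      ⟨Y, ⟨hY, x, hx, hj.1⟩, rfl⟩⟩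
  have : Finite L := hL
  let R : (Finset ℝ × Finset ℝ) → (Finset ℝ × Finset ℝ) → L → L → Prop := fun k k' f g =>
    f.1.1 = k ∧ g.1.1 = k' ∧ (f.1.2 ∩ g.1.2).Nonempty
  have hR : ∀ k k', ∃ τ : Equiv.Perm L, ∀ f g, R k k' f g → τ f = g := by
    intro k k'
    refine exists_perm_extending _ ?_ ?_
    · rintro ⟨⟨k, Y⟩, hY⟩ ⟨⟨k₁, Y₁⟩, h₁⟩ ⟨⟨k₂, Y₂⟩, h₂⟩ ⟨rfl, rfl, n₁⟩ ⟨-, e, n₂⟩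
      obtain rfl : k₂ = k₁ := e
      obtain rfl : Y₁ = Y₂ := hπ.liftedCell_unique hY.1 h₁.1 h₂.1 n₁ n₂
      rfl
    · rintro ⟨⟨k₁, Y₁⟩, h₁⟩ ⟨⟨k₂, Y₂⟩, h₂⟩ ⟨⟨k, Y⟩, hY⟩ ⟨rfl, rfl, n₁⟩ ⟨e, -, n₂⟩
      obtain rfl : k₂ = k₁ := e
      rw [inter_comm] at n₁ n₂
      obtain rfl : Y₁ = Y₂ := hπ.liftedCell_unique hY.1 h₁.1 h₂.1 n₁ n₂
      rfl
  choose τ hτ using hR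
  -- The diagonal has to be the identity. This is consistent with `R`, since two lifts of the same
  -- cell that meet are equal.
  let T : (Finset ℝ × Finset ℝ) → (Finset ℝ × Finset ℝ) → Equiv.Perm L := fun k k' =>
    if k = k' then 1 else τ k k'
  have hT : ∀ k k' f g, R k k' f g → T k k' f = g := by
    intro k k' f g hfg
    by_cases hk : k = k'
    · subst hk
      obtain ⟨⟨k₁, Y₁⟩, h₁⟩ := f
      obtain ⟨⟨k₂, Y₂⟩, h₂⟩ := g
      obtain ⟨rfl, e, n⟩ := hfg
      obtain rfl : k₂ = k₁ := e
      obtain rfl : Y₁ = Y₂ := hπ.liftedCell_unique h₁.1 h₁.1 h₂.1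
        (by rw [inter_self]; exact n.left) n
      simp [T]
    · simp only [T, if_neg hk]
      exact hτ k k' f g hfg
  have hclosed : IsClosed G.vertices := G.finite_vertices.isClosed
  obtain ⟨E, tE, p, mk, hp, hpmk, hmk, hfib, hcont⟩ := exists_isCoveringMap_of_cells.{u}
    (B := ↥(G.verticesᶜ)) (fun b => G.label b) (fun b => Subtype.val ⁻¹' G.star b)
    (fun b => (G.isOpen_star b).preimage continuous_subtype_val) (fun b => G.mem_star_self b)
    (fun b b' x hx => (G.label_eq_of_mem_star b.2 b'.2 hx.1 hx.2).imp_right fun h =>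
      continuous_subtype_val.continuousAt.eventually h) T (fun k => if_pos rfl)
  -- Slit data allow one node over each abscissa, whereas grid vertices share real parts; a rotation
  -- separates them.
  obtain ⟨θ, hθ, hinj⟩ := exists_rotation_injOn_re G.finite_vertices
  have hθ0 : θ ≠ 0 := norm_ne_zero_iff.1 (by rw [hθ]; exact one_ne_zero)
  let g := Homeomorph.mulLeft₀ θ hθ0
  have hcov : IsCoveringMapOn (g ∘ fun e => (p e : ℂ)) (g '' G.vertices)ᶜ := by
    have h1 : IsCoveringMapOn (fun e => (p e : ℂ)) G.verticesᶜ :=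
      IsCoveringMapOn.of_isCoveringMap_subtype hclosed.isOpen_compl (fun e => (p e).2) hp
    refine (h1.homeomorph_comp g).mono ?_
    intro z hz hz'
    exact hz ⟨_, hz', g.apply_symm_apply z⟩
  obtain ⟨I, hI, D, Φ, hΦ, hΦi, hΦp⟩ := exists_slitData_of_isCoveringMapOn
    (G.finite_vertices.image g) (by
      rintro _ ⟨z, hz, rfl⟩ _ ⟨w, hw, rfl⟩ he
      exact congrArg g (hinj hz hw he)) hcov (by
      rintro e ⟨z, hz, he⟩
      exact (p e).2 ((g.injective he : z = p e) ▸ hz)) (by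
      intro z
      by_cases hz : g.symm z ∈ G.vertices
      · convert finite_empty
        refine eq_empty_of_forall_notMem ?_
        rintro e rfl
        exact (p e).2 (by simpa using hz)
      · refine (finite_range (mk ⟨_, hz⟩)).subset ?_
        rintro e rfl
        rw [← hfib]
        exact Subtype.ext (by simp))
  let U : Set X := (⋃ j, halfCone π (ξ j) (r j) (W j)) \ π ⁻¹' G.vertices
  have hf : ∀ x : U, ∃ f : L, f.1.1 = G.label (π x) ∧ (x : X) ∈ f.1.2 := by
    rintro ⟨x, hx, hxN⟩
    obtain ⟨j, hj⟩ := mem_iUnion.1 hx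
    obtain ⟨Y, h1, h2, -⟩ := (h j).exists_liftedCell (hG j _ hj.2) (hc j) hj.1
      (G.mem_cell_label hxN)
    exact ⟨⟨⟨G.label (π x), Y⟩, h1, x, h2, rfl, j, hj⟩, rfl, h2⟩
  choose f hf1 hf2 using hf
  let b : U → ↥(G.verticesᶜ) := fun x => ⟨π x, x.2.2⟩
  have hbc : Continuous b := (hπ.continuous.comp continuous_subtype_val).subtype_mk _
  refine ⟨G.vertices, θ, I, hI, D, fun x => Φ (mk (b x) (f x)), G.finite_vertices, hc, hθ,
    hΦ.comp (hcont b f hbc fun x => ?_), fun x y hxy => ?_, fun x => ?_⟩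
  · obtain ⟨ρ, hρ, σ, s1, s2, s3, -⟩ := hπ.exists_disc (x : X) univ_mem
    have hb := Metric.ball_mem_nhds (π x) hρ
    have h4 := hπ.eventually_eq_section (s1.continuousAt hb) s3
      (by filter_upwards [hb] with z hz using s2 z hz)
    have hpc : Continuous fun y : U => π y := hπ.continuous.comp continuous_subtype_val
    filter_upwards [continuous_subtype_val.continuousAt.eventually h4,
      hpc.continuousAt.eventually_mem hb,
      hpc.continuousAt.eventually_mem ((G.isOpen_star (π x)).mem_nhds (G.mem_star_self _))]
      with y hy1 hy2 hy3
    -- The lifted cell of a nearby `y` contains `x` as well, because the closed cell of `π y`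
    -- contains `π x`; so the two lifted cells are matched by the transition.
    refine hT _ _ _ _ ⟨hf1 x, hf1 y, x, hf2 x, ?_⟩
    have hfy := (f y).2.1
    rw [hf1 y] at hfy
    obtain ⟨τ', t1, t2, hY⟩ := hfy
    have hm := hf2 y
    rw [hY] at hm ⊢
    obtain ⟨w, hw, hwy⟩ := hm
    have hwy' : w = π y := by rw [← hwy, t2 w hw]
    subst hwy'
    have hx := G.mem_cell_of_mem_star x.2.2 hy3
    refine ⟨π x, hx, ?_⟩
    have := hπ.eqOn_section ((G.convex_cell _).inter (convex_ball (π x) ρ)).isPreconnected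
      (t1.mono inter_subset_left) (s1.mono inter_subset_right) (fun z hz => t2 z hz.1)
      (fun z hz => s2 z hz.2) ⟨hw, hy2⟩ (hwy.trans hy1.symm) ⟨hx, Metric.mem_ball_self hρ⟩
    rw [this, s3]
  · have h1 := hΦi hxy
    have h2 : b x = b y := by rw [← hpmk (b x) (f x), h1, hpmk]
    rw [h2] at h1
    have h3 : f x = f y := hmk _ h1
    obtain ⟨σ, -, s2, hY⟩ := (f x).2.1
    have hx := hf2 x
    have hy := hf2 y
    rw [← h3] at hy
    rw [hY] at hx hy
    obtain ⟨z, hz, hzx⟩ := hx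
    obtain ⟨w, hw, hwy⟩ := hy
    have h5 : π x = π y := congrArg Subtype.val h2
    rw [← hzx, ← hwy, s2 z hz, s2 w hw] at h5
    exact Subtype.ext (by rw [← hzx, ← hwy, h5])
  · change D.pr (Φ _) = _
    rw [hΦp]
    change θ * (p _ : ℂ) = _
    rw [hpmk]

end Cells

namespace SlitData

variable {I : Type u} {D : SlitData I} {θ : ℂ}

theorem exists_section_reg {A : Set ℂ} (hA : A.Nonempty) {f : ℂ → D.Space} (hf : ContinuousOn f A)
    (hfr : ∀ z ∈ A, f z ∈ D.reg) :
    ∃ g : ℂ → D.reg, ContinuousOn g A ∧ ∀ z ∈ A, (g z : D.Space) = f z := by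
  classical
  obtain ⟨z₀, hz₀⟩ := hA
  have h : ∀ z ∈ A, ((if h : f z ∈ D.reg then ⟨f z, h⟩ else ⟨f z₀, hfr z₀ hz₀⟩ : D.reg) : D.Space) =
      f z := fun z hz => by rw [dif_pos (hfr z hz)]
  refine ⟨_, ?_, h⟩
  rw [Topology.IsInducing.subtypeVal.continuousOn_iff]
  exact hf.congr h

variable (hθ : ‖θ‖ = 1) [Finite I]
include hθ

theorem eqOn_section {A : Set ℂ} (hA : IsPreconnected A) {f f' : ℂ → D.Space}
    (hf : ContinuousOn f A) (hf' : ContinuousOn f' A) (hr : ∀ z ∈ A, f z ∈ D.reg)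
    (hr' : ∀ z ∈ A, f' z ∈ D.reg) (hp : ∀ z ∈ A, D.proj θ (f z) = z)
    (hp' : ∀ z ∈ A, D.proj θ (f' z) = z) {z : ℂ} (hz : z ∈ A) (h : f z = f' z) : EqOn f f' A := by
  obtain ⟨g, hg, e⟩ := exists_section_reg ⟨z, hz⟩ hf hr
  obtain ⟨g', hg', e'⟩ := exists_section_reg ⟨z, hz⟩ hf' hr'
  have := (D.isLocalHomeomorph_proj hθ).eqOn_section hA hg hg'
    (fun w hw => by rw [Function.comp_apply, e w hw, hp w hw])
    (fun w hw => by rw [Function.comp_apply, e' w hw, hp' w hw]) hz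
    (Subtype.ext (by rw [e z hz, e' z hz, h]))
  intro w hw
  rw [← e w hw, ← e' w hw, this hw]

/-- A point through which there is a section is regular. -/
theorem isReg_of_section {v : ℂ} {ρ : ℝ} (hρ : 0 < ρ) {f : ℂ → D.Space}
    (hf : ContinuousOn f (Metric.ball v ρ)) (hp : ∀ z ∈ Metric.ball v ρ, D.proj θ (f z) = z) :
    D.IsReg (f v) := by
  by_contra hreg
  obtain ⟨⟨w, i⟩, hw⟩ : ∃ q : ℂ × I, f v = D.pt q.1 q.2 := by
    induction f v using D.ind with | _ z i => exact ⟨(z, i), rfl⟩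
  simp only at hw
  have hwv : θ * w = v := by
    have := hp v (Metric.mem_ball_self hρ)
    rw [hw] at this
    exact this
  rw [hw] at hreg
  have hwn : w.im = D.height w.re := by_contra fun h => hreg (D.isReg_of_ne_height h i)
  obtain ⟨r₁, hg₁⟩ := D.exists_good w
  have hr0 : 0 < min r₁ ρ := lt_min hg₁.1 hρ
  have hg := hg₁.mono hr0 (min_le_left _ _)
  set r := min r₁ ρ with hr
  have hsub : Metric.ball v r ⊆ Metric.ball v ρ := Metric.ball_subset_ball (min_le_right _ _)
  have hpr : ∀ z ∈ Metric.ball v r, dist (D.pr (f z)) w < r := by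
    intro z hz
    rw [← dist_mul_unit hθ, hwv]
    have := hp z (hsub hz)
    rw [proj] at this
    rwa [this]
  have hcone : ∀ z ∈ Metric.ball v r, f z ∈ D.cone w i r := by
    intro z hz
    refine hg.subset_cone (((convex_ball v r).isPreconnected.image f (hf.mono hsub))) ?_
      ⟨v, Metric.mem_ball_self hr0, rfl⟩ (hw ▸ D.mem_cone_self hr0 i) ⟨z, hz, rfl⟩
    rintro _ ⟨z, hz, rfl⟩
    exact hpr z hz
  have hfreg : ∀ z ∈ Metric.ball v r \ {v}, f z ∈ D.reg := by
    rintro z ⟨hz, hzv⟩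
    have h1 := hpr z hz
    have h2 := hp z (hsub hz)
    generalize f z = q at h1 h2
    induction q using D.ind with | _ z' k =>
    refine hg.isReg h1 ?_ k
    rintro rfl
    exact hzv (h2.symm.trans hwv)
  have hv : (Metric.ball v r \ {v}).Nonempty := (isConnected_ball_diff_center v hr0).nonempty
  obtain ⟨g, hgc, hge⟩ := exists_section_reg hv (hf.mono (sdiff_subset.trans hsub)) hfreg
  obtain ⟨z₁, hz₁⟩ := hv
  have hP : IsPreconnected ((↑) ⁻¹' D.cone w i r : Set D.reg) := by
    have h1 := (hg.isPathConnected_puncturedCone hwn hreg).isConnected.isPreconnected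
    rw [← Topology.IsInducing.subtypeVal.isPreconnected_image, image_preimage_eq_inter_range,
      Subtype.range_coe]
    exact h1
  have hPA : ∀ y ∈ ((↑) ⁻¹' D.cone w i r : Set D.reg),
      (D.proj θ ∘ ((↑) : D.reg → D.Space)) y ∈ Metric.ball v r \ {v} := by
    rintro ⟨y, hy⟩ hyc
    change y ∈ D.cone w i r at hyc
    induction y using D.ind with | _ z' k =>
    obtain ⟨h1, h2, h3⟩ := (hg.mem_puncturedCone hreg).1 ⟨hyc, hy⟩
    refine ⟨?_, fun h => h3 ?_⟩
    · rw [Metric.mem_ball, ← hwv]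
      change dist (θ * z') (θ * w) < r
      rwa [dist_mul_unit hθ]
    · exact mul_left_cancel₀ (unit_ne_zero hθ) ((mem_singleton_iff.1 h).trans hwv.symm)
  -- The punctured cone is connected, so the section over the punctured disc exhausts it. Its fibres
  -- are then single points, which leaves room for only one sheet in the cycle.
  have key := (D.isLocalHomeomorph_proj hθ).subset_image_section hgc
    (fun z hz => by rw [Function.comp_apply, hge z hz, hp z (hsub hz.1)]) hP hPA
    (x := g z₁) (by rw [mem_preimage, hge z₁ hz₁]; exact hcone z₁ hz₁.1)
    (by rw [Function.comp_apply, hge z₁ hz₁, hp z₁ (hsub hz₁.1)])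
  refine hreg (D.isReg_pt.2 fun k hk => ?_)
  have hz2 : θ⁻¹ * z₁ ≠ w := fun h => hz₁.2 (by
    rw [mem_singleton_iff, ← hwv, ← h, mul_inv_cancel_left₀ (unit_ne_zero hθ)])
  have hz3 : dist (θ⁻¹ * z₁) w < r := by
    rw [← dist_mul_unit hθ, mul_inv_cancel_left₀ (unit_ne_zero hθ), hwv]; exact hz₁.1
  have hm1 := (hg.mem_puncturedCone hreg).2 ⟨hz3, (D.rel_node hwn).2 (.refl _ i), hz2⟩
  have hm2 := (hg.mem_puncturedCone hreg).2 ⟨hz3, (D.rel_node hwn).2 ((D.rel_node hwn).1 hk), hz2⟩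
  have e1 := key ⟨_, hm1.2⟩ hm1.1
  have e2 := key ⟨_, hm2.2⟩ hm2.1
  exact hg.eq_of_rel hz3 hz2 (D.pt_eq_pt'.1 (congrArg Subtype.val (e1.symm.trans e2)))

end SlitData

/-! ### Compact sets of the finite completion map to finite branched coverings -/

section Extension

variable {X : Type u} [TopologicalSpace X] [T2Space X] {π : X → ℂ}

/-- Apex and surface points are treated alike: both have arbitrarily small connected punctured
neighbourhoods, on which limits of maps to a branched covering can be tested. -/
theorem IsFiniteCone.exists_small_cones (hπ : IsLocalHomeomorph π) {ξ : FlatCompletion π} {r : ℝ}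
    {W : Set X} (h : IsFiniteCone π ξ r W) {η : FlatCompletion π}
    (hη : η ∈ insert ξ (toFlatCompletion π '' halfCone π ξ r W)) :
    ∃ ρ₀ > 0, ∃ P : ℝ → Set X, ∀ ρ, 0 < ρ → ρ ≤ ρ₀ → IsConnected (P ρ) ∧
      IsOpen (insert η (toFlatCompletion π '' P ρ)) ∧ P ρ ⊆ halfCone π ξ r W ∧
      ∀ x ∈ P ρ, dist (π x) (flatExtension π η) < ρ ∧ π x ≠ flatExtension π η := by
  have key : ∀ {ξ : FlatCompletion π} {r : ℝ} {W : Set X}, IsFiniteCone π ξ r W → ∀ ρ, 0 < ρ →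
      ρ ≤ r → IsConnected (W ∩ π ⁻¹' Metric.ball (flatExtension π ξ) ρ) ∧
      IsOpen (insert ξ (toFlatCompletion π '' (W ∩ π ⁻¹' Metric.ball (flatExtension π ξ) ρ))) ∧
      ∀ x ∈ W ∩ π ⁻¹' Metric.ball (flatExtension π ξ) ρ,
        dist (π x) (flatExtension π ξ) < ρ ∧ π x ≠ flatExtension π ξ := fun h ρ h0 hr =>
    ⟨h.isConnected_inter h0 hr, h.isOpen_insert_inter ρ h0,
      fun x hx => ⟨hx.2, fun he => (h.mapsTo hx.1).2 he⟩⟩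
  rcases hη with rfl | ⟨x, hx, rfl⟩
  · refine ⟨r / 2, half_pos h.pos, fun ρ => W ∩ π ⁻¹' Metric.ball (flatExtension π η) ρ,
      fun ρ h0 hr => ?_⟩
    obtain ⟨h1, h2, h3⟩ := key h ρ h0 (hr.trans (half_le_self h.pos.le))
    exact ⟨h1, h2, fun x hx => ⟨hx.1, lt_of_lt_of_le hx.2 hr⟩, h3⟩
  · have hO : IsOpen (halfCone π ξ r W) :=
      (h.isOpen hπ).inter (Metric.isOpen_ball.preimage hπ.continuous)
    obtain ⟨r', W', h', hW'⟩ := hπ.exists_isFiniteCone x (hO.mem_nhds hx)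
    refine ⟨r', h'.pos, 
      fun ρ => W' ∩ π ⁻¹' Metric.ball (flatExtension π (toFlatCompletion π x)) ρ, fun ρ h0 hr => ?_⟩
    obtain ⟨h1, h2, h3⟩ := key h' ρ h0 hr
    exact ⟨h1, h2, fun x hx => hW' hx.1, h3⟩

/-- A compact set of cone points of finite order has a neighbourhood with a map to a finite branched
covering of the plane, which on the surface is injective with regular values. -/
theorem exists_slitData_of_isCompact (hπ : IsLocalHomeomorph π) {K : Set (FlatCompletion π)}
    (hK : IsCompact K) (hne : K.Nonempty) (hcone : ∀ ξ ∈ K, ∃ r W, IsFiniteCone π ξ r W) :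
    ∃ (O : Set (FlatCompletion π)) (θ : ℂ) (I : Type u) (_ : Finite I) (D : SlitData I)
      (φ : FlatCompletion π → D.Space), IsOpen O ∧ K ⊆ O ∧ ‖θ‖ = 1 ∧ ContinuousOn φ O ∧
      (∀ η ∈ O, D.proj θ (φ η) = flatExtension π η) ∧
      (∀ x, toFlatCompletion π x ∈ O → D.IsReg (φ (toFlatCompletion π x))) ∧
      InjOn (φ ∘ toFlatCompletion π) (toFlatCompletion π ⁻¹' O) := by
  classical
  have hj := hπ.isOpenEmbedding_toFlatCompletion
  choose! r W hW using hcone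
  obtain ⟨t, hcov⟩ := hK.elim_nhds_subcover'
    (fun ξ _ => insert ξ (toFlatCompletion π '' halfCone π ξ (r ξ) (W ξ)))
    (fun ξ hξ => ((hW ξ hξ).isOpen_insert_inter _ (half_pos (hW ξ hξ).pos)).mem_nhds
      (mem_insert _ _))
  have key := exists_slitData_of_halfCones hπ (ι := t) (fun j => hW j.1 j.1.2)
  obtain ⟨B, hB⟩ : ∃ B, B = ⋃ j : t, halfCone π (j : K) (r j) (W j) := ⟨_, rfl⟩
  rw [← hB] at key
  obtain ⟨N, ϑ, I, hI, D, φ, hN, hξN, hϑ, hφc, hφi, hφp⟩ := key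
  have hϑ0 : ϑ ≠ 0 := SlitData.unit_ne_zero hϑ
  -- The map `φ` projects to `ϑ * π`; the inverse rotation restores `π`.
  have hθ : ‖ϑ⁻¹‖ = 1 := by rw [norm_inv, hϑ, inv_one]
  set O : Set (FlatCompletion π) :=
    ⋃ j : t, insert ((j : K) : FlatCompletion π) (toFlatCompletion π '' halfCone π (j : K) (r j) (W j)) with hO
  have hOo : IsOpen O := isOpen_iUnion fun j =>
    (hW j.1 j.1.2).isOpen_insert_inter _ (half_pos (hW j.1 j.1.2).pos)
  have hKO : K ⊆ O := fun ξ hξ => by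
    obtain ⟨j, hj, h⟩ := mem_iUnion₂.1 (hcov hξ)
    exact mem_iUnion.2 ⟨⟨j, hj⟩, h⟩
  have hBO : ∀ x ∈ B, toFlatCompletion π x ∈ O := fun x hx => by
    obtain ⟨j, h⟩ := mem_iUnion.1 (hB ▸ hx)
    exact mem_iUnion.2 ⟨j, Or.inr ⟨x, h, rfl⟩⟩
  have hOB : ∀ η ∈ O, flatExtension π η ∉ N → ∃ x ∈ B, toFlatCompletion π x = η := fun η hη hn => by
    obtain ⟨j, rfl | ⟨x, hx, rfl⟩⟩ := mem_iUnion.1 hη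
    · exact absurd (hξN j) hn
    · exact ⟨x, hB ▸ mem_iUnion.2 ⟨j, hx⟩, rfl⟩
  let i : ↥(B \ π ⁻¹' N) → O := fun a => ⟨toFlatCompletion π a, hBO a a.2.1⟩
  have hi : IsDenseInducing i := by
    refine ⟨?_, ?_⟩
    · refine IsInducing.of_comp (g := Subtype.val) ?_ continuous_subtype_val ?_
      · exact (hj.continuous.comp continuous_subtype_val).subtype_mk _
      · exact hj.isInducing.comp .subtypeVal
    · intro η
      rw [mem_closure_iff]
      rintro _ ⟨o, ho, rfl⟩ hη
      have hV : IsOpen (toFlatCompletion π ⁻¹' (o ∩ O)) := (ho.inter hOo).preimage hj.continuous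
      obtain ⟨_, hx₀, x₀, rfl⟩ := (UniformSpace.Completion.denseRange_coe (α := FlatSpace π)
        |>.inter_open_nonempty _ (ho.inter hOo) ⟨η, hη, η.2⟩)
      -- A nonempty open set of the surface has infinite projection, hence contains points outside
      -- the fibres over the finite set `N`.
      have hinf := infinite_of_mem_nhds _ ((hπ.isOpenMap _ hV).mem_nhds ⟨x₀, hx₀, rfl⟩)
      obtain ⟨_, ⟨x, hx, rfl⟩, hxN⟩ := hinf.exists_notMem_finite hN
      obtain ⟨y, hy, hxy⟩ := hOB _ hx.2 (by rwa [flatExtension_toFlatCompletion])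
      obtain rfl := hj.injective hxy
      exact ⟨i ⟨y, hy, hxN⟩, hx.1, ⟨_, rfl⟩⟩
  obtain ⟨ξ₀, hξ₀⟩ := hne
  have hlim : ∀ η, ∃ y, Tendsto φ (comap i (𝓝 η)) (𝓝 y) := by
    intro η
    by_cases hη : flatExtension π η ∈ N
    · obtain ⟨j, hηj⟩ := mem_iUnion.1 η.2
      obtain ⟨ρ₀, hρ₀, P, hP⟩ := (hW j.1 j.1.2).exists_small_cones hπ hηj
      set v := flatExtension π η with hv
      obtain ⟨ρ₁, hg₁⟩ := D.exists_good (ϑ * v)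
      obtain ⟨ρ₂, hρ₂, hN₂⟩ : ∃ ρ₂ > 0, ∀ z ∈ N, dist z v < ρ₂ → z = v := by
        obtain ⟨ρ₂, hρ₂, h⟩ := Metric.isOpen_iff.1 (hN.subset (sdiff_subset (t := {v}))).isClosed.isOpen_compl v
          (fun h => h.2 rfl)
        exact ⟨ρ₂, hρ₂, fun z hz hd => by_contra fun hne => h hd ⟨hz, hne⟩⟩
      set ρ := min ρ₀ (min ρ₁ ρ₂) with hρ
      have hρ0 : 0 < ρ := lt_min hρ₀ (lt_min hg₁.1 hρ₂)
      have hg := hg₁.mono hρ0 ((min_le_right _ _).trans (min_le_left _ _))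
      have hPA : ∀ ρ', 0 < ρ' → ρ' ≤ ρ → P ρ' ⊆ B \ π ⁻¹' N := by
        intro ρ' h0 hle x hx
        obtain ⟨-, -, h3, h4⟩ := hP ρ' h0 (hle.trans (min_le_left _ _))
        refine ⟨hB ▸ mem_iUnion.2 ⟨j, h3 hx⟩, fun hxN => (h4 x hx).2 (hN₂ _ hxN ?_)⟩
        exact (h4 x hx).1.trans_le (hle.trans ((min_le_right _ _).trans (min_le_right _ _)))
      have hd : ∀ a : ↥(B \ π ⁻¹' N), dist (D.pr (φ a)) (ϑ * v) = dist (π a) v := fun a => by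
        rw [hφp, SlitData.dist_mul_unit hϑ]
      obtain ⟨h1, h2, h3, h4⟩ := hP ρ hρ0 (min_le_left _ _)
      have hPc : IsPreconnected ((↑) ⁻¹' P ρ : Set ↥(B \ π ⁻¹' N)) := by
        rw [← Topology.IsInducing.subtypeVal.isPreconnected_image, image_preimage_eq_inter_range,
          Subtype.range_coe, inter_eq_left.2 (hPA ρ hρ0 le_rfl)]
        exact h1.isPreconnected
      obtain ⟨x₀, hx₀⟩ := h1.nonempty
      let a₀ : ↥(B \ π ⁻¹' N) := ⟨x₀, hPA ρ hρ0 le_rfl hx₀⟩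
      have hball : ∀ a : ↥(B \ π ⁻¹' N), (a : X) ∈ P ρ → φ a ∈ D.pr ⁻¹' Metric.ball (ϑ * v) ρ := by
        intro a ha
        rw [mem_preimage, Metric.mem_ball, hd]
        exact (h4 a ha).1
      have h5 := hball a₀ hx₀
      rw [D.preimage_ball] at h5
      obtain ⟨k, hk⟩ := mem_iUnion.1 h5
      -- The connected punctured neighbourhood is mapped into a single cone over the disc about `ϑ *
      -- v`; the apex of this cone is the limit.
      have hsub := hg.subset_cone (hPc.image φ hφc.continuousOn)
        (by rintro _ ⟨a, ha, rfl⟩; exact hball a ha) ⟨a₀, hx₀, rfl⟩ hk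
      refine ⟨D.pt (ϑ * v) k, ((D.nhds_hasBasis _ k).tendsto_right_iff).2 fun ρ' hρ' => ?_⟩
      have hρ'' : 0 < min ρ' ρ := lt_min hρ'.1 hρ0
      obtain ⟨-, o2, -, o4⟩ := hP (min ρ' ρ) hρ'' ((min_le_right _ _).trans (min_le_left _ _))
      have hev : ∀ᶠ a in comap i (𝓝 η), (i a : FlatCompletion π) ∈
          insert (η : FlatCompletion π) (toFlatCompletion π '' P (min ρ' ρ)) :=
        tendsto_comap.eventually
          (continuous_subtype_val.continuousAt.eventually_mem (o2.mem_nhds (mem_insert _ _)))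
      have hev2 : ∀ᶠ a in comap i (𝓝 η), (i a : FlatCompletion π) ∈
          insert (η : FlatCompletion π) (toFlatCompletion π '' P ρ) :=
        tendsto_comap.eventually
          (continuous_subtype_val.continuousAt.eventually_mem (h2.mem_nhds (mem_insert _ _)))
      have hmem : ∀ a ρ, (i a : FlatCompletion π) ∈ insert (η : FlatCompletion π)
          (toFlatCompletion π '' P ρ) → (a : X) ∈ P ρ := by
        rintro a ρ (he | ⟨x, hx, he⟩)
        · refine absurd ?_ a.2.2
          rw [mem_preimage, ← flatExtension_toFlatCompletion π a]
          exact (congrArg (flatExtension π) he).symm ▸ hη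
        · rwa [← hj.injective he]
      filter_upwards [hev, hev2] with a ha ha2
      have hc := hsub ⟨a, hmem a _ ha2, rfl⟩
      have hlt := (o4 a (hmem a _ ha)).1
      rw [← hd] at hlt
      generalize φ a = q at hc hlt
      induction q using D.ind with | _ z' k' =>
      exact hρ'.mem_cone.2 ⟨hlt.trans_le (min_le_left _ _), (hg.mem_cone.1 hc).2⟩
    · obtain ⟨x, hx, he⟩ := hOB η η.2 hη
      have hxN : x ∉ π ⁻¹' N := by
        rwa [mem_preimage, ← flatExtension_toFlatCompletion π x, he]
      have hηi : η = i ⟨x, hx, hxN⟩ := Subtype.ext he.symm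
      refine ⟨φ ⟨x, hx, hxN⟩, ?_⟩
      rw [hηi, ← hi.nhds_eq_comap]
      exact hφc.continuousAt
  obtain ⟨a₀⟩ := hi.dense.nonempty_iff.2 ⟨⟨ξ₀, hKO hξ₀⟩⟩
  have : Nonempty D.Space := ⟨φ a₀⟩
  have : RegularSpace D.Space := regularSpace_of_isProperMap D.isProperMap_pr
  have hΨ : Continuous (hi.extend φ) := hi.continuous_extend hlim
  have hΨi : ∀ a, hi.extend φ (i a) = φ a := hi.extend_eq hφc
  have hΨp : ∀ η, D.proj ϑ⁻¹ (hi.extend φ η) = flatExtension π η := by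
    have h1 : Continuous fun η : O => D.proj ϑ⁻¹ (hi.extend φ η) :=
      (continuous_const.mul D.continuous_pr).comp hΨ
    have h2 : Continuous fun η : O => flatExtension π η :=
      (continuous_flatExtension π).comp continuous_subtype_val
    refine congrFun (hi.dense.equalizer h1 h2 (funext fun a => ?_))
    simp only [Function.comp_apply, hΨi, SlitData.proj, hφp, i, flatExtension_toFlatCompletion]
    exact inv_mul_cancel_left₀ hϑ0 _
  let Φ : FlatCompletion π → D.Space := fun η => if h : η ∈ O then hi.extend φ ⟨η, h⟩ else φ a₀
  have hΦ : ∀ η (h : η ∈ O), Φ η = hi.extend φ ⟨η, h⟩ := fun η h => dif_pos h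
  have hΦc : ContinuousOn Φ O := by
    rw [continuousOn_iff_continuous_domRestrict]
    convert hΨ using 1
    exact funext fun η => hΦ η η.2
  have hΦp : ∀ η ∈ O, D.proj ϑ⁻¹ (Φ η) = flatExtension π η := fun η h => by rw [hΦ η h, hΨp]
  have hsec : ∀ x, toFlatCompletion π x ∈ O → ∃ ρ > 0, ∃ σ : ℂ → X,
      ContinuousOn σ (Metric.ball (π x) ρ) ∧ (∀ z ∈ Metric.ball (π x) ρ, π (σ z) = z) ∧
      σ (π x) = x ∧ (∀ z ∈ Metric.ball (π x) ρ, toFlatCompletion π (σ z) ∈ O) := fun x hx =>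
    hπ.exists_disc x ((hOo.preimage hj.continuous).mem_nhds hx)
  have hΦσ : ∀ {A : Set ℂ} {σ : ℂ → X}, ContinuousOn σ A → (∀ z ∈ A, π (σ z) = z) →
      (∀ z ∈ A, toFlatCompletion π (σ z) ∈ O) →
      ContinuousOn (fun z => Φ (toFlatCompletion π (σ z))) A ∧
      ∀ z ∈ A, D.proj ϑ⁻¹ (Φ (toFlatCompletion π (σ z))) = z := fun h1 h2 h3 =>
    ⟨hΦc.comp (hj.continuous.comp_continuousOn h1) h3, fun z hz => by
      rw [hΦp _ (h3 z hz), flatExtension_toFlatCompletion, h2 z hz]⟩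
  have hreg : ∀ x, toFlatCompletion π x ∈ O → D.IsReg (Φ (toFlatCompletion π x)) := by
    intro x hx
    obtain ⟨ρ, hρ, σ, h1, h2, h3, h4⟩ := hsec x hx
    obtain ⟨h5, h6⟩ := hΦσ h1 h2 h4
    have := SlitData.isReg_of_section hθ hρ h5 h6
    rwa [h3] at this
  refine ⟨O, ϑ⁻¹, I, hI, D, Φ, hOo, hKO, hθ, hΦc, hΦp, hreg, fun x hx y hy hxy => ?_⟩
  have hxy' : Φ (toFlatCompletion π x) = Φ (toFlatCompletion π y) := hxy
  have hπxy : π x = π y := by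
    rw [← flatExtension_toFlatCompletion π x, ← hΦp _ hx, hxy', hΦp _ hy,
      flatExtension_toFlatCompletion]
  obtain ⟨ρ, hρ, σ, h1, h2, h3, h4⟩ := hsec x hx
  obtain ⟨ρ', hρ', σ', h1', h2', h3', h4'⟩ := hsec y hy
  rw [← hπxy] at h1' h2' h3' h4'
  have hr : 0 < min ρ ρ' := lt_min hρ hρ'
  have s1 : Metric.ball (π x) (min ρ ρ') ⊆ Metric.ball (π x) ρ :=
    Metric.ball_subset_ball (min_le_left _ _)
  have s2 : Metric.ball (π x) (min ρ ρ') ⊆ Metric.ball (π x) ρ' :=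
    Metric.ball_subset_ball (min_le_right _ _)
  obtain ⟨h5, h6⟩ := hΦσ (h1.mono s1) (fun z hz => h2 z (s1 hz)) fun z hz => h4 z (s1 hz)
  obtain ⟨h5', h6'⟩ := hΦσ (h1'.mono s2) (fun z hz => h2' z (s2 hz)) fun z hz => h4' z (s2 hz)
  have heq := SlitData.eqOn_section hθ (convex_ball _ _).isPreconnected h5 h5'
    (fun z hz => hreg _ (h4 z (s1 hz))) (fun z hz => hreg _ (h4' z (s2 hz))) h6 h6'
    (Metric.mem_ball_self hr) (by rw [h3, h3', hxy'])
  -- Equality at `x` and `y` propagates along the local sections to a nearby point off `N`, where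
  -- `φ` is injective; uniqueness of sections brings `σ z = σ' z` back to `x = y`.
  obtain ⟨z, hz, hzN⟩ := (infinite_of_mem_nhds _ (Metric.ball_mem_nhds (π x) hr)).exists_notMem_finite hN
  have hmem : ∀ w, π w ∉ N → toFlatCompletion π w ∈ O → ∃ h : w ∈ B \ π ⁻¹' N,
      Φ (toFlatCompletion π w) = φ ⟨w, h⟩ := fun w hwN hwO => by
    obtain ⟨w', hw', he⟩ := hOB _ hwO (by rwa [flatExtension_toFlatCompletion])
    obtain rfl := hj.injective he
    exact ⟨⟨hw', hwN⟩, by rw [hΦ _ hwO]; exact hΨi ⟨w', hw', hwN⟩⟩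
  obtain ⟨m, e⟩ := hmem (σ z) (by rwa [h2 z (s1 hz)]) (h4 z (s1 hz))
  obtain ⟨m', e'⟩ := hmem (σ' z) (by rwa [h2' z (s2 hz)]) (h4' z (s2 hz))
  have hσz : σ z = σ' z := congrArg Subtype.val (hφi (e.symm.trans ((heq hz).trans e')))
  have := hπ.eqOn_section (convex_ball _ _).isPreconnected (h1.mono s1) (h1'.mono s2)
    (fun z hz => h2 z (s1 hz)) (fun z hz => h2' z (s2 hz)) hz hσz (Metric.mem_ball_self hr)
  rw [← h3, ← h3', this]

end Extension

namespace SlitData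

/-! ### Maps between branched coverings defined on part of the sheets -/

section PartialMap

variable {I : Type u} {J : Type v} (D : SlitData I) (G : Set I)

/-- The points all of whose sheets belong to `G`. -/
def onSheets : Set D.Space := {p | ∀ z k, p = D.pt z k → k ∈ G}

variable {D G}

theorem mem_onSheets {z : ℂ} {k : I} (h : D.pt z k ∈ D.onSheets G) : k ∈ G := h z k rfl

/-- Neither `G` nor its complement can be left by crossing a slit or passing to another sheet of a
cycle. -/
theorem isClopen_onSheets (hG : ∀ a, ∀ k ∈ G, D.perm a k ∈ G) (hG' : ∀ a, ∀ k ∉ G, D.perm a k ∉ G) :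
    IsClopen (D.onSheets G) := by
  have hiff : ∀ a k, D.perm a k ∈ G ↔ k ∈ G := fun a k =>
    ⟨fun h => by_contra fun h' => hG' a k h' h, hG a k⟩
  have hz : ∀ a (n : ℤ) k, (D.perm a ^ n) k ∈ G ↔ k ∈ G := by
    intro a n k
    induction n using Int.induction_on generalizing k with
    | zero => simp
    | succ n ih => rw [zpow_add_one, Equiv.Perm.mul_apply, ih, hiff]
    | pred n ih =>
      rw [zpow_sub_one, Equiv.Perm.mul_apply, ih, ← hiff a]; simp
  have hrel : ∀ {z z' k k'}, D.Rel z z' k k' → (k' ∈ G ↔ k ∈ G) := by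
    intro z z' k k' h
    by_cases hn : z.im = D.height z.re
    · obtain ⟨n, rfl⟩ := (D.rel_node hn).1 h
      exact hz _ n k
    · rcases le_or_gt z'.re z.re with hle | hlt
      · rw [(D.rel_of_le hn hle).1 h]
      · rw [(D.rel_of_lt hn hlt).1 h, cross]
        split_ifs
        · exact hiff _ _
        · rfl
  have hmem : ∀ z k, D.pt z k ∈ D.onSheets G ↔ k ∈ G := by
    refine fun z k => ⟨mem_onSheets, fun hk z' k' h => ?_⟩
    obtain ⟨rfl, h'⟩ := D.pt_eq_pt.1 h
    exact (hrel h').2 hk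
  constructor
  · rw [← isOpen_compl_iff, isOpen_iff]
    intro z k h
    rw [mem_compl_iff, hmem] at h
    exact Eventually.of_forall fun z' k' h' => by rwa [mem_compl_iff, hmem, hrel h']
  · rw [isOpen_iff]
    intro z k h
    rw [hmem] at h
    exact Eventually.of_forall fun z' k' h' => by rwa [hmem, hrel h']

variable {D' : SlitData J} {f : I → J} (hh : D.height = D'.height)
  (hf : ∀ a, ∀ k ∈ G, f (D.perm a k) = D'.perm a (f k))
include hh hf

/-- Equivariance is assumed on `G` only. It suffices, because membership in `onSheets G` puts the
whole cycle of `k` into `G` when `z` is a node. -/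
theorem rel_of_equivariantOn {z z' : ℂ} {k k' : I} (hk : D.pt z k ∈ D.onSheets G)
    (h : D.Rel z z' k k') : D'.Rel z z' (f k) (f k') := by
  have hkG : ∀ k', D.Rel z z k k' → k' ∈ G := fun k' h => hk z k' (D.pt_eq_pt'.2 h)
  by_cases hn : z.im = D.height z.re
  · have hkG' : ∀ n : ℤ, (D.perm z.re ^ n) k ∈ G := fun n =>
      hkG _ ((D.rel_node hn).2 ⟨n, rfl⟩)
    have key : ∀ n : ℤ, f ((D.perm z.re ^ n) k) = (D'.perm z.re ^ n) (f k) := by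
      intro n
      induction n using Int.induction_on with
      | zero => simp
      | succ n ih =>
        rw [add_comm, zpow_add, zpow_add, zpow_one, zpow_one, Equiv.Perm.mul_apply,
          Equiv.Perm.mul_apply, hf _ _ (hkG' _), ih]
      | pred n ih =>
        have h1 := hf z.re _ (hkG' (-n - 1))
        rw [← Equiv.Perm.mul_apply, ← zpow_one_add, add_sub_cancel, ih] at h1
        rw [sub_eq_add_neg, add_comm, zpow_add (D'.perm z.re), zpow_neg_one, Equiv.Perm.mul_apply,
          Equiv.Perm.eq_inv_iff_eq, ← sub_eq_neg_add, ← h1]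
    obtain ⟨n, rfl⟩ := (D.rel_node hn).1 h
    rw [D'.rel_node (hh ▸ hn), key]
    exact ⟨n, rfl⟩
  · have hn' : z.im ≠ D'.height z.re := hh ▸ hn
    rcases le_or_gt z'.re z.re with hle | hlt
    · rw [(D.rel_of_le hn hle).1 h, D'.rel_of_le hn' hle]
    · rw [(D.rel_of_lt hn hlt).1 h, D'.rel_of_lt hn' hlt, cross, cross, hh]
      split_ifs
      · exact hf _ _ (hkG k (D.rel_refl z k))
      · rfl

/-- An equivariant map defined on part of the sheets induces a map of the branched coverings,
continuous on the points whose sheets are in that part. -/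
theorem exists_continuousOn_onSheets : ∃ F : D.Space → D'.Space, ContinuousOn F (D.onSheets G) ∧
    ∀ z k, D.pt z k ∈ D.onSheets G → F (D.pt z k) = D'.pt z (f k) := by
  have hrep : ∀ p : D.Space, ∃ q : ℂ × I, p = D.pt q.1 q.2 := D.ind fun z k => ⟨(z, k), rfl⟩
  choose q hq using hrep
  have hF : ∀ z k, D.pt z k ∈ D.onSheets G →
      D'.pt (q (D.pt z k)).1 (f (q (D.pt z k)).2) = D'.pt z (f k) := by
    intro z k h
    obtain ⟨h1, h2⟩ := D.pt_eq_pt.1 (hq (D.pt z k))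
    rw [← h1]
    exact (D'.pt_eq_pt'.2 (rel_of_equivariantOn hh hf h h2)).symm
  refine ⟨fun p => D'.pt (q p).1 (f (q p).2), ?_, hF⟩
  refine D.ind fun z k hp => ?_
  rw [ContinuousWithinAt]
  rw [hF z k hp]
  intro U hU
  have h1 : ∀ᶠ z' in 𝓝 z, ∀ k', D.Rel z z' k k' → D.pt z' k' ∈ {p | p ∈ D.onSheets G →
      D'.pt (q p).1 (f (q p).2) ∈ U} := by
    filter_upwards [D'.mem_nhds_iff.1 hU] with z' hz' k' hk' hm
    rw [hF z' k' hm]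
    exact hz' _ (rel_of_equivariantOn hh hf hp hk')
  exact mem_nhdsWithin_iff_eventually.2 (D.mem_nhds_iff.2 h1)

theorem isReg_of_equivariantOn {z : ℂ} {k : I} (hk : D.pt z k ∈ D.onSheets G) (h : D.IsReg (D.pt z k)) :
    D'.IsReg (D'.pt z (f k)) := by
  by_cases hn : z.im = D.height z.re
  · rw [D.isReg_of_eq_height hn] at h
    rw [D'.isReg_of_eq_height (hh ▸ hn), ← hf _ _ (mem_onSheets hk), h]
  · exact D'.isReg_of_ne_height (hh ▸ hn) _

/-- Transport of a map with regular values. -/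
theorem exists_map_of_equivariantOn (hinj : InjOn f G) {X : Type*} [TopologicalSpace X] {U : Set X}
    {ψ : X → D.Space} (hψ : ContinuousOn ψ U) (hi : InjOn ψ U) (hreg : ∀ x ∈ U, D.IsReg (ψ x))
    (hG : ∀ x ∈ U, ψ x ∈ D.onSheets G) :
    ∃ ψ' : X → D'.Space, ContinuousOn ψ' U ∧ InjOn ψ' U ∧ (∀ x ∈ U, D'.IsReg (ψ' x)) ∧
      ∀ x ∈ U, D'.pr (ψ' x) = D.pr (ψ x) := by
  obtain ⟨F, hF, hFp⟩ := exists_continuousOn_onSheets hh hf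
  have hrep : ∀ p : D.Space, ∃ q : ℂ × I, p = D.pt q.1 q.2 := D.ind fun z k => ⟨(z, k), rfl⟩
  refine ⟨F ∘ ψ, hF.comp hψ hG, fun x hx y hy h => hi hx hy ?_, fun x hx => ?_, fun x hx => ?_⟩
  · have hx1 := hG x hx
    have hy1 := hG y hy
    have hx2 := hreg x hx
    obtain ⟨⟨z, k⟩, e⟩ := hrep (ψ x)
    obtain ⟨⟨w, l⟩, e'⟩ := hrep (ψ y)
    simp only [Function.comp_apply] at h
    rw [e] at hx1 hx2
    rw [e'] at hy1
    rw [e, e', hFp _ _ hx1, hFp _ _ hy1] at h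
    obtain ⟨rfl, h'⟩ := D'.pt_eq_pt.1 h
    have h2 := D'.isReg_pt.1 (isReg_of_equivariantOn hh hf hx1 hx2) _ h'
    rw [e, e', hinj (mem_onSheets hy1) (mem_onSheets hx1) h2]
  · obtain ⟨⟨z, k⟩, e⟩ := hrep (ψ x)
    have hx1 := hG x hx
    have hx2 := hreg x hx
    rw [e] at hx1 hx2
    rw [Function.comp_apply, e, hFp _ _ hx1]
    exact isReg_of_equivariantOn hh hf hx1 hx2
  · obtain ⟨⟨z, k⟩, e⟩ := hrep (ψ x)
    have hx1 := hG x hx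
    rw [e] at hx1
    rw [Function.comp_apply, e, hFp _ _ hx1]
    rfl

end PartialMap

/-! ### The component of a sheet -/

section Orbit

variable {I : Type u} (D : SlitData I) (i₀ : I)

/-- The sheets that can be reached from a given one. -/
def orbit : Set I := {i | Relation.EqvGen (fun k k' => ∃ a, D.perm a k = k') i₀ i}

theorem perm_mem_orbit (a : ℝ) (k : I) : D.perm a k ∈ D.orbit i₀ ↔ k ∈ D.orbit i₀ :=
  ⟨fun h => h.trans _ _ _ (.symm _ _ (.rel _ _ ⟨a, rfl⟩)), fun h => h.trans _ _ _ (.rel _ _ ⟨a, rfl⟩)⟩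

/-- The branched covering formed by the sheets that can be reached from `i₀`. -/
def component : SlitData (D.orbit i₀) where
  height := D.height
  perm a := (D.perm a).subtypePerm fun k => D.perm_mem_orbit i₀ a k
  finite_support := by
    refine D.finite_support.subset fun a ha h => ha ?_
    ext ⟨k, hk⟩
    simp [h]

theorem transitive_component : (D.component i₀).Transitive := by
  have key : ∀ i i', Relation.EqvGen (fun k k' => ∃ a, D.perm a k = k') i i' →
      ∀ (hi : i ∈ D.orbit i₀) (hi' : i' ∈ D.orbit i₀), Relation.EqvGen
        (fun k k' => ∃ a, (D.component i₀).perm a k = k') (⟨i, hi⟩ : D.orbit i₀) ⟨i', hi'⟩ := by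
    intro i i' h
    induction h with
    | rel i i' h =>
      obtain ⟨a, rfl⟩ := h
      exact fun hi hi' => .rel _ _ ⟨a, rfl⟩
    | refl i => exact fun _ _ => .refl _
    | symm i i' _ ih => exact fun hi hi' => .symm _ _ (ih hi' hi)
    | trans i j k h _ ih ih' =>
      intro hi hk
      have hj : j ∈ D.orbit i₀ := hi.trans _ _ _ h
      exact .trans _ _ _ (ih hi hj) (ih' hj hk)
  rintro ⟨i, hi⟩ ⟨i', hi'⟩
  exact key i i' (.trans _ _ _ (.symm _ _ hi) hi') hi hi'

end Orbit

end SlitData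

namespace SlitData

/-! ### The tree of words of a branched covering -/

section Words

variable {I : Type u} (D : SlitData I) (i₀ : I)

/-- The sheet reached by a word; a word lists the moves `(a, i)` to sheet `i` along the cycle of
`perm a`, the last one first. -/
def endSheet : List (ℝ × I) → I
  | [] => i₀
  | (_, i) :: _ => i

open Classical in
/-- The word before its last move, if that was along a cycle of `perm a`. -/
def wordBase {I : Type u} (a : ℝ) : List (ℝ × I) → List (ℝ × I)
  | [] => []
  | (b, i) :: w => if b = a then w else (b, i) :: w

/-- Reduced words. -/
def IsWord : List (ℝ × I) → Prop
  | [] => True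
  -- Each move really changes the sheet. The last condition says that the preceding move was not
  -- along the same abscissa, since two such moves would merge into one.
  | (a, i) :: w => IsWord w ∧ i ≠ endSheet i₀ w ∧ (D.perm a).SameCycle (endSheet i₀ w) i ∧
      wordBase a w = w

open Classical in
/-- Move to sheet `i` along the cycle of `perm a`. -/
def wordStep (a : ℝ) (i : I) (w : List (ℝ × I)) : List (ℝ × I) :=
  if i = endSheet i₀ (wordBase a w) then wordBase a w else (a, i) :: wordBase a w

variable {D i₀}

theorem wordBase_cons_self {a : ℝ} {i : I} {w : List (ℝ × I)} : wordBase a ((a, i) :: w) = w := by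
  simp [wordBase]

theorem IsWord.wordBase {w : List (ℝ × I)} (h : D.IsWord i₀ w) (a : ℝ) :
    D.IsWord i₀ (wordBase a w) := by
  rcases w with _ | ⟨⟨b, i⟩, w⟩
  · exact h
  · by_cases hb : b = a
    · simpa [SlitData.wordBase, hb] using h.1
    · simpa [SlitData.wordBase, hb] using h

theorem IsWord.wordBase_wordBase {w : List (ℝ × I)} (h : D.IsWord i₀ w) (a : ℝ) :
    SlitData.wordBase a (SlitData.wordBase a w) = SlitData.wordBase a w := by
  rcases w with _ | ⟨⟨b, i⟩, w⟩
  · rfl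
  · by_cases hb : b = a
    · subst hb
      simpa [SlitData.wordBase] using h.2.2.2
    · simp [SlitData.wordBase, hb]

theorem IsWord.sameCycle_wordBase {w : List (ℝ × I)} (h : D.IsWord i₀ w) (a : ℝ) :
    (D.perm a).SameCycle (endSheet i₀ (SlitData.wordBase a w)) (endSheet i₀ w) := by
  rcases w with _ | ⟨⟨b, i⟩, w⟩
  · rfl
  · by_cases hb : b = a
    · subst hb
      rw [wordBase_cons_self]
      exact h.2.2.1
    · simpa [SlitData.wordBase, hb] using Equiv.Perm.SameCycle.refl _ _

theorem length_wordBase_le (a : ℝ) (w : List (ℝ × I)) : (wordBase a w).length ≤ w.length := by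
  rcases w with _ | ⟨⟨b, i⟩, w⟩
  · rfl
  · by_cases hb : b = a <;> simp [wordBase, hb]

theorem endSheet_wordStep (a : ℝ) (i : I) (w : List (ℝ × I)) : endSheet i₀ (wordStep i₀ a i w) = i := by
  unfold wordStep
  split_ifs with h
  · exact h.symm
  · rfl

theorem IsWord.wordBase_wordStep {w : List (ℝ × I)} (h : D.IsWord i₀ w) (a : ℝ) (i : I) :
    SlitData.wordBase a (wordStep i₀ a i w) = SlitData.wordBase a w := by
  unfold wordStep
  split_ifs
  · exact h.wordBase_wordBase a
  · exact wordBase_cons_self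

/-- Successive moves along the same cycle replace one another, as the base of the word is unchanged.
This makes `wordPerm` invertible and its powers computable. -/
theorem IsWord.wordStep_wordStep {w : List (ℝ × I)} (h : D.IsWord i₀ w) (a : ℝ) (i i' : I) :
    wordStep i₀ a i' (wordStep i₀ a i w) = wordStep i₀ a i' w := by
  rw [wordStep, h.wordBase_wordStep, wordStep]

theorem IsWord.wordStep_endSheet {w : List (ℝ × I)} (h : D.IsWord i₀ w) (a : ℝ) :
    wordStep i₀ a (endSheet i₀ w) w = w := by
  rcases w with _ | ⟨⟨b, i⟩, w⟩
  · simp [wordStep, SlitData.wordBase]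
  · by_cases hb : b = a
    · subst hb
      rw [SlitData.wordStep, wordBase_cons_self]
      exact if_neg h.2.1
    · simp [wordStep, SlitData.wordBase, hb]

theorem IsWord.wordStep {w : List (ℝ × I)} (h : D.IsWord i₀ w) (a : ℝ) {i : I}
    (hi : (D.perm a).SameCycle (endSheet i₀ w) i) : D.IsWord i₀ (wordStep i₀ a i w) := by
  unfold SlitData.wordStep
  split_ifs with he
  · exact h.wordBase a
  · exact ⟨h.wordBase a, he, (h.sameCycle_wordBase a).trans hi, h.wordBase_wordBase a⟩

theorem length_wordStep_le (a : ℝ) (i : I) (w : List (ℝ × I)) :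
    (wordStep i₀ a i w).length ≤ (wordBase a w).length + 1 := by
  unfold wordStep
  split_ifs <;> simp

variable (D i₀)

/-- The type of reduced words. -/
abbrev Word : Type u := {w : List (ℝ × I) // D.IsWord i₀ w}

/-- The sheet reached by a reduced word. -/
def wordEnd (w : D.Word i₀) : I := endSheet i₀ w.1

/-- The permutation of the words that moves along the cycles of `perm a`. -/
def wordPerm (a : ℝ) : Equiv.Perm (D.Word i₀) where
  toFun w := ⟨wordStep i₀ a (D.perm a (endSheet i₀ w.1)) w.1, w.2.wordStep a ⟨1, by simp⟩⟩
  invFun w := ⟨wordStep i₀ a ((D.perm a)⁻¹ (endSheet i₀ w.1)) w.1, w.2.wordStep a ⟨-1, by simp⟩⟩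
  left_inv w := Subtype.ext (by
    simp only [endSheet_wordStep]
    rw [w.2.wordStep_wordStep, ← Equiv.Perm.mul_apply, inv_mul_cancel]
    exact w.2.wordStep_endSheet a)
  right_inv w := Subtype.ext (by
    simp only [endSheet_wordStep]
    rw [w.2.wordStep_wordStep, ← Equiv.Perm.mul_apply, mul_inv_cancel]
    exact w.2.wordStep_endSheet a)

/-- The branched covering whose sheets are the words. -/
def wordData : SlitData (D.Word i₀) where
  height := D.height
  perm := D.wordPerm i₀
  finite_support := by
    refine D.finite_support.subset fun a ha h => ha ?_
    ext w : 1
    refine Subtype.ext ?_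
    change wordStep i₀ a (D.perm a (endSheet i₀ w.1)) w.1 = w.1
    rw [h]
    exact w.2.wordStep_endSheet a

theorem height_wordData : (D.wordData i₀).height = D.height := rfl

theorem endSheet_wordPerm (a : ℝ) (w : D.Word i₀) :
    D.wordEnd i₀ ((D.wordData i₀).perm a w) = D.perm a (D.wordEnd i₀ w) :=
  endSheet_wordStep _ _ _

theorem wordPerm_zpow (a : ℝ) (n : ℤ) (w : D.Word i₀) :
    (((D.wordData i₀).perm a ^ n) w).1 = wordStep i₀ a ((D.perm a ^ n) (endSheet i₀ w.1)) w.1 := by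
  induction n using Int.induction_on with
  | zero => exact (w.2.wordStep_endSheet a).symm
  | succ n ih =>
    rw [add_comm, zpow_one_add, zpow_one_add, Equiv.Perm.mul_apply, Equiv.Perm.mul_apply]
    change wordStep i₀ a (D.perm a (endSheet i₀ (((D.wordData i₀).perm a ^ (n : ℤ)) w).1)) _ = _
    rw [ih, endSheet_wordStep, w.2.wordStep_wordStep]
  | pred n ih =>
    rw [sub_eq_neg_add, zpow_add, zpow_add, zpow_neg_one, zpow_neg_one, Equiv.Perm.mul_apply,
      Equiv.Perm.mul_apply]
    change wordStep i₀ a ((D.perm a)⁻¹ (endSheet i₀ (((D.wordData i₀).perm a ^ (-n : ℤ)) w).1)) _ = _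
    rw [ih, endSheet_wordStep, w.2.wordStep_wordStep]

theorem sameCycle_word {a : ℝ} {w w' : D.Word i₀} :
    ((D.wordData i₀).perm a).SameCycle w w' ↔
      ∃ i, (D.perm a).SameCycle (endSheet i₀ w.1) i ∧ w'.1 = wordStep i₀ a i w.1 := by
  constructor
  · rintro ⟨n, rfl⟩
    exact ⟨_, ⟨n, rfl⟩, D.wordPerm_zpow i₀ a n w⟩
  · rintro ⟨i, ⟨n, rfl⟩, h⟩
    exact ⟨n, Subtype.ext ((D.wordPerm_zpow i₀ a n w).trans h.symm)⟩

/-- Words of one cycle share their base and differ only in the sheet they reach, so cycles of words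
map injectively to cycles of sheets. The word covering is thus unramified over the original one. -/
theorem eq_of_sameCycle_word {a : ℝ} {w w' : D.Word i₀}
    (h : ((D.wordData i₀).perm a).SameCycle w w') (he : D.wordEnd i₀ w = D.wordEnd i₀ w') :
    w = w' := by
  obtain ⟨i, -, h'⟩ := (D.sameCycle_word i₀).1 h
  refine Subtype.ext ?_
  rw [wordEnd, wordEnd, h', endSheet_wordStep] at he
  rw [h', ← he, w.2.wordStep_endSheet]

theorem isCoveringMap_wordData : IsCoveringMap
    (map (D := D.wordData i₀) (D' := D) (f := D.wordEnd i₀) (D.height_wordData i₀)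
      (D.endSheet_wordPerm i₀)) :=
  isCoveringMap_map _ _ fun _ _ _ => D.eq_of_sameCycle_word i₀

theorem isReg_of_isReg_map {p : (D.wordData i₀).Space} (h : D.IsReg
    (map (D := D.wordData i₀) (D' := D) (f := D.wordEnd i₀) (D.height_wordData i₀)
      (D.endSheet_wordPerm i₀) p)) : (D.wordData i₀).IsReg p := by
  induction p using SlitData.ind with | _ z w =>
  rw [map_pt] at h
  by_cases hn : z.im = D.height z.re
  · rw [D.isReg_of_eq_height hn] at h
    rw [(D.wordData i₀).isReg_of_eq_height hn]
    refine (D.eq_of_sameCycle_word i₀ (a := z.re) ⟨1, by simp⟩ ?_).symm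
    rw [endSheet_wordPerm, h]
  · exact (D.wordData i₀).isReg_of_ne_height hn w

/-- A compact set only meets words of bounded length. -/
theorem exists_length_lt {K : Set (D.wordData i₀).Space} (hK : IsCompact K) :
    ∃ n : ℕ, K ⊆ (D.wordData i₀).onSheets {w | w.1.length < n} := by
  refine hK.induction_on (p := fun K => ∃ n : ℕ, K ⊆ (D.wordData i₀).onSheets {w | w.1.length < n})
    ⟨0, empty_subset _⟩ (fun _ _ h ⟨n, hn⟩ => ⟨n, h.trans hn⟩) ?_ ?_
  · rintro s t ⟨n, hn⟩ ⟨n', hn'⟩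
    refine ⟨max n n', union_subset (fun p hp z w h => ?_) fun p hp z w h => ?_⟩
    · exact (show w.1.length < n from hn hp z w h).trans_le (le_max_left _ _)
    · exact (show w.1.length < n' from hn' hp z w h).trans_le (le_max_right _ _)
  · intro p
    revert p
    refine (D.wordData i₀).ind fun z w _ => ?_
    have hstep : ∀ a i, (wordStep i₀ a i w.1).length ≤ w.1.length + 1 := fun a i =>
      (length_wordStep_le a i w.1).trans (Nat.succ_le_succ (length_wordBase_le a w.1))
    -- A cone meets only words obtained by at most one move, so lengths are locally bounded.
    have key : ∀ z' w', (D.wordData i₀).Rel z z' w w' → w'.1.length ≤ w.1.length + 1 := by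
      intro z' w' h
      by_cases hn : z.im = (D.wordData i₀).height z.re
      · obtain ⟨i, -, h⟩ := (D.sameCycle_word i₀).1 (((D.wordData i₀).rel_node hn).1 h)
        rw [h]
        exact hstep _ _
      · rcases le_or_gt z'.re z.re with hle | hlt
        · rw [((D.wordData i₀).rel_of_le hn hle).1 h]
          exact Nat.le_succ _
        · rw [((D.wordData i₀).rel_of_lt hn hlt).1 h, cross]
          split_ifs
          · exact hstep _ _
          · exact Nat.le_succ _
    obtain ⟨r, hg⟩ := (D.wordData i₀).exists_good z
    refine ⟨_, mem_nhdsWithin_of_mem_nhds ((hg.isOpen_cone w).mem_nhds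
      ((D.wordData i₀).mem_cone_self hg.1 w)), w.1.length + 2, fun q hq z' w' h => ?_⟩
    subst h
    exact Nat.lt_succ_of_le (key z' w' (hg.mem_cone.1 hq).2)

end Words

end SlitData

/-! ### Truncation of the tree of words -/

namespace SlitData

section Tree

variable {I : Type u} {D : SlitData I} {i₀ : I}

theorem length_le_length_wordBase (a : ℝ) (w : List (ℝ × I)) :
    w.length ≤ (wordBase a w).length + 1 := by
  rcases w with _ | ⟨⟨b, i⟩, w⟩
  · simp
  · by_cases hb : b = a <;> simp [wordBase, hb]

theorem length_wordBase_le_wordStep (a : ℝ) (i : I) (w : List (ℝ × I)) :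
    (wordBase a w).length ≤ (wordStep i₀ a i w).length := by
  unfold wordStep
  split_ifs <;> simp

theorem wordBase_wordPerm (a : ℝ) (w : D.Word i₀) :
    wordBase a ((D.wordData i₀).perm a w).1 = wordBase a w.1 :=
  w.2.wordBase_wordStep a _

theorem IsWord.perm_ne_one {w : List (ℝ × I)} (h : D.IsWord i₀ w) : ∀ x ∈ w, D.perm x.1 ≠ 1 := by
  induction w with
  | nil => simp
  | cons x w ih =>
    intro y hy
    rcases List.mem_cons.1 hy with rfl | hy
    · intro h1
      have := h.2.2.1
      rw [h1, Equiv.Perm.sameCycle_one] at this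
      exact h.2.1 this.symm
    · exact ih h.1 y hy

variable (D i₀) (n : ℕ)

/-- The words of length at most `n`. -/
abbrev ShortWord : Type u := {w : D.Word i₀ // w.1.length ≤ n}

/-- The letters of a reduced word are nontrivial moves, so their abscissae lie in the finite support
of `D`. -/
instance [Finite I] : Finite (D.ShortWord i₀ n) := by
  have : Finite {a | D.perm a ≠ 1} := D.finite_support
  let g : {a | D.perm a ≠ 1} × I → ℝ × I := Prod.map Subtype.val id
  have h1 : (List.map g '' {l | l.length ≤ n}).Finite := (List.finite_length_le _ n).image _
  have h2 : Finite ↥(List.map g '' {l | l.length ≤ n}) := h1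
  have h3 : ∀ w : D.ShortWord i₀ n, w.1.1 ∈ List.map g '' {l | l.length ≤ n} := by
    intro w
    have : w.1.1 ∈ range (List.map g) := by
      rw [range_list_map]
      intro x hx
      exact ⟨(⟨x.1, w.1.2.perm_ne_one x hx⟩, x.2), rfl⟩
    obtain ⟨l, hl⟩ := this
    exact ⟨l, by have := w.2; rwa [← hl, List.length_map] at this, hl⟩
  exact Finite.of_injective (fun w => (⟨w.1.1, h3 w⟩ : ↥(List.map g '' {l | l.length ≤ n})))
    fun w w' h => Subtype.ext (Subtype.ext (Subtype.mk.inj h))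

open Classical in
/-- The permutation `wordPerm` restricted to the cycles that consist of words of length at most
`n`. -/
def cutPerm (a : ℝ) : Equiv.Perm (D.Word i₀) :=
  Equiv.Perm.ofSubtype (((D.wordData i₀).perm a).subtypePerm
    (p := fun w => (wordBase a w.1).length < n) fun w => by rw [wordBase_wordPerm])

variable {D i₀ n}

theorem cutPerm_zpow_of_lt {a : ℝ} {w : D.Word i₀} (h : (wordBase a w.1).length < n) (m : ℤ) :
    (D.cutPerm i₀ n a ^ m) w = ((D.wordData i₀).perm a ^ m) w := by
  classical
  rw [cutPerm, ← _root_.map_zpow, Equiv.Perm.subtypePerm_zpow]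
  exact Equiv.Perm.ofSubtype_apply_of_mem (p := fun w : D.Word i₀ => (wordBase a w.1).length < n) _ h

theorem cutPerm_of_lt {a : ℝ} {w : D.Word i₀} (h : (wordBase a w.1).length < n) :
    D.cutPerm i₀ n a w = (D.wordData i₀).perm a w := by
  simpa using cutPerm_zpow_of_lt h 1

theorem cutPerm_of_not_lt {a : ℝ} {w : D.Word i₀} (h : ¬ (wordBase a w.1).length < n) :
    D.cutPerm i₀ n a w = w :=
  Equiv.Perm.ofSubtype_apply_of_not_mem _ h

theorem length_cutPerm (a : ℝ) (w : D.Word i₀) :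
    (D.cutPerm i₀ n a w).1.length ≤ n ↔ w.1.length ≤ n := by
  by_cases h : (wordBase a w.1).length < n
  · rw [cutPerm_of_lt h]
    exact iff_of_true ((length_wordStep_le a _ w.1).trans h)
      ((length_le_length_wordBase a w.1).trans h)
  · rw [cutPerm_of_not_lt h]

variable (D i₀ n)

/-- The branched covering whose sheets are the words of length at most `n`. -/
def treeData : SlitData (D.ShortWord i₀ n) where
  height := D.height
  perm a := (D.cutPerm i₀ n a).subtypePerm (length_cutPerm a)
  finite_support := by
    refine (D.wordData i₀).finite_support.subset fun a ha h => ha ?_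
    ext w : 1
    refine Subtype.ext ?_
    change D.cutPerm i₀ n a w.1 = w.1
    by_cases h' : (wordBase a w.1.1).length < n
    · rw [cutPerm_of_lt h', h]; rfl
    · exact cutPerm_of_not_lt h'

theorem height_treeData : (D.treeData i₀ n).height = D.height := rfl

variable {D i₀ n}

theorem sameCycle_treeData_of_lt {a : ℝ} {w w' : D.ShortWord i₀ n}
    (h : (wordBase a w.1.1).length < n) : ((D.treeData i₀ n).perm a).SameCycle w w' ↔
      ((D.wordData i₀).perm a).SameCycle w.1 w'.1 := by
  have key : ∀ m : ℤ, (((D.treeData i₀ n).perm a ^ m) w).1 = ((D.wordData i₀).perm a ^ m) w.1 := by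
    intro m
    rw [← cutPerm_zpow_of_lt h]
    change (((D.cutPerm i₀ n a).subtypePerm (length_cutPerm a) ^ m) w).1 = _
    rw [Equiv.Perm.subtypePerm_zpow]
    rfl
  constructor
  · rintro ⟨m, rfl⟩
    exact ⟨m, (key m).symm⟩
  · rintro ⟨m, hm⟩
    exact ⟨m, Subtype.ext ((key m).trans hm)⟩

theorem sameCycle_treeData_of_not_lt {a : ℝ} {w w' : D.ShortWord i₀ n}
    (h : ¬ (wordBase a w.1.1).length < n) (h' : ((D.treeData i₀ n).perm a).SameCycle w w') :
    w' = w := by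
  have : (D.treeData i₀ n).perm a w = w := Subtype.ext (cutPerm_of_not_lt h)
  obtain ⟨m, rfl⟩ := h'
  exact Equiv.Perm.zpow_apply_eq_self_of_apply_eq_self this m

/-- The word at which a cycle is attached. -/
theorem exists_sameCycle_wordBase (a : ℝ) (w : D.ShortWord i₀ n) :
    ∃ l : D.ShortWord i₀ n, l.1.1 = wordBase a w.1.1 ∧
      ((wordBase a w.1.1).length < n → ((D.treeData i₀ n).perm a).SameCycle w l) := by
  refine ⟨⟨⟨_, w.1.2.wordBase a⟩, (length_wordBase_le a _).trans w.2⟩, rfl, fun h => ?_⟩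
  rw [sameCycle_treeData_of_lt h, sameCycle_word]
  exact ⟨endSheet i₀ (wordBase a w.1.1), (w.1.2.sameCycle_wordBase a).symm, by simp [wordStep]⟩

/-- Depth is length, and the lowest word of an uncut cycle is its base. A nonempty word descends
only along the abscissa of its last move: for any other abscissa it is its own base. -/
theorem isTree_treeData : (D.treeData i₀ n).IsTree := by
  refine ⟨fun w => w.1.1.length, ⟨⟨[], trivial⟩, Nat.zero_le n⟩, fun w hw => ?_, fun a w => ?_,
    fun w hw => ?_⟩
  · exact List.length_pos_of_ne_nil fun h => hw (Subtype.ext (Subtype.ext h))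
  · by_cases h : (wordBase a w.1.1).length < n
    · obtain ⟨l, hl, hlc⟩ := exists_sameCycle_wordBase a w
      refine ⟨l, hlc h, fun k hk hkl => ?_⟩
      obtain ⟨i, -, hi⟩ := (D.sameCycle_word i₀).1 ((sameCycle_treeData_of_lt h).1 hk)
      have hne : k.1.1 ≠ l.1.1 := fun h => hkl (Subtype.ext (Subtype.ext h))
      simp only [hl, hi] at hne ⊢
      unfold wordStep at *
      split_ifs at * with h'
      · exact absurd rfl hne
      · simp
    · refine ⟨w, .refl _ _, fun k hk hkw => absurd (sameCycle_treeData_of_not_lt h hk) hkw⟩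
  · obtain ⟨⟨w, hw1⟩, hw2⟩ := w
    rcases w with _ | ⟨⟨a, i⟩, b⟩
    · exact absurd rfl hw
    · refine ⟨a, ?_, fun a' ⟨k, hk, hlt⟩ => ?_⟩
      · obtain ⟨l, hl, hlc⟩ := exists_sameCycle_wordBase a (⟨⟨(a, i) :: b, hw1⟩, hw2⟩ : D.ShortWord i₀ n)
        simp only [wordBase_cons_self] at hl hlc
        refine ⟨l, hlc (Nat.lt_of_succ_le hw2), ?_⟩
        simp only [hl]
        simp
      · by_contra hne
        have hbase : wordBase a' ((a, i) :: b) = (a, i) :: b := by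
          simp [wordBase, Ne.symm hne]
        by_cases h : (wordBase a' ((a, i) :: b)).length < n
        · obtain ⟨j, -, hj⟩ := (D.sameCycle_word i₀).1 ((sameCycle_treeData_of_lt h).1 hk)
          have := length_wordBase_le_wordStep (i₀ := i₀) a' j ((a, i) :: b)
          rw [hbase] at this
          simp only at hj hlt
          rw [hj] at hlt
          exact absurd hlt (not_lt.2 this)
        · rw [sameCycle_treeData_of_not_lt h hk] at hlt
          exact lt_irrefl _ hlt

/-- Removing the last move stays in one cycle, so every word leads down to the empty one. -/
theorem transitive_treeData : (D.treeData i₀ n).Transitive := by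
  let r : D.ShortWord i₀ n → D.ShortWord i₀ n → Prop := fun k k' =>
    ∃ a, (D.treeData i₀ n).perm a k = k'
  have h1 : ∀ a k k', ((D.treeData i₀ n).perm a).SameCycle k k' → Relation.EqvGen r k k' := by
    rintro a k _ ⟨m, rfl⟩
    induction m using Int.induction_on with
    | zero => exact .refl _
    | succ m ih =>
      refine ih.trans _ _ _ (.rel _ _ ⟨a, ?_⟩)
      rw [add_comm, zpow_one_add, Equiv.Perm.mul_apply]
    | pred m ih =>
      refine ih.trans _ _ _ (.symm _ _ (.rel _ _ ⟨a, ?_⟩))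
      rw [← Equiv.Perm.mul_apply, ← zpow_one_add, add_sub_cancel]
  have h2 : ∀ m : ℕ, ∀ w : D.ShortWord i₀ n, w.1.1.length = m →
      Relation.EqvGen r w ⟨⟨[], trivial⟩, Nat.zero_le n⟩ := by
    intro m
    induction m with
    | zero =>
      intro w hw
      have : w = ⟨⟨[], trivial⟩, Nat.zero_le n⟩ :=
        Subtype.ext (Subtype.ext (List.length_eq_zero_iff.1 hw))
      exact this ▸ .refl _
    | succ m ih =>
      rintro ⟨⟨w, hw1⟩, hw2⟩ hw
      rcases w with _ | ⟨⟨a, i⟩, b⟩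
      · simp at hw
      · obtain ⟨l, hl, hlc⟩ := exists_sameCycle_wordBase a (⟨⟨(a, i) :: b, hw1⟩, hw2⟩ : D.ShortWord i₀ n)
        simp only [wordBase_cons_self] at hl hlc
        refine (h1 a _ _ (hlc (Nat.lt_of_succ_le hw2))).trans _ _ _ (ih l ?_)
        rw [hl]
        simpa using hw
  exact fun i i' => (h2 _ i rfl).trans _ _ _ (.symm _ _ (h2 _ i' rfl))

/-- Transport to a branched covering glued along a finite tree. -/
theorem exists_map_treeData {X : Type*} [TopologicalSpace X] {U : Set X}
    {ψ : X → (D.wordData i₀).Space} (hψ : ContinuousOn ψ U) (hi : InjOn ψ U)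
    (hreg : ∀ x ∈ U, (D.wordData i₀).IsReg (ψ x))
    (hG : ∀ x ∈ U, ψ x ∈ (D.wordData i₀).onSheets {w | w.1.length < n}) :
    ∃ ψ' : X → (D.treeData i₀ n).Space, ContinuousOn ψ' U ∧ InjOn ψ' U ∧
      (∀ x ∈ U, (D.treeData i₀ n).IsReg (ψ' x)) ∧
      ∀ x ∈ U, (D.treeData i₀ n).pr (ψ' x) = (D.wordData i₀).pr (ψ x) := by
  classical
  -- Sheets of length less than `n` are used, one below the cut, so that a single move stays among
  -- the kept words and no cycle through them is cut. The empty word is a default value for longer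
  -- words.
  let f : D.Word i₀ → D.ShortWord i₀ n := fun w =>
    if h : w.1.length ≤ n then ⟨w, h⟩ else ⟨⟨[], trivial⟩, Nat.zero_le n⟩
  have hf : ∀ w : D.Word i₀, w.1.length ≤ n → (f w).1 = w := fun w h => by simp [f, dif_pos h]
  refine exists_map_of_equivariantOn (f := f) (D' := D.treeData i₀ n)
    ((D.height_wordData i₀).trans (D.height_treeData i₀ n).symm) ?_ ?_ hψ hi hreg hG
  · intro a w hw
    have hw' : w.1.length < n := hw
    have h1 : (wordBase a w.1).length < n := (length_wordBase_le a w.1).trans_lt hw'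
    refine Subtype.ext ?_
    change _ = D.cutPerm i₀ n a (f w).1
    rw [hf w hw'.le, cutPerm_of_lt h1, hf]
    exact (length_wordStep_le a _ w.1).trans h1
  · intro w hw w' hw' h
    rw [← hf w (le_of_lt hw), h, hf w' (le_of_lt hw')]

end Tree

end SlitData

/-! ### Lifting through coverings near a compact set -/

section Lifting

variable {A Z : Type*} [TopologicalSpace A] [TopologicalSpace Z]

/-- The image of a path by a map that is continuous on a set containing the path. -/
def Path.mapOn {O : Set A} {φ : A → Z} (hφ : ContinuousOn φ O) {a b : A} (γ : Path a b)
    (h : ∀ t, γ t ∈ O) : Path (φ a) (φ b) where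
  toFun t := φ (γ t)
  continuous_toFun := hφ.comp_continuous γ.continuous h
  source' := by simp
  target' := by simp

theorem Path.mapOn_trans {O : Set A} {φ : A → Z} (hφ : ContinuousOn φ O) {a b c : A} (γ : Path a b)
    (γ' : Path b c) (h : ∀ t, γ t ∈ O) (h' : ∀ t, γ' t ∈ O) (h'' : ∀ t, γ.trans γ' t ∈ O) :
    (γ.trans γ').mapOn hφ h'' = (γ.mapOn hφ h).trans (γ'.mapOn hφ h') := by
  ext t
  change φ (γ.trans γ' t) = _
  rw [Path.trans_apply, Path.trans_apply]
  split_ifs <;> rfl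

theorem Path.Homotopy.mapOn {O : Set A} {φ : A → Z} (hφ : ContinuousOn φ O) {a b : A}
    {γ γ' : Path a b} (H : γ.Homotopy γ') (hH : ∀ s, H s ∈ O) (h : ∀ t, γ t ∈ O)
    (h' : ∀ t, γ' t ∈ O) : (γ.mapOn hφ h).Homotopic (γ'.mapOn hφ h') :=
  ⟨{ toFun := fun s => φ (H s)
     continuous_toFun := hφ.comp_continuous H.continuous hH
     map_zero_left := fun t => by simp [Path.mapOn]
     map_one_left := fun t => by simp [Path.mapOn]
     prop' := fun t x hx => by
      have := H.eq_fst t hx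
      change φ (H (t, x)) = φ (γ x)
      rw [this]; rfl }⟩

variable {X : Type*} [TopologicalSpace X] [T2Space X] {π : X → ℂ}

/-- In a simply connected space, a map defined on a large enough neighbourhood of a compact set
lifts through every covering near that compact set. -/
theorem exists_isCompact_lift (hπ : IsLocalHomeomorph π) [SimplyConnectedSpace A] {j : X → A}
    (hj : Continuous j) (a₀ : A) {K : Set X} (hK : IsCompact K) :
    ∃ L : Set A, IsCompact L ∧ a₀ ∈ L ∧ ∀ {Y Z : Type u} [TopologicalSpace Y] [TopologicalSpace Z]
      {q : Y → Z}, IsCoveringMap q → ∀ {φ : A → Z} {O : Set A}, ContinuousOn φ O → L ⊆ O →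
      ∀ y₀, q y₀ = φ a₀ → ∃ (U : Set X) (ψ : X → Y), IsOpen U ∧ K ⊆ U ∧ MapsTo j U O ∧
        ContinuousOn ψ U ∧ ∀ x ∈ U, q (ψ x) = φ (j x) := by
  classical
  choose R hR σ h1 h2 h3 _ using fun x : X => hπ.exists_disc x univ_mem
  let B : X → Set ℂ := fun x => Metric.ball (π x) (R x / 2)
  have hB : ∀ x, Metric.closedBall (π x) (R x / 2) ⊆ Metric.ball (π x) (R x) := fun x =>
    Metric.closedBall_subset_ball (half_lt_self (hR x))
  have hBB : ∀ x, B x ⊆ Metric.ball (π x) (R x) := fun x => Metric.ball_subset_closedBall.trans (hB x)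
  have hcB : ∀ x, π x ∈ B x := fun x => Metric.mem_ball_self (half_pos (hR x))
  let Δ : X → Set X := fun x => σ x '' B x
  have hΔ : ∀ x, IsOpen (Δ x) := fun x =>
    hπ.isOpen_image_section Metric.isOpen_ball ((h1 x).mono (hBB x)) fun z hz => h2 x z (hBB x hz)
  have hΔπ : ∀ x, ∀ y ∈ Δ x, π y ∈ B x ∧ σ x (π y) = y := by
    rintro x _ ⟨z, hz, rfl⟩
    rw [h2 x z (hBB x hz)]
    exact ⟨hz, rfl⟩
  obtain ⟨t, -, ht⟩ := hK.elim_nhds_subcover Δ fun x _ => (hΔ x).mem_nhds ⟨π x, hcB x, h3 x⟩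
  -- The lift is prescribed by lifting `α x` from `y₀` and continuing over the disc `Δ x`; it
  -- remains to see that overlapping discs give the same values.
  let α : ∀ x, Path a₀ (j x) := fun x => PathConnectedSpace.somePath _ _
  let seg : ∀ x, ∀ y ∈ Δ x, Path (j x) (j y) := fun x y hy =>
    { toFun := fun s => j (σ x (AffineMap.lineMap (π x) (π y) (s : ℝ)))
      continuous_toFun := hj.comp (((h1 x).mono (hBB x)).comp_continuous
        (AffineMap.lineMap_continuous.comp continuous_subtype_val) fun s =>
          (convex_ball (π x) (R x / 2)).lineMap_mem (hcB x) (hΔπ x y hy).1 s.2)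
      source' := by simp [h3]
      target' := by simp [(hΔπ x y hy).2] }
  have hseg : ∀ x y hy s, seg x y hy s ∈ j '' (σ x '' Metric.closedBall (π x) (R x / 2)) :=
    fun x y hy s => ⟨_, ⟨_, Metric.ball_subset_closedBall
      ((convex_ball (π x) (R x / 2)).lineMap_mem (hcB x) (hΔπ x y hy).1 s.2), rfl⟩, rfl⟩
  -- Simple connectedness gives a homotopy between the two routes to a common point. One common
  -- point for each pair of discs suffices, as their sections agree over a convex set.
  have hC : ∀ x y, ∃ C : Set A, IsCompact C ∧ ((Δ x ∩ Δ y).Nonempty → ∃ w, ∃ (hx : w ∈ Δ x)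
      (hy : w ∈ Δ y) (H : ((α x).trans (seg x w hx)).Homotopy ((α y).trans (seg y w hy))),
      range H ⊆ C) := by
    intro x y
    by_cases hne : (Δ x ∩ Δ y).Nonempty
    · obtain ⟨w, hx, hy⟩ := hne
      obtain ⟨H⟩ := SimplyConnectedSpace.paths_homotopic ((α x).trans (seg x w hx))
        ((α y).trans (seg y w hy))
      exact ⟨range H, isCompact_range H.continuous, fun _ => ⟨w, hx, hy, H, le_rfl⟩⟩
    · exact ⟨∅, isCompact_empty, fun h => absurd h hne⟩
  choose C hCc hCH using hC
  -- All the discs, paths and homotopies just chosen go into `L`, which does not depend on the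
  -- covering to be lifted through.
  refine ⟨{a₀} ∪ ((⋃ x ∈ t, j '' (σ x '' Metric.closedBall (π x) (R x / 2))) ∪
    ((⋃ x ∈ t, range (α x)) ∪ ⋃ x ∈ t, ⋃ y ∈ t, C x y)), ?_, Or.inl rfl, ?_⟩
  · refine isCompact_singleton.union ((t.isCompact_biUnion fun x _ => ?_).union
      ((t.isCompact_biUnion fun x _ => isCompact_range (α x).continuous).union
        (t.isCompact_biUnion fun x _ => t.isCompact_biUnion fun y _ => hCc x y)))
    exact ((isCompact_closedBall _ _).image_of_continuousOn ((h1 x).mono (hB x))).image hj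
  intro Y Z _ _ q hq φ O hφ hLO y₀ hy₀
  simp only [union_subset_iff, iUnion₂_subset_iff] at hLO
  obtain ⟨-, hLd, hLα, hLC⟩ := hLO
  have hαO : ∀ x ∈ t, ∀ s, α x s ∈ O := fun x hx s => hLα x hx ⟨s, rfl⟩
  have hsegO : ∀ x ∈ t, ∀ y hy s, seg x y hy s ∈ O := fun x hx y hy s => hLd x hx (hseg x y hy s)
  have htransO : ∀ x ∈ t, ∀ y hy s, (α x).trans (seg x y hy) s ∈ O := by
    intro x hx y hy s
    rw [Path.trans_apply]
    split_ifs
    · exact hαO x hx _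
    · exact hsegO x hx y hy _
  have hdO : ∀ x ∈ t, ∀ z ∈ B x, j (σ x z) ∈ O := fun x hx z hz =>
    hLd x hx ⟨_, ⟨z, Metric.ball_subset_closedBall hz, rfl⟩, rfl⟩
  have hF : ∀ x, ∃ F : ℂ → Y, ∀ hx : x ∈ t, ContinuousOn F (B x) ∧
      (∀ z ∈ B x, q (F z) = φ (j (σ x z))) ∧
      F (π x) = hq.liftPath ((α x).mapOn hφ (hαO x hx)) y₀ (by simp [hy₀]) 1 := by
    intro x
    by_cases hx : x ∈ t
    · have := (convex_ball (π x) (R x / 2)).contractibleSpace ⟨_, hcB x⟩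
      have := (convex_ball (π x) (R x / 2)).locallyPathConnectedSpace
      have hc : ContinuousOn (fun z => φ (j (σ x z))) (B x) :=
        hφ.comp (hj.comp_continuousOn ((h1 x).mono (hBB x))) (hdO x hx)
      obtain ⟨F, ⟨f1, f2⟩, -⟩ := hq.existsUnique_continuousMap_lifts (A := B x)
        ⟨fun z => φ (j (σ x z)), continuousOn_iff_continuous_domRestrict.1 hc⟩ ⟨π x, hcB x⟩
        (hq.liftPath ((α x).mapOn hφ (hαO x hx)) y₀ (by simp [hy₀]) 1) (by
          have := congrFun (hq.liftPath_lifts ((α x).mapOn hφ (hαO x hx)) y₀ (by simp [hy₀])) 1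
          rw [Function.comp_apply] at this
          refine this.trans ?_
          change _ = φ (j (σ x (π x)))
          rw [h3]
          simp)
      refine ⟨fun z => if hz : z ∈ B x then F ⟨z, hz⟩ else y₀, fun _ => ⟨?_, fun z hz => ?_, ?_⟩⟩
      · rw [continuousOn_iff_continuous_domRestrict]
        convert F.continuous using 1
        ext ⟨z, hz⟩
        simp [hz]
      · simp only [dif_pos hz]
        exact congrFun f2 ⟨z, hz⟩
      · simp only [dif_pos (hcB x)]
        exact f1
    · exact ⟨fun _ => y₀, fun h => absurd h hx⟩
  choose F hF using hF
  -- The value of the local lift at `y` is the endpoint of the lifted route, so monodromy along the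
  -- homotopy compares the local lifts.
  have hend : ∀ x (hx : x ∈ t) y (hy : y ∈ Δ x),
      hq.liftPath (((α x).trans (seg x y hy)).mapOn hφ (htransO x hx y hy)) y₀ (by simp [hy₀]) 1 =
        F x (π y) := by
    intro x hx y hy
    obtain ⟨f1, f2, f3⟩ := hF x hx
    let Γ₁ : Path y₀ (F x (π x)) :=
      ⟨hq.liftPath ((α x).mapOn hφ (hαO x hx)) y₀ (by simp [hy₀]), hq.liftPath_zero _ _ _, f3.symm⟩
    have hline : ∀ s : unitInterval, AffineMap.lineMap (π x) (π y) (s : ℝ) ∈ B x := fun s =>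
      (convex_ball (π x) (R x / 2)).lineMap_mem (hcB x) (hΔπ x y hy).1 s.2
    let Γ₂ : Path (F x (π x)) (F x (π y)) :=
      { toFun := fun s => F x (AffineMap.lineMap (π x) (π y) (s : ℝ))
        continuous_toFun := f1.comp_continuous
          (AffineMap.lineMap_continuous.comp continuous_subtype_val) hline
        source' := by simp
        target' := by simp }
    have h4 : ⇑(Γ₁.trans Γ₂) =
        hq.liftPath (((α x).trans (seg x y hy)).mapOn hφ (htransO x hx y hy)) y₀ (by simp [hy₀]) := by
      rw [hq.eq_liftPath_iff]
      refine ⟨(Γ₁.trans Γ₂).continuous, ?_, (Γ₁.trans Γ₂).source⟩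
      rw [Path.mapOn_trans hφ _ _ (hαO x hx) (hsegO x hx y hy)]
      ext s
      change q (Γ₁.trans Γ₂ s) = Path.trans _ _ s
      rw [Path.trans_apply, Path.trans_apply]
      split_ifs
      · exact congrFun (hq.liftPath_lifts ((α x).mapOn hφ (hαO x hx)) y₀ (by simp [hy₀])) _
      · exact f2 _ (hline _)
    rw [← h4]
    exact (Γ₁.trans Γ₂).target
  have hagree : ∀ x ∈ t, ∀ y ∈ t, ∀ w ∈ Δ x ∩ Δ y, F x (π w) = F y (π w) := by
    intro x hx y hy w hw
    obtain ⟨f1, f2, -⟩ := hF x hx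
    obtain ⟨g1, g2, -⟩ := hF y hy
    obtain ⟨w₀, hwx, hwy, H, hH⟩ := hCH x y ⟨w, hw⟩
    have h0 : F x (π w₀) = F y (π w₀) := by
      rw [← hend x hx w₀ hwx, ← hend y hy w₀ hwy]
      exact hq.liftPath_apply_one_eq_of_homotopicRel (Path.Homotopy.mapOn hφ H
        (fun s => hLC x hx y hy (hH ⟨s, rfl⟩)) (htransO x hx w₀ hwx) (htransO y hy w₀ hwy)) _ _ _
    have hconv := ((convex_ball (π x) (R x / 2)).inter (convex_ball (π y) (R y / 2))).isPreconnected
    have hσ : EqOn (σ x) (σ y) (B x ∩ B y) := hπ.eqOn_section hconv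
      ((h1 x).mono (inter_subset_left.trans (hBB x))) ((h1 y).mono (inter_subset_right.trans (hBB y)))
      (fun z hz => h2 x z (hBB x hz.1)) (fun z hz => h2 y z (hBB y hz.2))
      ⟨(hΔπ x w₀ hwx).1, (hΔπ y w₀ hwy).1⟩ ((hΔπ x w₀ hwx).2.trans (hΔπ y w₀ hwy).2.symm)
    exact hq.eqOn_of_comp_eqOn hconv (f1.mono inter_subset_left) (g1.mono inter_subset_right)
      (fun z hz => by
        rw [Function.comp_apply, Function.comp_apply, f2 z hz.1, g2 z hz.2, hσ hz])
      ⟨(hΔπ x w₀ hwx).1, (hΔπ y w₀ hwy).1⟩ h0 ⟨(hΔπ x w hw.1).1, (hΔπ y w hw.2).1⟩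
  let ψ : X → Y := fun y => if h : ∃ x ∈ t, y ∈ Δ x then F h.choose (π y) else y₀
  have hψ : ∀ x ∈ t, ∀ y ∈ Δ x, ψ y = F x (π y) := by
    intro x hx y hy
    have h : ∃ x ∈ t, y ∈ Δ x := ⟨x, hx, hy⟩
    simp only [ψ, dif_pos h]
    exact hagree _ h.choose_spec.1 x hx y ⟨h.choose_spec.2, hy⟩
  refine ⟨⋃ x ∈ t, Δ x, ψ, isOpen_biUnion fun x _ => hΔ x, ht, ?_, ?_, ?_⟩
  · intro y hy
    obtain ⟨x, hx, hyx⟩ := mem_iUnion₂.1 hy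
    rw [← (hΔπ x y hyx).2]
    exact hdO x hx _ (hΔπ x y hyx).1
  · intro y hy
    obtain ⟨x, hx, hyx⟩ := mem_iUnion₂.1 hy
    refine ContinuousAt.continuousWithinAt ?_
    have hc : ContinuousAt (fun y => F x (π y)) y :=
      ContinuousAt.comp (((hF x hx).1).continuousAt (Metric.isOpen_ball.mem_nhds (hΔπ x y hyx).1))
        hπ.continuous.continuousAt
    refine hc.congr ?_
    filter_upwards [(hΔ x).mem_nhds hyx] with y' hy' using (hψ x hx y' hy').symm
  · intro y hy
    obtain ⟨x, hx, hyx⟩ := mem_iUnion₂.1 hy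
    rw [hψ x hx y hyx, (hF x hx).2.1 _ (hΔπ x y hyx).1, (hΔπ x y hyx).2]

end Lifting

/-! ### Truncations -/

section Truncation

/-- Cover `K` by finitely many lifted closed discs and join each of them to `p` by a path. -/
theorem IsLocalHomeomorph.exists_isCompact_isConnected {X : Type u} [TopologicalSpace X]
    [PathConnectedSpace X] {π : X → ℂ} (hπ : IsLocalHomeomorph π) (p : X) {K : Set X}
    (hK : IsCompact K) : ∃ K', IsCompact K' ∧ IsConnected K' ∧ p ∈ K' ∧ K ⊆ K' := by
  refine hK.induction_on (p := fun K => ∃ K', IsCompact K' ∧ IsConnected K' ∧ p ∈ K' ∧ K ⊆ K')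
    ⟨{p}, isCompact_singleton, isConnected_singleton, rfl, empty_subset _⟩
    (fun _ _ h ⟨K', h1, h2, h3, h4⟩ => ⟨K', h1, h2, h3, h.trans h4⟩) ?_ ?_
  · rintro s t ⟨K', h1, h2, h3, h4⟩ ⟨L', g1, g2, g3, g4⟩
    exact ⟨K' ∪ L', h1.union g1, h2.union ⟨p, h3, g3⟩ g2, Or.inl h3, union_subset_union h4 g4⟩
  · intro x _
    obtain ⟨r, hr, σ, hσ, hσπ, hσx, -⟩ := hπ.exists_disc x univ_mem
    have hB : Metric.closedBall (π x) (r / 2) ⊆ Metric.ball (π x) r :=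
      Metric.closedBall_subset_ball (half_lt_self hr)
    have hB' : Metric.ball (π x) (r / 2) ⊆ Metric.ball (π x) r :=
      Metric.ball_subset_ball (half_le_self hr.le)
    let γ := PathConnectedSpace.somePath p x
    refine ⟨σ '' Metric.ball (π x) (r / 2), mem_nhdsWithin_of_mem_nhds
      ((hπ.isOpen_image_section Metric.isOpen_ball (hσ.mono hB') fun z hz => hσπ z (hB' hz)).mem_nhds
        ⟨π x, Metric.mem_ball_self (half_pos hr), hσx⟩),
      range γ ∪ σ '' Metric.closedBall (π x) (r / 2),
      (isCompact_range γ.continuous).union ((isCompact_closedBall _ _).image_of_continuousOn (hσ.mono hB)),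
      (isConnected_range γ.continuous).union ⟨x, ⟨1, γ.target⟩, π x,
          Metric.mem_closedBall_self (half_pos hr).le, hσx⟩
        (((convex_closedBall _ _).isConnected ⟨π x, Metric.mem_closedBall_self (half_pos hr).le⟩).image σ
          (hσ.mono hB)), Or.inl ⟨0, γ.source⟩,
      (image_mono Metric.ball_subset_closedBall).trans subset_union_right⟩

/-- An injective map between spaces étale over the plane which commutes with the projections
preserves the path metrics. -/
theorem flatEDistIn_image {X : Type u} {Y : Type v} [TopologicalSpace X] [TopologicalSpace Y]
    {π : X → ℂ} {ρ : Y → ℂ} (hπ : IsLocalHomeomorph π) (hρ : IsLocalHomeomorph ρ) {U : Set X}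
    (hU : IsOpen U) {ι : X → Y} (hι : ContinuousOn ι U) (hinj : InjOn ι U)
    (hc : ∀ x ∈ U, ρ (ι x) = π x) {x y : X} (hx : x ∈ U) (hy : y ∈ U) :
    flatEDistIn ρ (ι '' U) (ι x) (ι y) = flatEDistIn π U x y := by
  refine le_antisymm (le_iInf₂ fun γ hγ => ?_) (le_iInf₂ fun γ hγ => ?_)
  · refine (iInf₂_le (γ.mapOn hι hγ) fun t => ⟨γ t, hγ t, rfl⟩).trans (le_of_eq ?_)
    exact congrArg (eVariationOn · univ) (funext fun t => hc _ (hγ t))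
  · have hr : IsLocalHomeomorph (ρ ∘ U.domRestrict ι) := by
      have : ρ ∘ U.domRestrict ι = π ∘ ((↑) : U → X) := funext fun z => hc z z.2
      rw [this]
      exact hπ.comp hU.isOpenEmbedding_subtypeVal.isLocalHomeomorph
    -- An injective lift of a local homeomorphism through another one is an open embedding, so paths
    -- in the image pull back continuously.
    have hemb : IsOpenEmbedding (U.domRestrict ι) :=
      (IsLocalHomeomorph.of_comp hr hρ (continuousOn_iff_continuous_domRestrict.1
        hι)).isOpenEmbedding_of_injective (injOn_iff_injective.1 hinj)
    let e := hemb.isEmbedding.toHomeomorph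
    have hγ' : ∀ t, γ t ∈ range (U.domRestrict ι) := fun t => by
      obtain ⟨z, hz, h⟩ := hγ t
      exact ⟨⟨z, hz⟩, h⟩
    have he : ∀ t, ι (e.symm ⟨γ t, hγ' t⟩ : U) = γ t := fun t =>
      congrArg Subtype.val (e.apply_symm_apply ⟨γ t, hγ' t⟩)
    let γ₁ : Path x y :=
      { toFun := fun t => (e.symm ⟨γ t, hγ' t⟩ : U)
        continuous_toFun := continuous_subtype_val.comp
          (e.symm.continuous.comp (γ.continuous.subtype_mk hγ'))
        source' := hinj (Subtype.prop _) hx ((he 0).trans γ.source)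
        target' := hinj (Subtype.prop _) hy ((he 1).trans γ.target) }
    refine (iInf₂_le γ₁ fun t => Subtype.prop _).trans (le_of_eq ?_)
    refine congrArg (eVariationOn · univ) (funext fun t => ?_)
    change π (e.symm ⟨γ t, hγ' t⟩ : U) = ρ (γ t)
    rw [← hc _ (Subtype.prop _), he]

theorem LogRiemannSurface.isLocalHomeomorph (S : LogRiemannSurface.{u}) : IsLocalHomeomorph S.π :=
  S.isLocalDiffeomorph.isLocalHomeomorph

theorem LogRiemannSurface.IsIsometricEmbeddingOn.mono {S : LogRiemannSurface.{u}}
    {T : LogRiemannSurface.{v}} {K K' : Set S} {ι : S → T} (h : S.IsIsometricEmbeddingOn T K' ι)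
    (hK : K ⊆ K') : S.IsIsometricEmbeddingOn T K ι := by
  obtain ⟨U, h1, h2, h3, h4⟩ := h
  exact ⟨U, h1, h2, hK.trans h3, h4⟩

/-- An injective lift of the projection to the regular points of a branched covering is an isometric
embedding into its surface. -/
theorem LogRiemannSurface.exists_isIsometricEmbeddingOn_surface (S : LogRiemannSurface.{u})
    {I : Type u} [Finite I] [Nonempty I] {D : SlitData I} {θ : ℂ} (hθ : ‖θ‖ = 1)
    (hD : D.Transitive) {U : Set S} (hU : IsOpen U) (hUc : IsConnected U) {ψ : S → D.Space}
    (hψ : ContinuousOn ψ U) (hi : InjOn ψ U) (hreg : ∀ x ∈ U, D.IsReg (ψ x))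
    (hpr : ∀ x ∈ U, D.proj θ (ψ x) = S.π x) {K : Set S} (hK : K ⊆ U) :
    ∃ ι : S → D.surface hθ hD, S.IsIsometricEmbeddingOn (D.surface hθ hD) K ι := by
  classical
  obtain ⟨p, hp⟩ := hUc.nonempty
  let ι : S → D.reg := fun x => if h : x ∈ U then ⟨ψ x, hreg x h⟩ else ⟨ψ p, hreg p hp⟩
  have hι : ∀ x ∈ U, (ι x : D.Space) = ψ x := fun x hx => by simp [ι, hx]
  have h1 : ContinuousOn ι U :=
    Topology.IsInducing.subtypeVal.continuousOn_iff.2 (hψ.congr hι)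
  have h2 : InjOn ι U := fun x hx y hy h => hi hx hy (by rw [← hι x hx, h, hι y hy])
  have h3 : ∀ x ∈ U, (D.proj θ ∘ ((↑) : D.reg → D.Space)) (ι x) = S.π x := fun x hx => by
    rw [Function.comp_apply, hι x hx, hpr x hx]
  refine ⟨ι, U, hU, hUc, hK, h1, h2, ⟨0, fun x hx => (h3 x hx).trans (add_zero _).symm⟩, ?_⟩
  exact fun x hx y hy => flatEDistIn_image S.isLocalHomeomorph (D.isLocalHomeomorph_proj hθ) hU h1 h2
    h3 hx hy

variable (S : LogRiemannSurface.{u}) (p : S)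

theorem LogRiemannSurface.exists_connected_nhds [LocallyConnectedSpace S] {K : Set S}
    (hK : IsConnected K) (hp : p ∈ K) {V : Set S} (hV : IsOpen V) (hKV : K ⊆ V) :
    ∃ U, IsOpen U ∧ IsConnected U ∧ p ∈ U ∧ K ⊆ U ∧ U ⊆ V :=
  ⟨connectedComponentIn V p, hV.connectedComponentIn, isConnected_connectedComponentIn_iff.2 (hKV hp),
    mem_connectedComponentIn (hKV hp), hK.isPreconnected.subset_connectedComponentIn hp hKV,
    connectedComponentIn_subset V p⟩

/-- Near a compact set, a log-Riemann surface embeds isometrically into one with finitely many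
ramification points, all of finite order. -/
theorem LogRiemannSurface.exists_truncation {K : Set S} (hK : IsCompact K) :
    ∃ (T : LogRiemannSurface.{u}) (ι : S → T), S.IsIsometricEmbeddingOn T K ι ∧
      T.ram.Finite ∧ ∀ w ∈ T.ram, HasFiniteRamificationOrder T.π w := by
  classical
  have : LocallyPathConnectedSpace S := ChartedSpace.locallyPathConnectedSpace ℂ S
  have : PathConnectedSpace S := .of_locallyPathConnectedSpace
  have : LocallyConnectedSpace S := ChartedSpace.locallyConnectedSpace ℂ S
  have hπ := S.isLocalHomeomorph
  have p : S := Classical.arbitrary S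
  obtain ⟨K', hK', hKc, hp, hKK⟩ := hπ.exists_isCompact_isConnected p hK
  have hj := hπ.isOpenEmbedding_toFlatCompletion.continuous
  obtain ⟨O, θ, I, _, D, φ, hO, hKO, hθ, hφ, hpr, hreg, hinj⟩ :=
    exists_slitData_of_isCompact hπ (hK'.image hj) (hKc.nonempty.image _) (by
      rintro _ ⟨x, -, rfl⟩
      obtain ⟨r, W, h, -⟩ := hπ.exists_isFiniteCone x univ_mem
      exact ⟨r, W, h⟩)
  obtain ⟨U, hU, hUc, hpU, hKU, hUO⟩ :=
    S.exists_connected_nhds p hKc hp (hO.preimage hj) (image_subset_iff.1 hKO)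
  have hψ : ContinuousOn (φ ∘ toFlatCompletion S.π) U := hφ.comp hj.continuousOn hUO
  obtain ⟨z, i₀, hz⟩ : ∃ z i₀, φ (toFlatCompletion S.π p) = D.pt z i₀ := by
    induction φ (toFlatCompletion S.π p) using D.ind with | _ z i => exact ⟨z, i, rfl⟩
  have hi₀ : i₀ ∈ D.orbit i₀ := .refl _
  -- The covering built so far may be disconnected. The connected set `U` sees only the orbit of one
  -- sheet, and restricting to that orbit gives transitive data.
  have hclopen : IsClopen (D.onSheets (D.orbit i₀)) := D.isClopen_onSheets
    (fun a k h => (D.perm_mem_orbit i₀ a k).2 h) fun a k h h' => h ((D.perm_mem_orbit i₀ a k).1 h')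
  have hsheets : ∀ x ∈ U, φ (toFlatCompletion S.π x) ∈ D.onSheets (D.orbit i₀) := by
    have h := (hUc.isPreconnected.image _ hψ).subset_isClopen hclopen
      ⟨_, mem_image_of_mem _ hpU, fun w k hk => ?_⟩
    · exact fun x hx => h (mem_image_of_mem _ hx)
    · have h1 := hreg p (hUO hpU)
      rw [hz] at h1
      rw [Function.comp_apply, hz] at hk
      rwa [D.isReg_pt.1 h1 k (D.pt_eq_pt.1 hk).2]
  have : Nonempty (D.orbit i₀) := ⟨⟨i₀, hi₀⟩⟩
  obtain ⟨ψ, h1, h2, h3, h4⟩ := SlitData.exists_map_of_equivariantOn (D' := D.component i₀)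
    (G := D.orbit i₀) (f := fun k => if h : k ∈ D.orbit i₀ then ⟨k, h⟩ else ⟨i₀, hi₀⟩) rfl
    (fun a k hk => by
      have hk' := (D.perm_mem_orbit i₀ a k).2 hk
      simp only [dif_pos hk, dif_pos hk']
      rfl)
    (fun k hk l hl h => by
      simp only [dif_pos hk, dif_pos hl] at h
      exact congrArg Subtype.val h)
    hψ (hinj.mono hUO) (fun x hx => hreg x (hUO hx)) hsheets
  have hT := D.transitive_component i₀
  obtain ⟨ι, hι⟩ := S.exists_isIsometricEmbeddingOn_surface hθ hT hU hUc h1 h2 h3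
    (fun x hx => by
      rw [SlitData.proj, h4 x hx, ← flatExtension_toFlatCompletion S.π x, ← hpr _ (hUO hx)]
      rfl) (hKK.trans hKU)
  exact ⟨_, ι, hι, SlitData.finite_ram_surface hθ _ hT,
    SlitData.hasFiniteRamificationOrder_surface hθ _ hT⟩

/-- If the finite completion is simply connected, then the truncation can be chosen with simply
connected finite completion. -/
theorem LogRiemannSurface.exists_simplyConnected_truncation [SimplyConnectedSpace S.finiteCompletion]
    {K : Set S} (hK : IsCompact K) :
    ∃ (T : LogRiemannSurface.{u}) (ι : S → T), S.IsIsometricEmbeddingOn T K ι ∧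
      T.ram.Finite ∧ (∀ w ∈ T.ram, HasFiniteRamificationOrder T.π w) ∧
      SimplyConnectedSpace T.finiteCompletion := by
  have : LocallyPathConnectedSpace S := ChartedSpace.locallyPathConnectedSpace ℂ S
  have : PathConnectedSpace S := .of_locallyPathConnectedSpace
  have : LocallyConnectedSpace S := ChartedSpace.locallyConnectedSpace ℂ S
  have : LocallyCompactSpace S := ChartedSpace.locallyCompactSpace ℂ S
  have hπ := S.isLocalHomeomorph
  have p : S := Classical.arbitrary S
  obtain ⟨K', hK', hKc, hp, hKK⟩ := hπ.exists_isCompact_isConnected p hK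
  let j : S → S.finiteCompletion := fun x => ⟨toFlatCompletion S.π x, Or.inl ⟨x, rfl⟩⟩
  have hj : Continuous j := hπ.isOpenEmbedding_toFlatCompletion.continuous.subtype_mk _
  -- `L` is chosen before the finite covering, which is then constructed near `L`. Its homotopies
  -- may pass through ramification points of finite order, hence the need for cones there.
  obtain ⟨L, hL, hpL, hlift⟩ := exists_isCompact_lift hπ hj (j p) hK'
  obtain ⟨O, θ, I, _, D, φ, hO, hLO, hθ, hφ, hpr, hreg, hinj⟩ :=
    exists_slitData_of_isCompact hπ (hL.image continuous_subtype_val) ⟨_, mem_image_of_mem _ hpL⟩ (by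
      rintro _ ⟨⟨_, ⟨x, rfl⟩ | hξ⟩, -, rfl⟩
      · obtain ⟨r, W, h, -⟩ := hπ.exists_isFiniteCone x univ_mem
        exact ⟨r, W, h⟩
      · exact hξ.exists_isFiniteCone)
  obtain ⟨z, i₀, hz⟩ : ∃ z i₀, φ (toFlatCompletion S.π p) = D.pt z i₀ := by
    induction φ (toFlatCompletion S.π p) using D.ind with | _ z i => exact ⟨z, i, rfl⟩
  -- The lift starts at the empty word over the image of `p`. It inherits injectivity and regular
  -- values from the map it lifts.
  obtain ⟨V, ψ, hV, hKV, hVO, hψ, hψφ⟩ := hlift (D.isCoveringMap_wordData i₀)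
    (φ := fun a : S.finiteCompletion => φ a) (O := Subtype.val ⁻¹' O)
    (hφ.comp continuous_subtype_val.continuousOn fun _ h => h) (image_subset_iff.1 hLO)
    ((D.wordData i₀).pt z ⟨[], trivial⟩) hz.symm
  -- A compact neighbourhood inside the domain of the lift bounds the length of the words on all of
  -- `U`.
  obtain ⟨L', hL', hKL', hLV'⟩ := exists_compact_between hK' hV hKV
  obtain ⟨U, hU, hUc, hpU, hKU, hUL⟩ := S.exists_connected_nhds p hKc hp isOpen_interior hKL'
  have hUL' : U ⊆ L' := hUL.trans interior_subset
  have hUV : U ⊆ V := hUL'.trans hLV'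
  obtain ⟨n, hn⟩ := D.exists_length_lt i₀ (hL'.image_of_continuousOn (hψ.mono hLV'))
  obtain ⟨χ, h1, h2, h3, h4⟩ := SlitData.exists_map_treeData (i₀ := i₀) (n := n) (hψ.mono hUV)
    (fun x hx y hy h => hinj (hVO (hUV hx)) (hVO (hUV hy)) (by
      have := congrArg (SlitData.map (D := D.wordData i₀) (D' := D) (f := D.wordEnd i₀)
        (D.height_wordData i₀) (D.endSheet_wordPerm i₀)) h
      rwa [hψφ x (hUV hx), hψφ y (hUV hy)] at this))
    (fun x hx => D.isReg_of_isReg_map i₀ (by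
      rw [hψφ x (hUV hx)]
      exact hreg x (hVO (hUV hx))))
    (fun x hx => hn (mem_image_of_mem _ (hUL' hx)))
  have : Nonempty (D.ShortWord i₀ n) := ⟨⟨⟨[], trivial⟩, Nat.zero_le _⟩⟩
  have hT := SlitData.transitive_treeData (D := D) (i₀ := i₀) (n := n)
  have := (SlitData.isTree_treeData (D := D) (i₀ := i₀) (n := n)).simplyConnectedSpace
  obtain ⟨ι, hι⟩ := S.exists_isIsometricEmbeddingOn_surface hθ hT hU hUc h1 h2 h3
    (fun x hx => by
      rw [SlitData.proj, h4 x hx, ← flatExtension_toFlatCompletion S.π x, ← hpr _ (hVO (hUV hx)),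
        SlitData.proj]
      congr 1
      rw [← SlitData.pr_map (D.height_wordData i₀) (D.endSheet_wordPerm i₀), hψφ x (hUV hx)])
    (hKK.trans hKU)
  exact ⟨_, ι, hι, SlitData.finite_ram_surface hθ _ hT,
    SlitData.hasFiniteRamificationOrder_surface hθ _ hT,
    SlitData.simplyConnectedSpace_finiteCompletion hθ _ hT⟩

end Truncation

end

theorem theorem2p10 (S : LogRiemannSurface.{u}) (p : S) :
    ∃ (T : ℕ → LogRiemannSurface.{u}) (q : ∀ n, T n),
      LogRiemannSurface.CaratheodoryConverges T q S p ∧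
      (∀ n, (T n).ram.Finite ∧ ∀ w ∈ (T n).ram, HasFiniteRamificationOrder (T n).π w) ∧
      (SimplyConnectedSpace S.finiteCompletion →
        ∀ n, SimplyConnectedSpace (T n).finiteCompletion) := by
  have : SigmaCompactSpace S := S.isLocalHomeomorph.sigmaCompactSpace
  have : LocallyCompactSpace S := ChartedSpace.locallyCompactSpace ℂ S
  have key : ∀ K : Set S, IsCompact K → ∃ (T : LogRiemannSurface.{u}) (ι : S → T),
      S.IsIsometricEmbeddingOn T K ι ∧
      (T.ram.Finite ∧ ∀ w ∈ T.ram, HasFiniteRamificationOrder T.π w) ∧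
      (SimplyConnectedSpace S.finiteCompletion → SimplyConnectedSpace T.finiteCompletion) := by
    intro K hK
    -- The sequence is chosen before the simple connectedness hypothesis is available, so the choice
    -- of construction is made by cases.
    by_cases hS : SimplyConnectedSpace S.finiteCompletion
    · obtain ⟨T, ι, h1, h2, h3, h4⟩ := S.exists_simplyConnected_truncation hK
      exact ⟨T, ι, h1, ⟨h2, h3⟩, fun _ => h4⟩
    · obtain ⟨T, ι, h1, h2⟩ := S.exists_truncation hK
      exact ⟨T, ι, h1, h2, fun h => absurd h hS⟩
  let E := CompactExhaustion.choice S
  choose T ι h1 h2 h3 using fun n => key (E n) (E.isCompact n)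
  -- The base points are the images of `p`. For small `n` the set `E n` may miss `p`, which does not
  -- affect the limit.
  refine ⟨T, fun n => ι n p, fun K hK _ => ?_, h2, fun h n => h3 n h⟩
  obtain ⟨N, hN⟩ := E.exists_superset_of_isCompact hK
  exact ⟨N, fun n hn => ⟨ι n, (h1 n).mono (hN.trans (E.subset hn)), rfl⟩⟩
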